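/- Let $n\ge 1$, $d\ge 0$ be integers and let $X=(X_1,\dots,X_n)$ be a vector of $\mathbb R^d$-valued random variables, possibly dependent, with $\mathbb E|X_i|^2<\infty$ and with a joint Lebesgue density $p$ on $(\mathbb R^d)^n$ such that $p\log p$ is integrable. Let $\tilde X_1,\dots,\tilde X_n$ be independent random variables such that $\tilde X_i$ has the same law as $X_i$ for each $i$, and let $Z_1,\dots,Z_n$ be independent standard Gaussian vectors of $\mathbb R^d$ such that $(Z_1,\dots,Z_n)$ is independent of $(X_1,\dots,X_n)$ and of $(\tilde X_1,\dots,\tilde X_n)$. For $t\ge 0$ set $$Y_i(t)=e^{-t}X_i+\sqrt{1-e^{-2t}}\,Z_i,\qquad \tilde Y_i(t)=e^{-t}\tilde X_i+\sqrt{1-e^{-2t}}\,Z_i .$$ For a random vector $W$ with density $f$ write $h(W)=-\int f\log f$. For a random vector $V=(V_1,\dots,V_n)$ of $(\mathbb R^d)^n$ with $C^1$ density $q$, let $\rho_i=-\nabla_i q/q\in\mathbb R^d$ be the $i$-th block of its score function, and let $\mathbf I(V)$ be its Fisher information matrix, the $n\times n$ matrix with entries $I_{ij}(V)=\mathbb E\langle\rho_i(V),\rho_j(V)\rangle$.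 Put $$\mathbf R_t=\int_0^t\big(\mathbf I(Y(s))-\mathbf I(\tilde Y(s))\big)\,ds .$$ Let $\lambda=(\lambda_1,\dots,\lambda_n)$ with $\lambda_i\in(0,1)$ and $\sum_{i=1}^n\lambda_i^2=1$. Then all these quantities are well defined: for every $t\ge0$ the vectors $X_i$, $\sum_i\lambda_iX_i$, $Y_i(t)$ and $\sum_i\lambda_iY_i(t)$ have densities and finite entropies; for every $s>0$ the vectors $Y(s)$ and $\tilde Y(s)$ have $C^1$ densities and square integrable scores; and the entries of $\mathbf I(Y(s))-\mathbf I(\tilde Y(s))$ are integrable in $s$ on $[0,t]$ for every $t\ge0$. For all $t\ge 0$, $$h\Big(\sum_{i=1}^n\lambda_iY_i(t)\Big)-\sum_{i=1}^n\lambda_i^2h(Y_i(t))\le h\Big(\sum_{i=1}^n\lambda_iX_i\Big)-\sum_{i=1}^n\lambda_i^2h(X_i)+\lambda^T\mathbf R_t\lambda .$$ In particular, $$h\Big(\sum_{i=1}^n\lambda_iX_i\Big)\ge\sum_{i=1}^n\lambda_i^2h(X_i)-\limsup_{t\to\infty}\lambda^T\mathbf R_t\lambda ,$$ where the upper limit is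 taken in $[-\infty,\infty]$. -/

import Mathlib

open MeasureTheory ProbabilityTheory Filter Topology Set

namespace DependentEPI

noncomputable section

/-- The differential (Shannon) entropy `-∫ f log f` of a law `μ` with Lebesgue density `f`. -/
def entropy {E : Type*} [MeasureSpace E] (μ : Measure E) : ℝ :=
  ∫ x, Real.negMulLog (μ.rnDeriv volume x).toReal

/-- The law `μ` has a Lebesgue density `f`, and `f log f` is integrable: its entropy is well
defined and finite. -/
structure FiniteEntropy {E : Type*} [MeasureSpace E] (μ : Measure E) : Prop where
  absolutelyContinuous : μ ≪ volume
  integrable : Integrable (fun x => Real.negMulLog (μ.rnDeriv volume x).toReal) volume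

/-- `f` is a continuously differentiable density of the law `μ` on `(ℝ^d)^n`. -/
structure IsSmoothDensity {n d : ℕ} (μ : Measure (Fin n → EuclideanSpace ℝ (Fin d)))
    (f : (Fin n → EuclideanSpace ℝ (Fin d)) → ℝ) : Prop where
  contDiff : ContDiff ℝ 1 f
  nonneg : ∀ x, 0 ≤ f x
  eq_withDensity : μ = volume.withDensity (fun x => ENNReal.ofReal (f x))

/-- A continuously differentiable density is unique. -/
theorem IsSmoothDensity.unique {n d : ℕ} {μ : Measure (Fin n → EuclideanSpace ℝ (Fin d))}
    {f g : (Fin n → EuclideanSpace ℝ (Fin d)) → ℝ}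
    (hf : IsSmoothDensity μ f) (hg : IsSmoothDensity μ g) : f = g := by
  have hfc := hf.contDiff.continuous
  have hgc := hg.contDiff.continuous
  have h := hf.eq_withDensity.symm.trans hg.eq_withDensity
  rw [withDensity_eq_iff_of_sigmaFinite
    hfc.measurable.ennreal_ofReal.aemeasurable
    hgc.measurable.ennreal_ofReal.aemeasurable] at h
  refine (hfc.ae_eq_iff_eq (μ := volume) hgc).1 ?_
  filter_upwards [h] with x hx
  exact (ENNReal.ofReal_eq_ofReal_iff (hf.nonneg x) (hg.nonneg x)).1 hx

open Classical in
/-- The continuously differentiable density of the law `μ` (and `0` if there is none). -/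
def smoothDensity {n d : ℕ} (μ : Measure (Fin n → EuclideanSpace ℝ (Fin d))) :
    (Fin n → EuclideanSpace ℝ (Fin d)) → ℝ :=
  if h : ∃ f, IsSmoothDensity μ f then h.choose else 0

theorem IsSmoothDensity.smoothDensity_eq {n d : ℕ}
    {μ : Measure (Fin n → EuclideanSpace ℝ (Fin d))}
    {f : (Fin n → EuclideanSpace ℝ (Fin d)) → ℝ}
    (hf : IsSmoothDensity μ f) : smoothDensity μ = f := by
  have h : ∃ f, IsSmoothDensity μ f := ⟨f, hf⟩
  rw [smoothDensity, dif_pos h]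
  exact h.choose_spec.unique hf

/-- The `i`-th block `∇_i f (x) ∈ ℝ^d` of the gradient of a function `f` on `(ℝ^d)^n`. -/
def blockGradient {n d : ℕ} (f : (Fin n → EuclideanSpace ℝ (Fin d)) → ℝ) (i : Fin n)
    (x : Fin n → EuclideanSpace ℝ (Fin d)) : EuclideanSpace ℝ (Fin d) :=
  gradient (fun y => f (Function.update x i y)) (x i)

/-- The `i`-th block `ρ_i = -∇_i p / p` of the score function of a law with density `p`. -/
def score {n d : ℕ} (μ : Measure (Fin n → EuclideanSpace ℝ (Fin d))) (i : Fin n)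
    (x : Fin n → EuclideanSpace ℝ (Fin d)) : EuclideanSpace ℝ (Fin d) :=
  -((smoothDensity μ x)⁻¹ • blockGradient (smoothDensity μ) i x)

/-- The Fisher information matrix `I_{ij} = 𝔼 ⟨ρ_i, ρ_j⟩`, an `n × n` matrix. -/
def fisherMatrix {n d : ℕ} (μ : Measure (Fin n → EuclideanSpace ℝ (Fin d))) :
    Matrix (Fin n) (Fin n) ℝ :=
  Matrix.of fun i j => ∫ x, inner ℝ (score μ i x) (score μ j x) ∂μ

/-- The Fisher information matrix of `μ` is well defined: there is a continuously differentiable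
density and all blocks of the score function are square integrable. -/
structure FiniteFisher {n d : ℕ} (μ : Measure (Fin n → EuclideanSpace ℝ (Fin d))) : Prop where
  exists_density : ∃ f, IsSmoothDensity μ f
  memLp_score : ∀ i, MemLp (score μ i) 2 μ

/-- The joint law of the random vector `(X_1, …, X_n)`. -/
def jointLaw {n d : ℕ} {Ω : Type*} [MeasurableSpace Ω] (P : Measure Ω)
    (X : Fin n → Ω → EuclideanSpace ℝ (Fin d)) : Measure (Fin n → EuclideanSpace ℝ (Fin d)) :=
  P.map (fun ω i => X i ω)

/-- The Ornstein-Uhlenbeck flow `Y_i(t) = e^{-t} X_i + √(1 - e^{-2t}) Z_i`. -/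
def ouFlow {n d : ℕ} {Ω : Type*} (X Z : Fin n → Ω → EuclideanSpace ℝ (Fin d)) (t : ℝ) :
    Fin n → Ω → EuclideanSpace ℝ (Fin d) :=
  fun i ω => Real.exp (-t) • X i ω + Real.sqrt (1 - Real.exp (-2 * t)) • Z i ω

/-- The weighted sum `∑ i, l_i X_i`. -/
def weightedSum {n d : ℕ} {Ω : Type*} (l : Fin n → ℝ)
    (X : Fin n → Ω → EuclideanSpace ℝ (Fin d)) : Ω → EuclideanSpace ℝ (Fin d) :=
  fun ω => ∑ i, l i • X i ω

/-- The matrix `R_t = ∫_0^t (I(Y(s)) - I(Y'(s))) ds` (entrywise), where `Y` and `Y'` are the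
Ornstein-Uhlenbeck flows of `X` and of `X'` driven by the same `Z`. -/
def fisherGap {n d : ℕ} {Ω : Type*} [MeasurableSpace Ω] (P : Measure Ω)
    (X X' Z : Fin n → Ω → EuclideanSpace ℝ (Fin d)) (t : ℝ) : Matrix (Fin n) (Fin n) ℝ :=
  Matrix.of fun i j => ∫ s in (0 : ℝ)..t,
    (fisherMatrix (jointLaw P (ouFlow X Z s)) i j - fisherMatrix (jointLaw P (ouFlow X' Z s)) i j)

end

end DependentEPI

open DependentEPI

/-!
The proof is the semigroup argument along the Ornstein-Uhlenbeck flow. Let `D(t)` be the entropy of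
`∑ λ_i Y_i(t)` minus `∑ λ_i² h(Y_i(t))`.

By de Bruijn's identity the entropy of an Ornstein-Uhlenbeck flow on `ℝ^d` has derivative `J - d`,
where `J` is the trace of the Fisher information (`hasDerivAt_integral_negMulLog_heatFlow`,
`hasDerivAt_entropy_ouLaw`). Hence `D(t) - D(0)` is the integral of
`J(∑ λ_i Y_i) - ∑ λ_i² J(Y_i)`, the constants cancelling because `∑ λ_i² = 1`.

The score of `X + √s Z` is the conditional expectation of `Z / √s` given the sum (Tweedie's
formula, `integral_inner_heatScore`). As `y ↦ ∑ λ_i y_i` is a co-isometry, the score of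
`∑ λ_i Y_i` is the conditional expectation of `∑ λ_i ρ_i(Y)`, so that
`J(∑ λ_i Y_i) ≤ λᵀ I(Y) λ` (`heatFisher_map_le`, `ouFisher_map_weightedSumL_le`). For the independent
copies the scores of different blocks are independent and centred, so that `I(Y')` is the diagonal
matrix with entries `J(Y_i)` (`ouFisherMatrix_map_toLp_pi`). Together this gives
`D(t) ≤ D(0) + λᵀ R_t λ` (`entropyDeficit_ouLaw_le`).

The delicate point is the initial time, where the laws need not have a finite Fisher information.
There the entropy is continuous (`tendsto_integral_negMulLog_heatFlow`): adding a Gaussian does not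
decrease the entropy, and the relative entropy with respect to the standard Gaussian is lower
semicontinuous. As `J` is nonnegative, it is then integrable up to time zero
(`intervalIntegrable_ouFisher`), and it dominates the entries of the Fisher information matrix.
Finiteness of the entropies of the blocks and of the weighted sum is data processing for the relative
entropy with respect to the standard Gaussian (`finiteEntropy_map_of_coisometry`).

As `t → ∞`, entropy bounds of Gaussian type give `liminf D(t) ≥ 0`
(`exists_tendsto_le_entropyDeficit`), which yields the second inequality.

The analysis is carried out for laws on an arbitrary finite-dimensional real inner product space. It
is applied to the joint law on the Hilbert sum of `n` copies of `ℝ^d`, and to its images under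
weighted sums and coordinate projections.
-/

namespace DependentEPI

noncomputable section

set_option linter.unusedSectionVars false

section

variable {E : Type*} [NormedAddCommGroup E] [InnerProductSpace ℝ E]

/-! ### The heat kernel -/

/-- The centred Gaussian density of covariance `s • 1` on a finite-dimensional inner product
space. -/
def heatKernel (s : ℝ) (r : E) : ℝ :=
  (2 * Real.pi * s) ^ (-(Module.finrank ℝ E / 2 : ℝ)) * Real.exp (-‖r‖ ^ 2 / (2 * s))

theorem heatKernel_pos {s : ℝ} (hs : 0 < s) (r : E) : 0 < heatKernel s r := by
  unfold heatKernel
  have := Real.pi_pos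
  positivity

theorem heatKernel_le {s : ℝ} (hs : 0 < s) (r : E) :
    heatKernel s r ≤ (2 * Real.pi * s) ^ (-(Module.finrank ℝ E / 2 : ℝ)) := by
  unfold heatKernel
  refine mul_le_of_le_one_right (by have := Real.pi_pos; positivity) ?_
  rw [Real.exp_le_one_iff, neg_div]
  have : 0 ≤ ‖r‖ ^ 2 / (2 * s) := by positivity
  linarith

theorem log_heatKernel {s : ℝ} (hs : 0 < s) (r : E) :
    Real.log (heatKernel s r) =
      -(Module.finrank ℝ E / 2 : ℝ) * Real.log (2 * Real.pi * s) - ‖r‖ ^ 2 / (2 * s) := by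
  have := Real.pi_pos
  unfold heatKernel
  rw [Real.log_mul (by positivity) (by positivity), Real.log_rpow (by positivity), Real.log_exp]
  ring

theorem continuous_heatKernel (s : ℝ) : Continuous (heatKernel s : E → ℝ) := by
  unfold heatKernel
  fun_prop

/-- Parabolic scaling of the heat kernel. -/
theorem heatKernel_smul {c s : ℝ} (hc : 0 < c) (hs : 0 < s) (r : E) :
    heatKernel (c ^ 2 * s) (c • r) = c⁻¹ ^ Module.finrank ℝ E * heatKernel s r := by
  have := Real.pi_pos
  unfold heatKernel
  have h1 : 2 * Real.pi * (c ^ 2 * s) = c ^ 2 * (2 * Real.pi * s) := by ring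
  have h2 : -‖c • r‖ ^ 2 / (2 * (c ^ 2 * s)) = -‖r‖ ^ 2 / (2 * s) := by
    rw [norm_smul, Real.norm_of_nonneg hc.le]
    field_simp
  have h3 : (c ^ 2) ^ (-(Module.finrank ℝ E / 2 : ℝ)) = c⁻¹ ^ Module.finrank ℝ E := by
    rw [← Real.rpow_natCast c 2, ← Real.rpow_mul hc.le, ← Real.rpow_natCast c⁻¹,
      Real.inv_rpow hc.le, ← Real.rpow_neg hc.le]
    congr 1
    push_cast
    ring
  rw [h1, h2, Real.mul_rpow (by positivity) (by positivity), h3]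
  ring

/-- The time derivative is half of the Laplacian, i.e. the heat equation with generator `Δ / 2`. -/
theorem hasDerivAt_heatKernel {s : ℝ} (hs : 0 < s) (r : E) :
    HasDerivAt (fun s => heatKernel s r)
      (heatKernel s r * ((‖r‖ ^ 2 / s ^ 2 - Module.finrank ℝ E / s) / 2)) s := by
  have hpi := Real.pi_pos
  have hp : 0 < 2 * Real.pi * s := by positivity
  have h1 : HasDerivAt (fun s : ℝ => 2 * Real.pi * s) (2 * Real.pi) s := by
    simpa using (hasDerivAt_id s).const_mul (2 * Real.pi)
  have h2 := h1.rpow_const (p := -(Module.finrank ℝ E / 2 : ℝ)) (Or.inl hp.ne')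
  have h3 : HasDerivAt (fun s : ℝ => -‖r‖ ^ 2 / (2 * s)) (‖r‖ ^ 2 / (2 * s ^ 2)) s := by
    have := ((hasDerivAt_id s).const_mul 2).fun_inv (by simpa using hs.ne')
    have := this.const_mul (-‖r‖ ^ 2)
    simp only [id_eq, ← div_eq_mul_inv] at this
    refine this.congr_deriv ?_
    field_simp
  refine (h2.mul h3.exp).congr_deriv ?_
  unfold heatKernel
  rw [Real.rpow_sub_one hp.ne']
  field_simp
  ring

theorem hasFDerivAt_heatKernel {s : ℝ} (hs : 0 < s) (r : E) :
    HasFDerivAt (heatKernel s) (-(heatKernel s r / s) • innerSL ℝ r) r := by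
  have h1 : HasFDerivAt (fun r : E => -‖r‖ ^ 2 / (2 * s)) (-(1 / s) • innerSL ℝ r) r := by
    have := ((hasStrictFDerivAt_norm_sq r).hasFDerivAt).const_mul (-(1 / (2 * s)))
    refine (this.congr_fderiv ?_).congr_of_eventuallyEq (Eventually.of_forall fun x => ?_)
    · ext v
      simp
      field_simp
    · simp only
      field_simp
  refine ((h1.exp).const_mul ((2 * Real.pi * s) ^ (-(Module.finrank ℝ E / 2 : ℝ)))).congr_fderiv ?_
  ext v
  simp only [heatKernel, _root_.smul_apply, smul_eq_mul]
  field_simp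

/-- On a compact range of times, the heat kernel multiplied by a polynomial of degree four is
dominated by one Gaussian. -/
theorem exists_weighted_heatKernel_le {a b : ℝ} (ha : 0 < a) (hab : a ≤ b) :
    ∃ C, 0 ≤ C ∧ ∀ s ∈ Icc a b, ∀ r : E,
      (1 + ‖r‖ ^ 2) ^ 2 * heatKernel s r ≤ C * Real.exp (-(1 / (4 * b)) * ‖r‖ ^ 2) := by
  have hpi := Real.pi_pos
  have hb : 0 < b := ha.trans_le hab
  refine ⟨(2 * Real.pi * a) ^ (-(Module.finrank ℝ E / 2 : ℝ)) * (1 + 8 * b) ^ 2,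
    by positivity, fun s hs r => ?_⟩
  have hs0 : 0 < s := ha.trans_le hs.1
  set x := ‖r‖ ^ 2 with hx
  have hx0 : 0 ≤ x := by positivity
  have h1 : (2 * Real.pi * s) ^ (-(Module.finrank ℝ E / 2 : ℝ)) ≤
      (2 * Real.pi * a) ^ (-(Module.finrank ℝ E / 2 : ℝ)) := by
    refine Real.rpow_le_rpow_of_nonpos (by positivity) ?_ ?_
    · have := hs.1
      gcongr
    · have : (0 : ℝ) ≤ Module.finrank ℝ E / 2 := by positivity
      linarith
  -- half of the exponent absorbs the polynomial, the other half is kept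
  have h2 : Real.exp (-x / (2 * s)) ≤ Real.exp (-(1 / (8 * b)) * x * 2) *
      Real.exp (-(1 / (4 * b)) * x) := by
    rw [← Real.exp_add, Real.exp_le_exp]
    have : x / (2 * b) ≤ x / (2 * s) := by
      have := hs.2
      gcongr
    have e : -(1 / (8 * b)) * x * 2 + -(1 / (4 * b)) * x = -(x / (2 * b)) := by
      field_simp
      ring
    rw [e, neg_div]
    linarith
  have h3 : 1 + x ≤ (1 + 8 * b) * Real.exp (1 / (8 * b) * x) := by
    have := Real.add_one_le_exp (1 / (8 * b) * x)
    have h4 : 1 + x ≤ (1 + 8 * b) * (1 / (8 * b) * x + 1) := by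
      have : 0 ≤ 1 / (8 * b) * x := by positivity
      have e : (1 + 8 * b) * (1 / (8 * b) * x + 1) = 1 / (8 * b) * x + x + 1 + 8 * b := by
        field_simp
        ring
      rw [e]
      linarith
    exact h4.trans (by gcongr)
  have h5 : (1 + x) ^ 2 * Real.exp (-(1 / (8 * b)) * x * 2) ≤ (1 + 8 * b) ^ 2 := by
    calc (1 + x) ^ 2 * Real.exp (-(1 / (8 * b)) * x * 2)
        ≤ ((1 + 8 * b) * Real.exp (1 / (8 * b) * x)) ^ 2 *
          Real.exp (-(1 / (8 * b)) * x * 2) := by gcongr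
      _ = (1 + 8 * b) ^ 2 := by
          rw [mul_pow, mul_assoc, ← Real.exp_nat_mul, ← Real.exp_add]
          have : ((2 : ℕ) : ℝ) * (1 / (8 * b) * x) + -(1 / (8 * b)) * x * 2 = 0 := by
            push_cast; ring
          rw [this, Real.exp_zero, mul_one]
  unfold heatKernel
  calc (1 + x) ^ 2 * ((2 * Real.pi * s) ^ (-(Module.finrank ℝ E / 2 : ℝ)) *
        Real.exp (-x / (2 * s)))
      ≤ (1 + x) ^ 2 * ((2 * Real.pi * a) ^ (-(Module.finrank ℝ E / 2 : ℝ)) *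
        (Real.exp (-(1 / (8 * b)) * x * 2) * Real.exp (-(1 / (4 * b)) * x))) := by gcongr
    _ = (2 * Real.pi * a) ^ (-(Module.finrank ℝ E / 2 : ℝ)) *
        ((1 + x) ^ 2 * Real.exp (-(1 / (8 * b)) * x * 2)) * Real.exp (-(1 / (4 * b)) * x) := by
          ring
    _ ≤ _ := by gcongr

variable [MeasurableSpace E] [BorelSpace E]

theorem measurable_uncurry_heatKernel :
    Measurable (fun p : ℝ × E => heatKernel p.1 p.2) := by
  unfold heatKernel
  fun_prop

variable [FiniteDimensional ℝ E]

theorem integral_heatKernel {s : ℝ} (hs : 0 < s) : ∫ r : E, heatKernel s r = 1 := by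
  have hpi := Real.pi_pos
  unfold heatKernel
  rw [integral_const_mul]
  have h := GaussianFourier.integral_rexp_neg_mul_sq_norm (V := E) (b := 1 / (2 * s))
    (by positivity)
  have e : (fun v : E => Real.exp (-(1 / (2 * s)) * ‖v‖ ^ 2)) =
      fun v : E => Real.exp (-‖v‖ ^ 2 / (2 * s)) := by
    ext v
    congr 1
    field_simp
  rw [e] at h
  rw [h]
  have e2 : Real.pi / (1 / (2 * s)) = 2 * Real.pi * s := by field_simp
  rw [e2, ← Real.rpow_add (by positivity), neg_add_cancel, Real.rpow_zero]

theorem integrable_exp_neg_mul_norm_sq {c : ℝ} (hc : 0 < c) :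
    Integrable (fun r : E => Real.exp (-c * ‖r‖ ^ 2)) := by
  refine Integrable.of_integral_ne_zero ?_
  rw [GaussianFourier.integral_rexp_neg_mul_sq_norm hc]
  have := Real.pi_pos
  positivity

theorem integrable_weight_mul_exp {c : ℝ} (hc : 0 < c) :
    Integrable (fun r : E => (1 + ‖r‖ ^ 2) * Real.exp (-c * ‖r‖ ^ 2)) := by
  refine ((integrable_exp_neg_mul_norm_sq (E := E) (half_pos hc)).const_mul
    (1 + 2 / c)).mono' (by fun_prop) (Eventually.of_forall fun r => ?_)
  rw [Real.norm_of_nonneg (by positivity)]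
  set x := ‖r‖ ^ 2 with hx
  have hx0 : 0 ≤ x := by positivity
  have h1 := Real.add_one_le_exp (c / 2 * x)
  have h2 : 1 + x ≤ (1 + 2 / c) * (c / 2 * x + 1) := by
    have e : (1 + 2 / c) * (c / 2 * x + 1) = c / 2 * x + x + 1 + 2 / c := by
      field_simp
      ring
    have : 0 ≤ c / 2 * x := by positivity
    have : 0 ≤ 2 / c := by positivity
    rw [e]
    linarith
  calc (1 + x) * Real.exp (-c * x)
      ≤ ((1 + 2 / c) * Real.exp (c / 2 * x)) * Real.exp (-c * x) := by
        gcongr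
        exact h2.trans (by gcongr)
    _ = (1 + 2 / c) * Real.exp (-(c / 2) * x) := by
        rw [mul_assoc, ← Real.exp_add]
        congr 2
        ring

theorem integrable_heatKernel {s : ℝ} (hs : 0 < s) : Integrable (heatKernel s : E → ℝ) :=
  Integrable.of_integral_ne_zero (by rw [integral_heatKernel hs]; exact one_ne_zero)

variable (E) in
/-- The law with density `heatKernel s`. -/
def heatMeasure (s : ℝ) : Measure E :=
  volume.withDensity (fun r => ENNReal.ofReal (heatKernel s r))

theorem isProbabilityMeasure_heatMeasure {s : ℝ} (hs : 0 < s) :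
    IsProbabilityMeasure (heatMeasure E s) := by
  constructor
  rw [heatMeasure, withDensity_apply _ MeasurableSet.univ, Measure.restrict_univ,
    ← ofReal_integral_eq_lintegral_ofReal (integrable_heatKernel hs)
      (Eventually.of_forall fun r => (heatKernel_pos hs r).le), integral_heatKernel hs,
    ENNReal.ofReal_one]

theorem charFun_heatMeasure {s : ℝ} (hs : 0 < s) (t : E) :
    charFun (heatMeasure E s) t = Complex.exp (-(s * ‖t‖ ^ 2 / 2 : ℝ)) := by
  have hpi := Real.pi_pos
  rw [charFun_apply, heatMeasure, integral_withDensity_eq_integral_toReal_smul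
    (continuous_heatKernel s).measurable.ennreal_ofReal
    (Eventually.of_forall fun _ => ENNReal.ofReal_lt_top)]
  have h := GaussianFourier.integral_cexp_neg_mul_sq_norm_add (V := E) (b := (1 / (2 * s) : ℝ))
    (by simp; positivity) Complex.I t
  have e : ∀ v : E, (ENNReal.ofReal (heatKernel s v)).toReal •
      Complex.exp (inner ℝ v t * Complex.I) =
      ((2 * Real.pi * s) ^ (-(Module.finrank ℝ E / 2 : ℝ)) : ℝ) *
        Complex.exp (-((1 / (2 * s) : ℝ) : ℂ) * ‖v‖ ^ 2 + Complex.I * inner ℝ t v) := by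
    intro v
    rw [ENNReal.toReal_ofReal (heatKernel_pos hs v).le, heatKernel, Complex.real_smul,
      Complex.ofReal_mul, mul_assoc, Complex.ofReal_exp, ← Complex.exp_add, real_inner_comm]
    congr 2
    push_cast
    field_simp
  simp_rw [e]
  rw [integral_const_mul, h]
  have e2 : ((Real.pi : ℂ) / ((1 / (2 * s) : ℝ) : ℂ)) = ((2 * Real.pi * s : ℝ) : ℂ) := by
    push_cast
    field_simp
  have e3 : ((2 * Real.pi * s : ℝ) : ℂ) ^ (Module.finrank ℝ E / 2 : ℂ) =
      (((2 * Real.pi * s) ^ (Module.finrank ℝ E / 2 : ℝ) : ℝ) : ℂ) := by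
    rw [Complex.ofReal_cpow (by positivity)]
    push_cast
    rfl
  rw [e2, e3, ← mul_assoc, ← Complex.ofReal_mul, ← Real.rpow_add (by positivity), neg_add_cancel,
    Real.rpow_zero, Complex.ofReal_one, one_mul]
  congr 1
  push_cast
  field_simp
  rw [Complex.I_sq]
  ring

/-- The Gaussian with density `heatKernel s` is a dilation of the standard one. -/
theorem map_smul_stdGaussian {s : ℝ} (hs : 0 < s) :
    (stdGaussian E).map (fun z => Real.sqrt s • z) = heatMeasure E s := by
  have := isProbabilityMeasure_heatMeasure (E := E) hs
  have : IsProbabilityMeasure ((stdGaussian E).map (fun z => Real.sqrt s • z)) :=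
    Measure.isProbabilityMeasure_map (by fun_prop)
  apply Measure.ext_of_charFun
  ext t
  rw [charFun_map_smul, charFun_stdGaussian, charFun_heatMeasure hs, norm_smul,
    Real.norm_of_nonneg (Real.sqrt_nonneg _)]
  congr 1
  push_cast
  rw [mul_pow, ← Complex.ofReal_pow, Real.sq_sqrt hs.le]
  ring

end

section

/-! ### The heat flow of a probability measure -/

variable {E : Type*} [NormedAddCommGroup E] [InnerProductSpace ℝ E] [MeasurableSpace E]
variable {F : Type*} [NormedAddCommGroup F] [NormedSpace ℝ F]

/-- The integral `∫ w (y - x) K_s (y - x) dν(x)` of a weight `w` against the heat kernel `K_s`.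
For `ν` the law of `X` and `W = X + R` with `R` independent of density `K_s`, this is the
density of `W` at `y` multiplied by the conditional expectation of `w R` given `W = y`. -/
def heatAvg (ν : Measure E) (s : ℝ) (w : E → F) (y : E) : F :=
  ∫ x, heatKernel s (y - x) • w (y - x) ∂ν

/-- The density at time `s` of the heat flow started from `ν`, i.e. of `X + √s Z` with `X` of
law `ν` and `Z` an independent standard Gaussian. -/
def heatFlow (ν : Measure E) (s : ℝ) (y : E) : ℝ :=
  ∫ x, heatKernel s (y - x) ∂ν

theorem heatFlow_eq_heatAvg (ν : Measure E) (s : ℝ) :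
    heatFlow ν s = heatAvg ν s (fun _ => (1 : ℝ)) := by
  ext y
  simp [heatFlow, heatAvg]

/-- The gradient of `heatFlow ν s` for `s > 0`, see `hasFDerivAt_heatFlow`. -/
def heatGrad (ν : Measure E) (s : ℝ) (y : E) : E :=
  -(s⁻¹ • heatAvg ν s id y)

/-- The score `-∇u / u` of the heat flow. Up to the factor `1 / s` it is the conditional expectation
of the Gaussian increment given its endpoint. -/
def heatScore (ν : Measure E) (s : ℝ) (y : E) : E :=
  -((heatFlow ν s y)⁻¹ • heatGrad ν s y)

/-- The average of `exp (-c ‖y - x‖ ^ 2)` over `x`, without normalization. It dominates heat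
averages locally uniformly in time. -/
def heatEnvelope (ν : Measure E) (c : ℝ) (y : E) : ℝ :=
  ∫ x, Real.exp (-c * ‖y - x‖ ^ 2) ∂ν

variable {ν : Measure E} {s a b c M : ℝ} {w : E → F}

/-- Throughout, weights `w` of quadratic growth are allowed: this covers the weights `r`, `⟪v, r⟫ ^ 2`
and `‖r‖ ^ 2` that come from the first and second derivatives of the heat kernel. -/
theorem norm_heatKernel_smul_le (hs : 0 < s) (hw : ∀ r, ‖w r‖ ≤ M * (1 + ‖r‖ ^ 2)) (r : E) :
    ‖heatKernel s r • w r‖ ≤ M * ((1 + ‖r‖ ^ 2) ^ 2 * heatKernel s r) := by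
  rw [norm_smul, Real.norm_of_nonneg (heatKernel_pos hs r).le]
  have hM : 0 ≤ M := by
    have := (norm_nonneg _).trans (hw r)
    by_contra hM
    have : M * (1 + ‖r‖ ^ 2) < 0 := mul_neg_of_neg_of_pos (not_le.1 hM) (by positivity)
    linarith
  have hK := (heatKernel_pos hs r).le
  calc heatKernel s r * ‖w r‖ ≤ heatKernel s r * (M * (1 + ‖r‖ ^ 2) * 1) := by
        gcongr
        simpa using hw r
    _ ≤ heatKernel s r * (M * (1 + ‖r‖ ^ 2) * (1 + ‖r‖ ^ 2)) := by
        gcongr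
        linarith [sq_nonneg ‖r‖]
    _ = _ := by ring

/-- On a compact range of times, a weighted heat kernel with a weight of quadratic growth is
dominated by one Gaussian. -/
theorem exists_norm_heatKernel_smul_le (ha : 0 < a) (hab : a ≤ b)
    (hM : 0 ≤ M) : ∃ C, 0 ≤ C ∧ ∀ s ∈ Icc a b, ∀ w : E → F, (∀ r, ‖w r‖ ≤ M * (1 + ‖r‖ ^ 2)) →
      ∀ r : E, ‖heatKernel s r • w r‖ ≤ C * Real.exp (-(1 / (4 * b)) * ‖r‖ ^ 2) := by
  obtain ⟨C, hC, h⟩ := exists_weighted_heatKernel_le (E := E) ha hab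
  refine ⟨M * C, by positivity, fun s hs w hw r => ?_⟩
  refine (norm_heatKernel_smul_le (ha.trans_le hs.1) hw r).trans ?_
  rw [mul_assoc]
  exact mul_le_mul_of_nonneg_left (h s hs r) hM

theorem exists_norm_heatKernel_smul_le_const (ha : 0 < a) (hab : a ≤ b)
    (hM : 0 ≤ M) : ∃ C, 0 ≤ C ∧ ∀ s ∈ Icc a b, ∀ w : E → F, (∀ r, ‖w r‖ ≤ M * (1 + ‖r‖ ^ 2)) →
      ∀ r : E, ‖heatKernel s r • w r‖ ≤ C := by
  obtain ⟨C, hC, h⟩ := exists_norm_heatKernel_smul_le (E := E) (F := F) ha hab hM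
  refine ⟨C, hC, fun s hs w hw r => (h s hs w hw r).trans (mul_le_of_le_one_right hC ?_)⟩
  rw [Real.exp_le_one_iff, neg_mul]
  have : 0 < b := ha.trans_le hab
  have : 0 ≤ 1 / (4 * b) * ‖r‖ ^ 2 := by positivity
  linarith

theorem growth_nonneg (hw : ∀ r, ‖w r‖ ≤ M * (1 + ‖r‖ ^ 2)) : 0 ≤ M := by
  simpa using (norm_nonneg _).trans (hw 0)

variable [BorelSpace E] [FiniteDimensional ℝ E]

theorem aestronglyMeasurable_heatKernel_smul (hwc : Continuous w) (y : E) :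
    AEStronglyMeasurable (fun x => heatKernel s (y - x) • w (y - x)) ν :=
  Continuous.aestronglyMeasurable (((continuous_heatKernel s).smul hwc).comp (by fun_prop))

variable [IsProbabilityMeasure ν]

theorem integrable_heatKernel_smul (hs : 0 < s) (hwc : Continuous w)
    (hw : ∀ r, ‖w r‖ ≤ M * (1 + ‖r‖ ^ 2)) (y : E) :
    Integrable (fun x => heatKernel s (y - x) • w (y - x)) ν := by
  obtain ⟨C, -, h⟩ := exists_norm_heatKernel_smul_le_const (E := E) (F := F) hs le_rfl
    (growth_nonneg hw)
  exact Integrable.of_bound (aestronglyMeasurable_heatKernel_smul hwc y) C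
    (Eventually.of_forall fun x => h s ⟨le_rfl, le_rfl⟩ w hw _)

theorem integrable_heatKernel_sub (hs : 0 < s) (y : E) :
    Integrable (fun x => heatKernel s (y - x)) ν := by
  simpa using integrable_heatKernel_smul (ν := ν) hs (w := fun _ => (1 : ℝ)) continuous_const
    (M := 1) (fun r => by simp) y

theorem continuous_heatAvg (hs : 0 < s) (hwc : Continuous w)
    (hw : ∀ r, ‖w r‖ ≤ M * (1 + ‖r‖ ^ 2)) : Continuous (heatAvg ν s w) := by
  obtain ⟨C, -, h⟩ := exists_norm_heatKernel_smul_le_const (E := E) (F := F) hs le_rfl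
    (growth_nonneg hw)
  refine continuous_of_dominated (bound := fun _ => C)
    (fun y => aestronglyMeasurable_heatKernel_smul hwc y)
    (fun y => Eventually.of_forall fun x => h s ⟨le_rfl, le_rfl⟩ w hw _) (integrable_const _)
    (Eventually.of_forall fun x => ?_)
  exact ((continuous_heatKernel s).smul hwc).comp (continuous_id.sub continuous_const)

theorem continuous_heatFlow (hs : 0 < s) : Continuous (heatFlow ν s) := by
  rw [heatFlow_eq_heatAvg]
  exact continuous_heatAvg hs continuous_const (M := 1) (fun r => by simp)

theorem norm_id_le (r : E) : ‖id r‖ ≤ 1 * (1 + ‖r‖ ^ 2) := by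
  simp only [id]
  nlinarith [sq_nonneg (‖r‖ - 1 / 2)]

theorem continuous_heatGrad (hs : 0 < s) : Continuous (heatGrad ν s) :=
  ((continuous_heatAvg hs continuous_id norm_id_le).const_smul s⁻¹).neg

theorem heatFlow_pos (hs : 0 < s) (y : E) : 0 < heatFlow ν s y :=
  (integral_pos_iff_support_of_nonneg (fun x => (heatKernel_pos hs _).le)
    (integrable_heatKernel_sub hs y)).2 (by
      have : Function.support (fun x => heatKernel s (y - x)) = univ := by
        ext x
        simp [(heatKernel_pos hs (y - x)).ne']
      simp [this])

theorem continuous_heatScore (hs : 0 < s) : Continuous (heatScore ν s) :=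
  (((continuous_heatFlow hs).inv₀ fun y => (heatFlow_pos hs y).ne').smul
    (continuous_heatGrad hs)).neg

theorem heatFlow_le (hs : 0 < s) (y : E) :
    heatFlow ν s y ≤ (2 * Real.pi * s) ^ (-(Module.finrank ℝ E / 2 : ℝ)) := by
  have := integral_mono (integrable_heatKernel_sub (ν := ν) hs y)
    (integrable_const ((2 * Real.pi * s) ^ (-(Module.finrank ℝ E / 2 : ℝ))))
    (fun x => heatKernel_le hs _)
  simpa [heatFlow] using this

theorem heatFlow_smul_heatScore (hs : 0 < s) (y : E) :
    heatFlow ν s y • heatScore ν s y = s⁻¹ • heatAvg ν s id y := by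
  rw [heatScore, smul_neg, smul_smul, mul_inv_cancel₀ (heatFlow_pos hs y).ne', one_smul, heatGrad,
    neg_neg]

/-! ### Derivatives of the heat flow -/

theorem hasFDerivAt_heatFlow (hs : 0 < s) (y : E) :
    HasFDerivAt (heatFlow ν s) (innerSL ℝ (heatGrad ν s y)) y := by
  obtain ⟨C, -, h⟩ := exists_norm_heatKernel_smul_le_const (E := E) (F := E) hs le_rfl zero_le_one
  have key : HasFDerivAt (heatFlow ν s)
      (∫ x, -(heatKernel s (y - x) / s) • innerSL ℝ (y - x) ∂ν) y := by
    refine hasFDerivAt_integral_of_dominated_of_fderiv_le (s := univ) (bound := fun _ => s⁻¹ * C)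
      (F' := fun y x => -(heatKernel s (y - x) / s) • innerSL ℝ (y - x)) univ_mem
      (Eventually.of_forall fun z => (integrable_heatKernel_sub hs z).aestronglyMeasurable)
      (integrable_heatKernel_sub hs y) ?_ ?_ (integrable_const _) ?_
    · refine Continuous.aestronglyMeasurable ?_
      have : Continuous fun x => heatKernel s (y - x) :=
        (continuous_heatKernel s).comp (by fun_prop)
      fun_prop
    · refine Eventually.of_forall fun x z _ => ?_
      have h1 := h s ⟨le_rfl, le_rfl⟩ id norm_id_le (z - x)
      rw [norm_smul, Real.norm_of_nonneg (heatKernel_pos hs _).le, id] at h1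
      rw [norm_smul, innerSL_apply_norm, norm_neg, norm_div,
        Real.norm_of_nonneg (heatKernel_pos hs _).le, Real.norm_of_nonneg hs.le]
      calc heatKernel s (z - x) / s * ‖z - x‖ = s⁻¹ * (heatKernel s (z - x) * ‖z - x‖) := by
            ring
        _ ≤ _ := by gcongr
    · refine Eventually.of_forall fun x z _ => ?_
      exact (hasFDerivAt_heatKernel hs (z - x)).comp z ((hasFDerivAt_id z).sub_const x)
  refine key.congr_fderiv ?_
  have h2 := (innerSL ℝ (E := E)).integral_comp_comm
    ((integrable_heatKernel_smul (ν := ν) hs continuous_id norm_id_le y).smul (-s⁻¹))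
  rw [heatGrad, heatAvg, ← neg_smul, ← integral_smul]
  refine Eq.trans (integral_congr_ae (Eventually.of_forall fun x => ?_)) h2
  simp only [Pi.smul_apply, map_smul, id, smul_smul]
  congr 1
  ring

/-- The second derivative of the heat flow in the direction `v`, up to the factor `-1 / s`. -/
theorem hasLineDerivAt_heatAvg_inner (hs : 0 < s) (y v : E) :
    HasLineDerivAt ℝ (heatAvg ν s (fun r => inner ℝ v r))
      (heatAvg ν s (fun r => ‖v‖ ^ 2 - inner ℝ v r ^ 2 / s) y) y v := by
  have hM : 0 ≤ ‖v‖ ^ 2 + ‖v‖ ^ 2 / s + ‖v‖:= by positivity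
  obtain ⟨C, -, h⟩ := exists_norm_heatKernel_smul_le_const (E := E) (F := ℝ) hs le_rfl hM
  have hv : ∀ r, ‖(inner ℝ v r : ℝ)‖ ≤ (‖v‖ ^ 2 + ‖v‖ ^ 2 / s + ‖v‖) * (1 + ‖r‖ ^ 2) := by
    intro r
    have h1 := abs_real_inner_le_norm v r
    have h2 : 0 ≤ ‖v‖ ^ 2 / s := by positivity
    have h3 := norm_id_le r
    rw [id, one_mul] at h3
    calc ‖(inner ℝ v r : ℝ)‖ ≤ ‖v‖ * (1 + ‖r‖ ^ 2) := h1.trans (by gcongr)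
      _ ≤ _ := by
        gcongr
        linarith [sq_nonneg ‖v‖]
  have hv2 : ∀ r, ‖(‖v‖ ^ 2 - inner ℝ v r ^ 2 / s : ℝ)‖ ≤
      (‖v‖ ^ 2 + ‖v‖ ^ 2 / s + ‖v‖) * (1 + ‖r‖ ^ 2) := by
    intro r
    have h1 : inner ℝ v r ^ 2 / s ≤ ‖v‖ ^ 2 / s * ‖r‖ ^ 2 := by
      rw [div_mul_eq_mul_div, ← mul_pow]
      have := sq_le_sq' (neg_le_of_abs_le (abs_real_inner_le_norm v r))
        (le_of_abs_le (abs_real_inner_le_norm v r))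
      gcongr
    have h2 : 0 ≤ (inner ℝ v r : ℝ) ^ 2 / s := by positivity
    have h3 : 0 ≤ ‖v‖ ^ 2 / s := by positivity
    have h4 : 0 ≤ ‖v‖ ^ 2 * ‖r‖ ^ 2 := by positivity
    have h5 : 0 ≤ ‖v‖ * (1 + ‖r‖ ^ 2) := by positivity
    rw [Real.norm_eq_abs, abs_le]
    constructor <;> nlinarith [sq_nonneg ‖v‖]
  have hc1 : Continuous fun r : E => (inner ℝ v r : ℝ) := by fun_prop
  have hc2 : Continuous fun r : E => (‖v‖ ^ 2 - inner ℝ v r ^ 2 / s : ℝ) := by fun_prop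
  have key := hasDerivAt_integral_of_dominated_loc_of_deriv_le (μ := ν) (x₀ := (0 : ℝ)) (s := univ)
    (bound := fun _ => C)
    (F := fun t x => heatKernel s (y + t • v - x) • (inner ℝ v (y + t • v - x) : ℝ))
    (F' := fun t x => heatKernel s (y + t • v - x) •
      (‖v‖ ^ 2 - inner ℝ v (y + t • v - x) ^ 2 / s : ℝ)) univ_mem
    (Eventually.of_forall fun t => aestronglyMeasurable_heatKernel_smul hc1 _)
    (integrable_heatKernel_smul hs hc1 hv _) (aestronglyMeasurable_heatKernel_smul hc2 _)
    (Eventually.of_forall fun x t _ => h s ⟨le_rfl, le_rfl⟩ _ hv2 _) (integrable_const _) ?_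
  · have := key.2
    simp only [zero_smul, add_zero] at this
    exact this
  · refine Eventually.of_forall fun x t _ => ?_
    have h0 : HasDerivAt (fun t : ℝ => y + t • v - x) v t := by
      simpa using (((hasDerivAt_id t).smul_const v).const_add y).sub_const x
    have h1 := (hasFDerivAt_heatKernel hs (y + t • v - x)).comp_hasDerivAt t h0
    have h2 := (innerSL ℝ v).hasFDerivAt.comp_hasDerivAt t h0
    refine (h1.mul h2).congr_deriv ?_
    simp only [Function.comp_apply]
    generalize y + t • v - x = r
    simp [real_inner_comm]
    ring

/-- Quadratic growth, uniformly for times `s ≥ a`, of the weight in the time derivative of the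
heat flow. -/
theorem norm_timeWeight_le (ha : 0 < a) (has : a ≤ s) (r : E) :
    ‖((‖r‖ ^ 2 / s ^ 2 - Module.finrank ℝ E / s) / 2 : ℝ)‖ ≤
      (1 / a ^ 2 + Module.finrank ℝ E / a) * (1 + ‖r‖ ^ 2) := by
  have hs := ha.trans_le has
  have h1 : ‖r‖ ^ 2 / s ^ 2 ≤ 1 / a ^ 2 * ‖r‖ ^ 2 := by
    rw [one_div_mul_eq_div]
    gcongr
  have h2 : (Module.finrank ℝ E : ℝ) / s ≤ Module.finrank ℝ E / a := by gcongr
  have h3 : 0 ≤ ‖r‖ ^ 2 / s ^ 2 := by positivity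
  have h4 : 0 ≤ (Module.finrank ℝ E : ℝ) / s := by positivity
  have h5 : 0 ≤ 1 / a ^ 2 := by positivity
  have h6 : 0 ≤ (Module.finrank ℝ E : ℝ) / a * ‖r‖ ^ 2 := by positivity
  rw [Real.norm_eq_abs, abs_le]
  constructor <;> linarith

theorem hasDerivAt_heatFlow (hs : 0 < s) (y : E) :
    HasDerivAt (fun s => heatFlow ν s y)
      (heatAvg ν s (fun r => (‖r‖ ^ 2 / s ^ 2 - Module.finrank ℝ E / s) / 2) y) s := by
  obtain ⟨C, -, h⟩ := exists_norm_heatKernel_smul_le_const (E := E) (F := ℝ) (half_pos hs)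
    (b := 2 * s) (by linarith)
    (M := 1 / (s / 2) ^ 2 + Module.finrank ℝ E / (s / 2)) (by positivity)
  have hmeas : AEStronglyMeasurable (fun x => heatKernel s (y - x) *
      ((‖y - x‖ ^ 2 / s ^ 2 - Module.finrank ℝ E / s) / 2)) ν :=
    aestronglyMeasurable_heatKernel_smul
      (w := fun r : E => (‖r‖ ^ 2 / s ^ 2 - Module.finrank ℝ E / s) / 2) (by fun_prop) y
  refine (hasDerivAt_integral_of_dominated_loc_of_deriv_le (μ := ν) (x₀ := s)
    (s := Icc (s / 2) (2 * s)) (bound := fun _ => C)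
    (F := fun s x => heatKernel s (y - x))
    (F' := fun s x => heatKernel s (y - x) *
      ((‖y - x‖ ^ 2 / s ^ 2 - Module.finrank ℝ E / s) / 2)) (Icc_mem_nhds (by linarith)
        (by linarith))
    ((lt_mem_nhds hs).mono fun t ht => (integrable_heatKernel_sub ht y).aestronglyMeasurable)
    (integrable_heatKernel_sub hs y) hmeas ?_ (integrable_const _)
    (Eventually.of_forall fun x t ht =>
      hasDerivAt_heatKernel (lt_of_lt_of_le (half_pos hs) ht.1) (y - x))).2
  exact Eventually.of_forall fun x t ht => h t ht
      (fun r => (‖r‖ ^ 2 / t ^ 2 - Module.finrank ℝ E / t) / 2)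
      (norm_timeWeight_le (half_pos hs) ht.1) (y - x)

end

section

/-! ### Domination and integrability in space -/

variable {E : Type*} [NormedAddCommGroup E] [InnerProductSpace ℝ E] [MeasurableSpace E]
  [BorelSpace E] [FiniteDimensional ℝ E]
variable {F : Type*} [NormedAddCommGroup F] [NormedSpace ℝ F]
variable {ν : Measure E} [IsProbabilityMeasure ν] {s a b c M : ℝ} {w : E → F}

theorem measurePreserving_shear (ν : Measure E) [SFinite ν] :
    MeasurePreserving (MeasurableEquiv.shearAddRight E).symm
      (ν.prod (volume : Measure E)) (ν.prod volume) :=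
  MeasurePreserving.symm (MeasurableEquiv.shearAddRight E)
    (measurePreserving_prod_add ν (volume : Measure E))

theorem integrable_shear {f : E × E → F} (hf : Integrable f (ν.prod volume)) :
    Integrable (fun p => f (p.1, p.2 - p.1)) (ν.prod volume) := by
  have := (measurePreserving_shear ν).integrable_comp_of_integrable hf
  refine this.congr (Eventually.of_forall fun p => ?_)
  simp [MeasurableEquiv.shearAddRight, sub_eq_neg_add]

theorem one_add_norm_sq_add_le (x r : E) :
    1 + ‖x + r‖ ^ 2 ≤ 2 * ((1 + ‖x‖ ^ 2) * (1 + ‖r‖ ^ 2)) := by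
  have h1 := norm_add_le x r
  have h2 : ‖x + r‖ ^ 2 ≤ (‖x‖ + ‖r‖) ^ 2 := by gcongr
  nlinarith [sq_nonneg (‖x‖ - ‖r‖), mul_nonneg (sq_nonneg ‖x‖) (sq_nonneg ‖r‖)]

/-- The envelope has a finite second moment: it is a convolution of `ν` with a Gaussian. -/
theorem integrable_weight_mul_heatEnvelope (hν : Integrable (fun x => ‖x‖ ^ 2) ν) (hc : 0 < c) :
    Integrable (fun y => (1 + ‖y‖ ^ 2) * heatEnvelope ν c y) := by
  have h1 : Integrable (fun p : E × E => (1 + ‖p.1‖ ^ 2) *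
      ((1 + ‖p.2‖ ^ 2) * Real.exp (-c * ‖p.2‖ ^ 2))) (ν.prod volume) :=
    Integrable.mul_prod (f := fun x : E => 1 + ‖x‖ ^ 2) ((integrable_const 1).add hν)
      (integrable_weight_mul_exp hc)
  have h2 : Integrable (fun p : E × E => (1 + ‖p.2‖ ^ 2) * Real.exp (-c * ‖p.2 - p.1‖ ^ 2))
      (ν.prod volume) := by
    refine ((integrable_shear h1).const_mul 2).mono' (by fun_prop)
      (Eventually.of_forall fun p => ?_)
    rw [Real.norm_of_nonneg (by positivity)]
    have := one_add_norm_sq_add_le p.1 (p.2 - p.1)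
    rw [add_sub_cancel] at this
    calc (1 + ‖p.2‖ ^ 2) * Real.exp (-c * ‖p.2 - p.1‖ ^ 2)
        ≤ 2 * ((1 + ‖p.1‖ ^ 2) * (1 + ‖p.2 - p.1‖ ^ 2)) * Real.exp (-c * ‖p.2 - p.1‖ ^ 2) := by
          gcongr
      _ = _ := by ring
  refine h2.integral_prod_right.congr (Eventually.of_forall fun y => ?_)
  simp only [heatEnvelope, integral_const_mul]

theorem integrable_of_le_heatEnvelope (hν : Integrable (fun x => ‖x‖ ^ 2) ν) (hc : 0 < c)
    {f : E → F} (hf : Continuous f) {C : ℝ}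
    (h : ∀ y, ‖f y‖ ≤ C * ((1 + ‖y‖ ^ 2) * heatEnvelope ν c y)) : Integrable f :=
  ((integrable_weight_mul_heatEnvelope hν hc).const_mul C).mono' hf.aestronglyMeasurable
    (Eventually.of_forall h)

theorem exists_norm_heatAvg_le (ν : Measure E) [IsProbabilityMeasure ν] (ha : 0 < a) (hab : a ≤ b)
    (hM : 0 ≤ M) : ∃ C, 0 ≤ C ∧ ∀ s ∈ Icc a b, ∀ w : E → F, (∀ r, ‖w r‖ ≤ M * (1 + ‖r‖ ^ 2)) →
      ∀ y, ‖heatAvg ν s w y‖ ≤ C * heatEnvelope ν (1 / (4 * b)) y := by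
  obtain ⟨C, hC, h⟩ := exists_norm_heatKernel_smul_le (E := E) (F := F) ha hab hM
  have hb : 0 < b := ha.trans_le hab
  refine ⟨C, hC, fun s hs w hw y => ?_⟩
  rw [heatEnvelope, ← integral_const_mul]
  refine norm_integral_le_of_norm_le ?_ (Eventually.of_forall fun x => h s hs w hw (y - x))
  refine Integrable.const_mul (Integrable.of_bound (C := 1)
    (Continuous.aestronglyMeasurable (by fun_prop)) (Eventually.of_forall fun x => ?_)) C
  rw [Real.norm_of_nonneg (Real.exp_pos _).le, Real.exp_le_one_iff, neg_mul]
  have : 0 ≤ 1 / (4 * b) * ‖y - x‖ ^ 2 := by positivity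
  linarith

/-- Heat averages of weights of quadratic growth have a finite second moment. -/
theorem integrable_weight_mul_heatAvg (hν : Integrable (fun x => ‖x‖ ^ 2) ν) (hs : 0 < s)
    (hwc : Continuous w) (hw : ∀ r, ‖w r‖ ≤ M * (1 + ‖r‖ ^ 2)) :
    Integrable (fun y => (1 + ‖y‖ ^ 2) * ‖heatAvg ν s w y‖) := by
  obtain ⟨C, hC, h⟩ := exists_norm_heatAvg_le (F := F) ν hs le_rfl (growth_nonneg hw)
  refine integrable_of_le_heatEnvelope hν (c := 1 / (4 * s)) (by positivity) (C := C) ?_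
    fun y => ?_
  · have := continuous_heatAvg (ν := ν) hs hwc hw
    fun_prop
  · rw [norm_mul, norm_norm, Real.norm_of_nonneg (by positivity)]
    calc (1 + ‖y‖ ^ 2) * ‖heatAvg ν s w y‖
        ≤ (1 + ‖y‖ ^ 2) * (C * heatEnvelope ν (1 / (4 * s)) y) := by
          gcongr
          exact h s ⟨le_rfl, le_rfl⟩ w hw y
      _ = _ := by ring

theorem integrable_mul_heatAvg (hν : Integrable (fun x => ‖x‖ ^ 2) ν) (hs : 0 < s)
    {w : E → ℝ} (hwc : Continuous w) (hw : ∀ r, ‖w r‖ ≤ M * (1 + ‖r‖ ^ 2)) {g : E → ℝ}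
    (hg : Continuous g) {C : ℝ} (hgC : ∀ y, |g y| ≤ C * (1 + ‖y‖ ^ 2)) :
    Integrable (fun y => g y * heatAvg ν s w y) := by
  refine ((integrable_weight_mul_heatAvg hν hs hwc hw).const_mul C).mono'
    (hg.mul (continuous_heatAvg hs hwc hw)).aestronglyMeasurable (Eventually.of_forall fun y => ?_)
  rw [norm_mul, Real.norm_eq_abs, ← mul_assoc]
  gcongr
  exact hgC y

theorem integrable_mul_heatFlow (hν : Integrable (fun x => ‖x‖ ^ 2) ν) (hs : 0 < s)
    {g : E → ℝ} (hg : Continuous g) {C : ℝ} (hgC : ∀ y, |g y| ≤ C * (1 + ‖y‖ ^ 2)) :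
    Integrable (fun y => g y * heatFlow ν s y) := by
  rw [heatFlow_eq_heatAvg]
  exact integrable_mul_heatAvg hν hs continuous_const (M := 1) (fun r => by simp) hg hgC

theorem integrable_sq_norm_sub (hν : Integrable (fun x => ‖x‖ ^ 2) ν) (y : E) :
    Integrable (fun x => ‖y - x‖ ^ 2) ν := by
  refine (((integrable_const (1 : ℝ)).add hν).const_mul (2 * (1 + ‖y‖ ^ 2))).mono' (by fun_prop)
    (Eventually.of_forall fun x => ?_)
  have := one_add_norm_sq_add_le y (-x)
  rw [norm_neg, ← sub_eq_add_neg] at this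
  rw [Real.norm_of_nonneg (by positivity)]
  simp only [Pi.add_apply]
  linarith

/-- Jensen's inequality for the logarithm gives a quadratic lower bound for the logarithm of the
heat flow. -/
theorem le_log_heatFlow (hν : Integrable (fun x => ‖x‖ ^ 2) ν) (hs : 0 < s) (y : E) :
    -(Module.finrank ℝ E / 2 : ℝ) * Real.log (2 * Real.pi * s) -
      (‖y‖ ^ 2 + ∫ x, ‖x‖ ^ 2 ∂ν) / s ≤ Real.log (heatFlow ν s y) := by
  set A := -(Module.finrank ℝ E / 2 : ℝ) * Real.log (2 * Real.pi * s) with hA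
  set m := A - (∫ x, ‖y - x‖ ^ 2 ∂ν) / (2 * s) with hm
  have hI := integrable_sq_norm_sub hν y
  -- `m` is the average of `log K_s (y - x)`; the tangent line of `exp` at `m` gives Jensen
  have h1 : Real.exp m ≤ heatFlow ν s y := by
    have j1 : Integrable (fun x => A - ‖y - x‖ ^ 2 / (2 * s)) ν :=
      (integrable_const A).sub (hI.div_const _)
    have j2 : Integrable (fun x => A - ‖y - x‖ ^ 2 / (2 * s) - m) ν := j1.sub (integrable_const m)
    have hint : Integrable (fun x => Real.exp m *
        (1 + (A - ‖y - x‖ ^ 2 / (2 * s) - m))) ν := ((integrable_const 1).add j2).const_mul _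
    have h2 := integral_mono hint (integrable_heatKernel_sub hs y) (fun x => by
      have h3 := Real.add_one_le_exp (A - ‖y - x‖ ^ 2 / (2 * s) - m)
      have h4 := log_heatKernel hs (y - x)
      rw [← hA] at h4
      simp only
      rw [← Real.exp_log (heatKernel_pos hs (y - x)), h4]
      calc Real.exp m * (1 + (A - ‖y - x‖ ^ 2 / (2 * s) - m))
          ≤ Real.exp m * Real.exp (A - ‖y - x‖ ^ 2 / (2 * s) - m) := by
            gcongr
            linarith
        _ = _ := by
            rw [← Real.exp_add]
            congr 1
            ring)
    rw [integral_const_mul] at h2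
    have h5 : ∫ x, (1 + (A - ‖y - x‖ ^ 2 / (2 * s) - m)) ∂ν = 1 := by
      rw [integral_add (integrable_const _) j2, integral_sub j1 (integrable_const m),
        integral_sub (integrable_const A) (hI.div_const _), integral_div]
      simp [hm]
    rw [h5, mul_one] at h2
    exact h2
  have h6 : ∫ x, ‖y - x‖ ^ 2 ∂ν ≤ 2 * ‖y‖ ^ 2 + 2 * ∫ x, ‖x‖ ^ 2 ∂ν := by
    have := integral_mono hI ((integrable_const (2 * ‖y‖ ^ 2)).add (hν.const_mul 2)) (fun x => by
      have h1 : ‖y - x‖ ^ 2 ≤ (‖y‖ + ‖x‖) ^ 2 := by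
        gcongr
        exact norm_sub_le y x
      simp only [Pi.add_apply]
      nlinarith [sq_nonneg (‖y‖ - ‖x‖)])
    simp only [Pi.add_apply] at this
    rwa [integral_add (integrable_const _) (hν.const_mul 2), integral_const, probReal_univ,
      one_smul, integral_const_mul] at this
  have h7 : m ≤ Real.log (heatFlow ν s y) := (Real.le_log_iff_exp_le (heatFlow_pos hs y)).2 h1
  refine le_trans ?_ h7
  rw [hm]
  gcongr A - ?_
  rw [div_le_div_iff₀ (by positivity) hs]
  nlinarith

/-- The upper bound is the maximum of the heat kernel, the lower bound is Jensen's inequality. -/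
theorem exists_abs_log_heatFlow_le (hν : Integrable (fun x => ‖x‖ ^ 2) ν) (ha : 0 < a)
    (hab : a ≤ b) : ∃ C, 0 ≤ C ∧ ∀ s ∈ Icc a b, ∀ y,
      |Real.log (heatFlow ν s y)| ≤ C * (1 + ‖y‖ ^ 2) := by
  have hpi := Real.pi_pos
  have hb := ha.trans_le hab
  set m := ∫ x, ‖x‖ ^ 2 ∂ν with hm
  have hm0 : 0 ≤ m := integral_nonneg fun _ => by positivity
  set B := (Module.finrank ℝ E / 2 : ℝ) *
    (|Real.log (2 * Real.pi * a)| + |Real.log (2 * Real.pi * b)|) with hB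
  have hB0 : 0 ≤ B := by positivity
  refine ⟨B + (1 + m) / a, by positivity, fun s hs y => ?_⟩
  have hs0 : 0 < s := ha.trans_le hs.1
  have h1 : |(Module.finrank ℝ E / 2 : ℝ) * Real.log (2 * Real.pi * s)| ≤ B := by
    rw [abs_mul, abs_of_nonneg (by positivity : (0 : ℝ) ≤ Module.finrank ℝ E / 2), hB]
    gcongr
    have hs1 := hs.1
    have hs2 := hs.2
    have l1 : Real.log (2 * Real.pi * a) ≤ Real.log (2 * Real.pi * s) := by gcongr
    have l2 : Real.log (2 * Real.pi * s) ≤ Real.log (2 * Real.pi * b) := by gcongr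
    rw [abs_le]
    constructor
    · linarith [neg_abs_le (Real.log (2 * Real.pi * a)), abs_nonneg (Real.log (2 * Real.pi * b))]
    · linarith [le_abs_self (Real.log (2 * Real.pi * b)), abs_nonneg (Real.log (2 * Real.pi * a))]
  have h2 := le_log_heatFlow hν hs0 y
  have h3 : Real.log (heatFlow ν s y) ≤
      -(Module.finrank ℝ E / 2 : ℝ) * Real.log (2 * Real.pi * s) := by
    rw [← Real.log_rpow (by positivity)]
    exact Real.log_le_log (heatFlow_pos hs0 y) (heatFlow_le hs0 y)
  have h4 : (‖y‖ ^ 2 + m) / s ≤ (1 + m) / a * (1 + ‖y‖ ^ 2) := by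
    rw [div_mul_eq_mul_div]
    have := hs.1
    gcongr
    nlinarith [mul_nonneg hm0 (sq_nonneg ‖y‖)]
  have h5 : 0 ≤ B * ‖y‖ ^ 2 := by positivity
  have h6 : 0 ≤ (1 + m) / a * (1 + ‖y‖ ^ 2) := by positivity
  rw [abs_le] at h1 ⊢
  constructor <;> nlinarith [h1.1, h1.2]

theorem continuous_log_heatFlow (hs : 0 < s) :
    Continuous (fun y => Real.log (heatFlow ν s y)) :=
  (continuous_heatFlow hs).log fun y => (heatFlow_pos hs y).ne'

theorem integrable_heatFlow (hν : Integrable (fun x => ‖x‖ ^ 2) ν) (hs : 0 < s) :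
    Integrable (heatFlow ν s) := by
  simpa using integrable_mul_heatFlow hν hs (g := fun _ => 1) (C := 1) continuous_const
    (fun y => by simp)

theorem integrable_negMulLog_heatFlow (hν : Integrable (fun x => ‖x‖ ^ 2) ν) (hs : 0 < s) :
    Integrable (fun y => Real.negMulLog (heatFlow ν s y)) := by
  obtain ⟨C, -, h⟩ := exists_abs_log_heatFlow_le hν hs le_rfl
  refine (integrable_mul_heatFlow hν hs (continuous_log_heatFlow hs)
    (h s ⟨le_rfl, le_rfl⟩)).neg.congr (Eventually.of_forall fun y => ?_)
  simp [Real.negMulLog, mul_comm]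

/-! ### Square integrability of the score -/

theorem inner_heatAvg_id (hs : 0 < s) (v y : E) :
    inner ℝ v (heatAvg ν s id y) = heatAvg ν s (fun r => (inner ℝ v r : ℝ)) y := by
  have h := (innerSL ℝ v).integral_comp_comm
    (integrable_heatKernel_smul (ν := ν) hs continuous_id norm_id_le y)
  simpa [heatAvg] using h.symm

theorem norm_inner_le_growth (v r : E) : ‖(inner ℝ v r : ℝ)‖ ≤ ‖v‖ * (1 + ‖r‖ ^ 2) := by
  have h3 := norm_id_le r
  rw [id, one_mul] at h3
  exact (abs_real_inner_le_norm v r).trans (by gcongr)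

theorem norm_inner_sq_le_growth (v r : E) :
    ‖(inner ℝ v r ^ 2 : ℝ)‖ ≤ ‖v‖ ^ 2 * (1 + ‖r‖ ^ 2) := by
  rw [norm_pow]
  calc ‖(inner ℝ v r : ℝ)‖ ^ 2 ≤ (‖v‖ * ‖r‖) ^ 2 := by
        gcongr
        exact abs_real_inner_le_norm v r
    _ = ‖v‖ ^ 2 * ‖r‖ ^ 2 := by ring
    _ ≤ _ := by
        gcongr
        linarith

theorem heatAvg_inner_sq_nonneg (hs : 0 < s) (v y : E) :
    0 ≤ heatAvg ν s (fun r => (inner ℝ v r ^ 2 : ℝ)) y :=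
  integral_nonneg fun _ => mul_nonneg (heatKernel_pos hs _).le (sq_nonneg _)

/-- The Cauchy-Schwarz inequality for the conditional expectation given `y`. -/
theorem sq_heatAvg_inner_div_le (hs : 0 < s) (v y : E) :
    (heatAvg ν s (fun r => (inner ℝ v r : ℝ)) y) ^ 2 / heatFlow ν s y ≤
      heatAvg ν s (fun r => (inner ℝ v r ^ 2 : ℝ)) y := by
  set A := heatAvg ν s (fun r => (inner ℝ v r : ℝ)) y with hA
  set u := heatFlow ν s y with hu
  have hu0 : 0 < u := heatFlow_pos hs y
  have i0 := integrable_heatKernel_sub (ν := ν) hs y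
  have i1 := integrable_heatKernel_smul (ν := ν) hs (w := fun r => (inner ℝ v r : ℝ))
    (by fun_prop) (norm_inner_le_growth v) y
  have i2 := integrable_heatKernel_smul (ν := ν) hs (w := fun r => (inner ℝ v r ^ 2 : ℝ))
    (by fun_prop) (norm_inner_sq_le_growth v) y
  -- the conditional variance, `A / u` being the conditional mean, is nonnegative
  have h : 0 ≤ ∫ x, (heatKernel s (y - x) • (inner ℝ v (y - x) ^ 2 : ℝ) -
      2 * (A / u) * (heatKernel s (y - x) • (inner ℝ v (y - x) : ℝ)) +
      (A / u) ^ 2 * heatKernel s (y - x)) ∂ν := by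
    refine integral_nonneg fun x => ?_
    have e : heatKernel s (y - x) • (inner ℝ v (y - x) ^ 2 : ℝ) -
      2 * (A / u) * (heatKernel s (y - x) • (inner ℝ v (y - x) : ℝ)) +
      (A / u) ^ 2 * heatKernel s (y - x) =
      heatKernel s (y - x) * (inner ℝ v (y - x) - A / u) ^ 2 := by
      simp only [smul_eq_mul]
      ring
    simp only [Pi.zero_apply]
    rw [e]
    exact mul_nonneg (heatKernel_pos hs _).le (sq_nonneg _)
  have i3 : Integrable (fun x => heatKernel s (y - x) • (inner ℝ v (y - x) ^ 2 : ℝ) -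
      2 * (A / u) * (heatKernel s (y - x) • (inner ℝ v (y - x) : ℝ))) ν :=
    i2.sub (i1.const_mul _)
  rw [integral_add i3 (i0.const_mul _), integral_sub i2 (i1.const_mul _), integral_const_mul,
    integral_const_mul] at h
  change 0 ≤ heatAvg ν s (fun r => (inner ℝ v r ^ 2 : ℝ)) y - 2 * (A / u) * A +
    (A / u) ^ 2 * u at h
  have e : 2 * (A / u) * A - (A / u) ^ 2 * u = A ^ 2 / u := by
    field_simp
    ring
  linarith

theorem sq_inner_heatGrad_div (hs : 0 < s) (v y : E) :
    (inner ℝ v (heatGrad ν s y)) ^ 2 / heatFlow ν s y = s⁻¹ ^ 2 *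
      ((heatAvg ν s (fun r => (inner ℝ v r : ℝ)) y) ^ 2 / heatFlow ν s y) := by
  rw [heatGrad, inner_neg_right, inner_smul_right, inner_heatAvg_id hs]
  ring

theorem integrable_sq_inner_heatGrad_div (hν : Integrable (fun x => ‖x‖ ^ 2) ν) (hs : 0 < s)
    (v : E) : Integrable (fun y => (inner ℝ v (heatGrad ν s y)) ^ 2 / heatFlow ν s y) := by
  simp_rw [sq_inner_heatGrad_div hs]
  refine Integrable.const_mul ?_ _
  have hcont : Continuous fun y => (heatAvg ν s (fun r => (inner ℝ v r : ℝ)) y) ^ 2 /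
      heatFlow ν s y :=
    ((continuous_heatAvg hs (by fun_prop) (norm_inner_le_growth v)).pow 2).div
      (continuous_heatFlow hs) fun y => (heatFlow_pos hs y).ne'
  refine (integrable_weight_mul_heatAvg hν hs (w := fun r => (inner ℝ v r ^ 2 : ℝ))
    (by fun_prop) (norm_inner_sq_le_growth v)).mono' hcont.aestronglyMeasurable
    (Eventually.of_forall fun y => ?_)
  rw [Real.norm_of_nonneg (div_nonneg (sq_nonneg _) (heatFlow_pos hs y).le)]
  refine (sq_heatAvg_inner_div_le hs v y).trans ?_
  rw [Real.norm_of_nonneg (heatAvg_inner_sq_nonneg hs v y)]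
  nlinarith [heatAvg_inner_sq_nonneg (ν := ν) hs v y, mul_nonneg (sq_nonneg ‖y‖)
    (heatAvg_inner_sq_nonneg (ν := ν) hs v y)]

/-- The trace of the Fisher information matrix of the heat flow. -/
def heatFisher (ν : Measure E) (s : ℝ) : ℝ :=
  ∫ y, heatFlow ν s y * ‖heatScore ν s y‖ ^ 2

theorem heatFlow_mul_norm_sq_heatScore (hs : 0 < s) (y : E) :
    heatFlow ν s y * ‖heatScore ν s y‖ ^ 2 =
      ∑ i, (inner ℝ (stdOrthonormalBasis ℝ E i) (heatGrad ν s y)) ^ 2 / heatFlow ν s y := by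
  have hu := (heatFlow_pos (ν := ν) hs y).ne'
  rw [← Finset.sum_div, (stdOrthonormalBasis ℝ E).sum_sq_inner_right, heatScore, norm_neg,
    norm_smul, norm_inv, mul_pow, Real.norm_eq_abs, inv_pow, sq_abs]
  field_simp

theorem integrable_heatFlow_mul_norm_sq_heatScore (hν : Integrable (fun x => ‖x‖ ^ 2) ν)
    (hs : 0 < s) : Integrable (fun y => heatFlow ν s y * ‖heatScore ν s y‖ ^ 2) := by
  simp_rw [heatFlow_mul_norm_sq_heatScore hs]
  exact integrable_finsetSum _ fun i _ => integrable_sq_inner_heatGrad_div hν hs _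

/-! ### De Bruijn's identity -/

/-- Quadratic growth of the weight in the second derivative of the heat flow in the
direction `v`. -/
theorem norm_laplaceWeight_le (hs : 0 < s) (v r : E) :
    ‖(inner ℝ v r ^ 2 / s ^ 2 - ‖v‖ ^ 2 / s : ℝ)‖ ≤
      (‖v‖ ^ 2 / s ^ 2 + ‖v‖ ^ 2 / s) * (1 + ‖r‖ ^ 2) := by
  refine (norm_sub_le _ _).trans ?_
  rw [norm_div, norm_div, norm_pow s, norm_pow ‖v‖, norm_norm, Real.norm_of_nonneg hs.le]
  have h1 := norm_inner_sq_le_growth v r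
  have h3 : 0 ≤ ‖v‖ ^ 2 / s * ‖r‖ ^ 2 := by positivity
  calc _ ≤ ‖v‖ ^ 2 * (1 + ‖r‖ ^ 2) / s ^ 2 + ‖v‖ ^ 2 / s := by gcongr
    _ ≤ _ := by
      rw [add_mul, div_mul_eq_mul_div]
      linarith

/-- Integration by parts in the direction `v`: `∫ (log u + 1) ∂²u = -∫ (∂u)² / u`. -/
theorem integral_log_mul_heatAvg (hν : Integrable (fun x => ‖x‖ ^ 2) ν) (hs : 0 < s) (v : E) :
    ∫ y, (Real.log (heatFlow ν s y) + 1) *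
        heatAvg ν s (fun r => (inner ℝ v r ^ 2 / s ^ 2 - ‖v‖ ^ 2 / s : ℝ)) y =
      -∫ y, (inner ℝ v (heatGrad ν s y)) ^ 2 / heatFlow ν s y := by
  obtain ⟨C, hC, hlog⟩ := exists_abs_log_heatFlow_le hν hs le_rfl
  have hlog1 : ∀ y, |Real.log (heatFlow ν s y) + 1| ≤ (C + 1) * (1 + ‖y‖ ^ 2) := fun y => by
    have h1 := abs_add_le (Real.log (heatFlow ν s y)) 1
    have h2 := hlog s ⟨le_rfl, le_rfl⟩ y
    rw [abs_one] at h1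
    nlinarith [sq_nonneg ‖y‖]
  have hlogc : Continuous fun y => Real.log (heatFlow ν s y) + 1 :=
    (continuous_log_heatFlow hs).add continuous_const
  have hscal : heatAvg ν s (fun r => (inner ℝ v r ^ 2 / s ^ 2 - ‖v‖ ^ 2 / s : ℝ)) =
      fun y => -s⁻¹ * heatAvg ν s (fun r => (‖v‖ ^ 2 - inner ℝ v r ^ 2 / s : ℝ)) y := by
    ext y
    rw [heatAvg, heatAvg, ← integral_const_mul]
    congr 1 with x
    simp only [smul_eq_mul]
    field_simp
    ring
  have hgrad : ∀ y, inner ℝ v (heatGrad ν s y) =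
      -s⁻¹ * heatAvg ν s (fun r => (inner ℝ v r : ℝ)) y := fun y => by
    rw [heatGrad, inner_neg_right, inner_smul_right, inner_heatAvg_id hs]
    ring
  have h := integral_bilinear_hasLineDerivAt_right_eq_neg_left_of_integrable
    (μ := (volume : Measure E)) (B := ContinuousLinearMap.mul ℝ ℝ) (v := v)
    (f := fun y => Real.log (heatFlow ν s y) + 1)
    (f' := fun y => inner ℝ v (heatGrad ν s y) / heatFlow ν s y)
    (g := fun y => inner ℝ v (heatGrad ν s y))
    (g' := heatAvg ν s (fun r => (inner ℝ v r ^ 2 / s ^ 2 - ‖v‖ ^ 2 / s : ℝ)))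
    ?_ ?_ ?_ ?_ ?_
  · simp only [ContinuousLinearMap.mul_apply'] at h
    rw [h]
    congr 2 with y
    ring
  · simp only [ContinuousLinearMap.mul_apply']
    refine (integrable_sq_inner_heatGrad_div hν hs v).congr (Eventually.of_forall fun y => ?_)
    simp only
    ring
  · simp only [ContinuousLinearMap.mul_apply']
    exact integrable_mul_heatAvg hν hs (by fun_prop) (norm_laplaceWeight_le hs v) hlogc hlog1
  · simp only [ContinuousLinearMap.mul_apply', hgrad]
    refine ((integrable_mul_heatAvg hν hs (by fun_prop) (norm_inner_le_growth v) hlogc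
      hlog1).const_mul (-s⁻¹)).congr (Eventually.of_forall fun y => ?_)
    simp only
    ring
  · intro y _
    have h1 : HasFDerivAt (fun y => Real.log (heatFlow ν s y) + 1)
        ((heatFlow ν s y)⁻¹ • innerSL ℝ (heatGrad ν s y)) y :=
      ((hasFDerivAt_heatFlow hs y).log (heatFlow_pos hs y).ne').add_const 1
    have h2 := h1.hasLineDerivAt v
    convert h2 using 1
    simp [real_inner_comm]
    ring
  · intro y _
    have h1 := (hasLineDerivAt_heatAvg_inner (ν := ν) hs y v)
    simp only [hgrad, hscal]
    have h2 : HasDerivAt (fun t : ℝ => heatAvg ν s (fun r => (inner ℝ v r : ℝ)) (y + t • v)) _ 0 :=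
      h1
    exact h2.const_mul (-s⁻¹)

/-- The heat equation `∂ₛ u = Δ u / 2`, in terms of heat averages. -/
theorem heatAvg_timeWeight (hs : 0 < s) (y : E) :
    heatAvg ν s (fun r => (‖r‖ ^ 2 / s ^ 2 - Module.finrank ℝ E / s) / 2) y =
      1 / 2 * ∑ i, heatAvg ν s (fun r => ((inner ℝ (stdOrthonormalBasis ℝ E i) r : ℝ) ^ 2 / s ^ 2 -
        ‖stdOrthonormalBasis ℝ E i‖ ^ 2 / s : ℝ)) y := by
  simp only [heatAvg]
  rw [← integral_finsetSum _ fun i _ => integrable_heatKernel_smul hs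
      (w := fun r => ((inner ℝ (stdOrthonormalBasis ℝ E i) r : ℝ) ^ 2 / s ^ 2 -
        ‖stdOrthonormalBasis ℝ E i‖ ^ 2 / s : ℝ)) (by fun_prop) (norm_laplaceWeight_le hs _) y,
    ← integral_const_mul]
  congr 1 with x
  simp only [smul_eq_mul]
  rw [← Finset.mul_sum, Finset.sum_sub_distrib, ← Finset.sum_div,
    (stdOrthonormalBasis ℝ E).sum_sq_inner_right]
  simp
  ring

/-- **De Bruijn's identity**: the entropy along the heat flow has half of the Fisher information
as its derivative. -/
theorem hasDerivAt_integral_negMulLog_heatFlow (hν : Integrable (fun x => ‖x‖ ^ 2) ν)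
    (hs : 0 < s) :
    HasDerivAt (fun s => ∫ y, Real.negMulLog (heatFlow ν s y)) (heatFisher ν s / 2) s := by
  have hs2 : 0 < s / 2 := half_pos hs
  set w : ℝ → E → ℝ := fun s r => (‖r‖ ^ 2 / s ^ 2 - Module.finrank ℝ E / s) / 2 with hw
  have hwc : ∀ s, Continuous (w s) := fun s => by fun_prop
  obtain ⟨C, hC, hlog⟩ := exists_abs_log_heatFlow_le hν hs2 (b := 2 * s) (by linarith)
  obtain ⟨D, hD, hbd⟩ := exists_norm_heatAvg_le (F := ℝ) ν hs2 (b := 2 * s) (by linarith)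
    (M := 1 / (s / 2) ^ 2 + Module.finrank ℝ E / (s / 2)) (by positivity)
  have hlog1 : ∀ t ∈ Icc (s / 2) (2 * s), ∀ y,
      |-Real.log (heatFlow ν t y) - 1| ≤ (C + 1) * (1 + ‖y‖ ^ 2) := fun t ht y => by
    have h1 := abs_sub (-Real.log (heatFlow ν t y)) 1
    have h2 := hlog t ht y
    rw [abs_one, abs_neg] at h1
    nlinarith [sq_nonneg ‖y‖]
  have hmem : s ∈ Icc (s / 2) (2 * s) := ⟨by linarith, by linarith⟩
  have hpos : ∀ t ∈ Icc (s / 2) (2 * s), 0 < t := fun t ht => hs2.trans_le ht.1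
  have hFc : Continuous fun y => (-Real.log (heatFlow ν s y) - 1) * heatAvg ν s (w s) y :=
    ((continuous_log_heatFlow hs).neg.sub continuous_const).mul
      (continuous_heatAvg hs (hwc s) (norm_timeWeight_le hs2 hmem.1))
  have key := (hasDerivAt_integral_of_dominated_loc_of_deriv_le (μ := (volume : Measure E))
    (x₀ := s) (s := Icc (s / 2) (2 * s))
    (bound := fun y => (C + 1) * D * ((1 + ‖y‖ ^ 2) * heatEnvelope ν (1 / (4 * (2 * s))) y))
    (F := fun s y => Real.negMulLog (heatFlow ν s y))
    (F' := fun s y => (-Real.log (heatFlow ν s y) - 1) * heatAvg ν s (w s) y)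
    (Icc_mem_nhds (by linarith) (by linarith))
    ((lt_mem_nhds hs).mono fun t ht =>
      (Real.continuous_negMulLog.comp (continuous_heatFlow ht)).aestronglyMeasurable)
    (integrable_negMulLog_heatFlow hν hs) hFc.aestronglyMeasurable
    (Eventually.of_forall fun y t ht => ?_)
    ((integrable_weight_mul_heatEnvelope hν (by positivity)).const_mul _)
    (Eventually.of_forall fun y t ht => ?_)).2
  · refine key.congr_deriv ?_
    have hD : ∀ i, Integrable fun y => (Real.log (heatFlow ν s y) + 1) *
        heatAvg ν s (fun r => ((inner ℝ (stdOrthonormalBasis ℝ E i) r : ℝ) ^ 2 / s ^ 2 -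
        ‖stdOrthonormalBasis ℝ E i‖ ^ 2 / s : ℝ)) y := fun i => by
      refine integrable_mul_heatAvg hν hs (by fun_prop) (norm_laplaceWeight_le hs _)
        ((continuous_log_heatFlow hs).add continuous_const) (C := C + 1) fun y => ?_
      have := hlog1 s hmem y
      rwa [← abs_neg, neg_sub, sub_neg_eq_add, add_comm] at this
    calc ∫ y, (-Real.log (heatFlow ν s y) - 1) * heatAvg ν s (w s) y
        = ∫ y, -(1 / 2) * ∑ i, (Real.log (heatFlow ν s y) + 1) *
          heatAvg ν s (fun r => ((inner ℝ (stdOrthonormalBasis ℝ E i) r : ℝ) ^ 2 / s ^ 2 -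
          ‖stdOrthonormalBasis ℝ E i‖ ^ 2 / s : ℝ)) y := by
          congr 1 with y
          rw [hw, heatAvg_timeWeight hs, ← Finset.mul_sum]
          ring
      _ = -(1 / 2) * ∑ i, -∫ y, (inner ℝ (stdOrthonormalBasis ℝ E i) (heatGrad ν s y)) ^ 2 /
          heatFlow ν s y := by
          rw [integral_const_mul, integral_finsetSum _ fun i _ => hD i]
          simp_rw [integral_log_mul_heatAvg hν hs]
      _ = heatFisher ν s / 2 := by
          rw [heatFisher]
          simp_rw [heatFlow_mul_norm_sq_heatScore hs]
          rw [integral_finsetSum _ fun i _ => integrable_sq_inner_heatGrad_div hν hs _,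
            Finset.sum_neg_distrib]
          ring
  · have h1 := hlog1 t ht y
    have h2 := hbd t ht (w t) (norm_timeWeight_le hs2 ht.1) y
    rw [norm_mul, Real.norm_eq_abs]
    calc _ ≤ ((C + 1) * (1 + ‖y‖ ^ 2)) * (D * heatEnvelope ν (1 / (4 * (2 * s))) y) := by gcongr
      _ = _ := by ring
  · exact (Real.hasDerivAt_negMulLog (heatFlow_pos (hpos t ht) y).ne').comp t
      (hasDerivAt_heatFlow (ν := ν) (hpos t ht) y)

end

section

/-! ### Laws with a real-valued density -/

section Density

variable {α : Type*} [MeasurableSpace α] {m : Measure α} {f : α → ℝ}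
variable {F : Type*} [NormedAddCommGroup F] [NormedSpace ℝ F]

theorem integral_withDensity_ofReal (hf : Measurable f) (hf0 : ∀ x, 0 ≤ f x) (g : α → F) :
    ∫ x, g x ∂(m.withDensity fun x => ENNReal.ofReal (f x)) = ∫ x, f x • g x ∂m := by
  rw [integral_withDensity_eq_integral_toReal_smul hf.ennreal_ofReal
    (Eventually.of_forall fun _ => ENNReal.ofReal_lt_top)]
  simp_rw [ENNReal.toReal_ofReal (hf0 _)]

theorem integrable_withDensity_ofReal_iff (hf : Measurable f) (hf0 : ∀ x, 0 ≤ f x) {g : α → F} :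
    Integrable g (m.withDensity fun x => ENNReal.ofReal (f x)) ↔
      Integrable (fun x => f x • g x) m := by
  rw [integrable_withDensity_iff_integrable_smul' hf.ennreal_ofReal
    (Eventually.of_forall fun _ => ENNReal.ofReal_lt_top)]
  simp_rw [ENNReal.toReal_ofReal (hf0 _)]

end Density

variable {E : Type*} [NormedAddCommGroup E] [InnerProductSpace ℝ E] [MeasurableSpace E]
  [BorelSpace E] [FiniteDimensional ℝ E]
variable {ν : Measure E} [IsProbabilityMeasure ν] {s : ℝ}

/-! ### The law of the heat flow -/

/-- The law at time `s > 0` of the heat flow started from `ν`, given by its density. -/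
def flowLaw (ν : Measure E) (s : ℝ) : Measure E :=
  volume.withDensity fun y => ENNReal.ofReal (heatFlow ν s y)

theorem integral_flowLaw {F : Type*} [NormedAddCommGroup F] [NormedSpace ℝ F] (hs : 0 < s)
    (g : E → F) : ∫ y, g y ∂(flowLaw ν s) = ∫ y, heatFlow ν s y • g y :=
  integral_withDensity_ofReal (continuous_heatFlow hs).measurable
    (fun y => (heatFlow_pos hs y).le) g

theorem integrable_flowLaw_iff {F : Type*} [NormedAddCommGroup F] [NormedSpace ℝ F] (hs : 0 < s)
    {g : E → F} : Integrable g (flowLaw ν s) ↔ Integrable (fun y => heatFlow ν s y • g y) :=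
  integrable_withDensity_ofReal_iff (continuous_heatFlow hs).measurable
    (fun y => (heatFlow_pos hs y).le)

theorem prod_heatMeasure (ν : Measure E) [SFinite ν] (s : ℝ) : ν.prod (heatMeasure E s) =
    (ν.prod volume).withDensity fun p => ENNReal.ofReal (heatKernel s p.2) := by
  rw [heatMeasure, prod_withDensity_right (continuous_heatKernel s).measurable.ennreal_ofReal]

/-- The heat flow of `ν` at time `s` is the law of `X + R` with `X` of law `ν` and `R` an
independent Gaussian of covariance `s`. -/
theorem map_add_prod_heatMeasure (hs : 0 < s) :
    (ν.prod (heatMeasure E s)).map (fun p => p.1 + p.2) = flowLaw ν s := by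
  ext B hB
  have hmeas : Measurable fun p : E × E => p.1 + p.2 := measurable_fst.add measurable_snd
  have hK : Measurable fun p : E × E => heatKernel s (p.2 - p.1) :=
    (continuous_heatKernel s).measurable.comp (measurable_snd.sub measurable_fst)
  rw [Measure.map_apply hmeas hB, prod_heatMeasure, withDensity_apply _ (hmeas hB),
    ← lintegral_indicator (hmeas hB), flowLaw, withDensity_apply _ hB,
    ← (measurePreserving_shear ν).lintegral_comp (Measurable.indicator (f := fun p : E × E =>
      ENNReal.ofReal (heatKernel s p.2))
      ((continuous_heatKernel s).measurable.comp measurable_snd).ennreal_ofReal (hmeas hB))]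
  have e : ∀ p : E × E, ((fun p : E × E => p.1 + p.2) ⁻¹' B).indicator
      (fun p => ENNReal.ofReal (heatKernel s p.2)) ((MeasurableEquiv.shearAddRight E).symm p) =
      B.indicator (fun _ => ENNReal.ofReal (heatKernel s (p.2 - p.1))) p.2 := by
    intro p
    have hp : (MeasurableEquiv.shearAddRight E).symm p = (p.1, p.2 - p.1) := by
      simp [MeasurableEquiv.shearAddRight, ← sub_eq_neg_add]
    have hmem : (p.1, p.2 - p.1) ∈ (fun p : E × E => p.1 + p.2) ⁻¹' B ↔ p.2 ∈ B := by
      rw [mem_preimage, add_sub_cancel]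
    rw [hp]
    by_cases h : p.2 ∈ B
    · rw [indicator_of_mem (hmem.2 h), indicator_of_mem h]
    · rw [indicator_of_notMem (fun h' => h (hmem.1 h')), indicator_of_notMem h]
  simp_rw [e]
  rw [lintegral_prod_symm _ (by
    exact ((hK.ennreal_ofReal).indicator (measurable_snd hB)).aemeasurable),
    ← lintegral_indicator hB]
  congr 1 with y
  by_cases hy : y ∈ B
  · simp only [indicator_of_mem hy]
    rw [heatFlow, ofReal_integral_eq_lintegral_ofReal (integrable_heatKernel_sub hs y)
      (Eventually.of_forall fun x => (heatKernel_pos hs _).le)]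
  · simp [indicator_of_notMem hy]

theorem isProbabilityMeasure_flowLaw (hs : 0 < s) : IsProbabilityMeasure (flowLaw ν s) := by
  have := isProbabilityMeasure_heatMeasure (E := E) hs
  rw [← map_add_prod_heatMeasure hs]
  exact Measure.isProbabilityMeasure_map (by fun_prop)

theorem integral_heatFlow (hs : 0 < s) : ∫ y, heatFlow ν s y = 1 := by
  have := isProbabilityMeasure_flowLaw (ν := ν) hs
  have h := integral_flowLaw (ν := ν) hs (fun _ => (1 : ℝ))
  simpa using h.symm

/-! ### Second moments -/

theorem integrable_sq_norm_heatMeasure (hs : 0 < s) :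
    Integrable (fun r => ‖r‖ ^ 2) (heatMeasure E s) := by
  rw [heatMeasure, integrable_withDensity_ofReal_iff (continuous_heatKernel s).measurable
    fun r => (heatKernel_pos hs r).le]
  obtain ⟨C, hC, h⟩ := exists_norm_heatKernel_smul_le (E := E) (F := ℝ) hs le_rfl zero_le_one
  refine ((integrable_exp_neg_mul_norm_sq (E := E) (c := 1 / (4 * s)) (by positivity)).const_mul
    C).mono' ((continuous_heatKernel s).smul (by fun_prop)).aestronglyMeasurable
    (Eventually.of_forall fun r => ?_)
  refine h s ⟨le_rfl, le_rfl⟩ (fun r => ‖r‖ ^ 2) (fun r => ?_) r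
  rw [norm_pow, norm_norm]
  linarith

variable (E) in
/-- The second moment of the standard Gaussian. (It is the dimension of `E`, but its value is not
used.) -/
def gaussianMoment : ℝ := ∫ z, ‖z‖ ^ 2 ∂(stdGaussian E)

theorem integral_sq_norm_heatMeasure (hs : 0 < s) :
    ∫ r, ‖r‖ ^ 2 ∂(heatMeasure E s) = s * gaussianMoment E := by
  rw [← map_smul_stdGaussian hs, integral_map (by fun_prop)
    (Continuous.aestronglyMeasurable (by fun_prop)), gaussianMoment, ← integral_const_mul]
  congr 1 with z
  rw [norm_smul, mul_pow, Real.norm_of_nonneg (Real.sqrt_nonneg _), Real.sq_sqrt hs.le]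

theorem memLp_fst_prod_heatMeasure (hν : Integrable (fun x => ‖x‖ ^ 2) ν) (hs : 0 < s) :
    MemLp (fun p : E × E => p.1) 2 (ν.prod (heatMeasure E s)) := by
  have := isProbabilityMeasure_heatMeasure (E := E) hs
  rw [memLp_two_iff_integrable_sq_norm measurable_fst.aestronglyMeasurable]
  exact hν.comp_fst _

theorem memLp_snd_prod_heatMeasure (hs : 0 < s) :
    MemLp (fun p : E × E => p.2) 2 (ν.prod (heatMeasure E s)) := by
  have := isProbabilityMeasure_heatMeasure (E := E) hs
  rw [memLp_two_iff_integrable_sq_norm measurable_snd.aestronglyMeasurable]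
  exact (integrable_sq_norm_heatMeasure hs).comp_snd _

theorem integrable_inner_of_memLp {α : Type*} [MeasurableSpace α] {m : Measure α} {f g : α → E}
    (hf : MemLp f 2 m) (hg : MemLp g 2 m) : Integrable (fun x => (inner ℝ (f x) (g x) : ℝ)) m := by
  refine ((hf.integrable_norm_pow (by norm_num)).add (hg.integrable_norm_pow (by norm_num))).mono'
    (hf.1.inner hg.1) (Eventually.of_forall fun x => ?_)
  refine (norm_inner_le_norm _ _).trans ?_
  simp only [Pi.add_apply]
  nlinarith [sq_nonneg (‖f x‖ - ‖g x‖), sq_nonneg ‖f x‖, sq_nonneg ‖g x‖]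

theorem integral_inner_prod_heatMeasure (hν : Integrable (fun x => ‖x‖ ^ 2) ν) (hs : 0 < s) :
    ∫ p, (inner ℝ p.1 p.2 : ℝ) ∂(ν.prod (heatMeasure E s)) = 0 := by
  have := isProbabilityMeasure_heatMeasure (E := E) hs
  rw [integral_prod _ (integrable_inner_of_memLp (memLp_fst_prod_heatMeasure hν hs)
    (memLp_snd_prod_heatMeasure hs))]
  have h : ∀ x : E, ∫ r, (inner ℝ x r : ℝ) ∂(heatMeasure E s) = 0 := by
    intro x
    rw [heatMeasure, integral_withDensity_ofReal (continuous_heatKernel s).measurable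
      fun r => (heatKernel_pos hs r).le]
    -- the integrand is odd
    have h1 := integral_neg_eq_self (fun r : E => heatKernel s r • (inner ℝ x r : ℝ)) volume
    have h2 : ∀ r : E, heatKernel s (-r) • (inner ℝ x (-r) : ℝ) =
        -(heatKernel s r • (inner ℝ x r : ℝ)) := fun r => by
      simp [heatKernel]
    simp_rw [h2] at h1
    rw [integral_neg] at h1
    linarith
  simp [h]

theorem integral_sq_norm_flowLaw (hν : Integrable (fun x => ‖x‖ ^ 2) ν) (hs : 0 < s) :
    ∫ y, ‖y‖ ^ 2 ∂(flowLaw ν s) = ∫ x, ‖x‖ ^ 2 ∂ν + s * gaussianMoment E := by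
  have := isProbabilityMeasure_heatMeasure (E := E) hs
  rw [← map_add_prod_heatMeasure hs, integral_map (by fun_prop)
    (Continuous.aestronglyMeasurable (by fun_prop))]
  simp_rw [norm_add_sq_real]
  have i1 := (memLp_fst_prod_heatMeasure hν hs).integrable_norm_pow (by norm_num)
  have i2 := (memLp_snd_prod_heatMeasure (ν := ν) hs).integrable_norm_pow (by norm_num)
  have i3 := integrable_inner_of_memLp (memLp_fst_prod_heatMeasure hν hs)
    (memLp_snd_prod_heatMeasure (ν := ν) hs)
  simp only at i1 i2
  have i4 : Integrable (fun p : E × E => ‖p.1‖ ^ 2 + 2 * (inner ℝ p.1 p.2 : ℝ))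
    (ν.prod (heatMeasure E s)) := i1.add (i3.const_mul 2)
  rw [integral_add i4 i2, integral_add i1 (i3.const_mul 2), integral_const_mul,
    integral_inner_prod_heatMeasure hν hs, integral_fun_fst (fun x : E => ‖x‖ ^ 2),
    integral_fun_snd (fun x : E => ‖x‖ ^ 2), integral_sq_norm_heatMeasure hs]
  simp

/-! ### The score as a conditional expectation -/

theorem memLp_heatScore (hν : Integrable (fun x => ‖x‖ ^ 2) ν) (hs : 0 < s) :
    MemLp (heatScore ν s) 2 (flowLaw ν s) := by
  rw [memLp_two_iff_integrable_sq_norm (continuous_heatScore hs).aestronglyMeasurable,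
    integrable_flowLaw_iff hs]
  exact integrable_heatFlow_mul_norm_sq_heatScore hν hs

theorem heatFisher_eq_integral_flowLaw (hs : 0 < s) :
    heatFisher ν s = ∫ y, ‖heatScore ν s y‖ ^ 2 ∂(flowLaw ν s) := by
  rw [integral_flowLaw hs]
  rfl

/-- **Tweedie's formula**, tested against `φ`: the score of `X + R` is the conditional expectation
of `R / s` given `X + R`. -/
theorem integral_inner_heatScore (hs : 0 < s) {φ : E → E}
    (hint : Integrable (fun p : E × E => (inner ℝ p.2 (φ (p.1 + p.2)) : ℝ))
      (ν.prod (heatMeasure E s))) :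
    ∫ y, (inner ℝ (heatScore ν s y) (φ y) : ℝ) ∂(flowLaw ν s) =
      s⁻¹ * ∫ p, (inner ℝ p.2 (φ (p.1 + p.2)) : ℝ) ∂(ν.prod (heatMeasure E s)) := by
  have hKm : Measurable fun p : E × E => heatKernel s p.2 :=
    (continuous_heatKernel s).measurable.comp measurable_snd
  rw [prod_heatMeasure, integrable_withDensity_ofReal_iff hKm
    fun p => (heatKernel_pos hs p.2).le] at hint
  rw [prod_heatMeasure, integral_withDensity_ofReal hKm fun p => (heatKernel_pos hs p.2).le,
    integral_flowLaw hs,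
    ← (measurePreserving_shear ν).integral_comp' (g := fun p : E × E =>
      heatKernel s p.2 • (inner ℝ p.2 (φ (p.1 + p.2)) : ℝ))]
  have e : ∀ p : E × E, (fun p : E × E => heatKernel s p.2 • (inner ℝ p.2 (φ (p.1 + p.2)) : ℝ))
      ((MeasurableEquiv.shearAddRight E).symm p) =
      heatKernel s (p.2 - p.1) • (inner ℝ (p.2 - p.1) (φ p.2) : ℝ) := by
    intro p
    simp [MeasurableEquiv.shearAddRight, ← sub_eq_neg_add]
  simp_rw [e]
  have h1 := integrable_shear hint
  simp only [add_sub_cancel] at h1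
  rw [integral_prod_symm _ h1, ← integral_const_mul]
  congr 1 with y
  rw [smul_eq_mul, ← real_inner_smul_left, heatFlow_smul_heatScore hs, real_inner_smul_left,
    real_inner_comm]
  congr 1
  have h := (innerSL ℝ (φ y)).integral_comp_comm
    (integrable_heatKernel_smul (ν := ν) hs continuous_id norm_id_le y)
  rw [heatAvg]
  simp only [innerSL_apply_apply] at h
  rw [← h]
  congr 1 with x
  rw [inner_smul_right, real_inner_comm]
  rfl

/-! ### Fisher information of a linear image -/

variable {F : Type*} [NormedAddCommGroup F] [InnerProductSpace ℝ F] [MeasurableSpace F]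
  [BorelSpace F] [FiniteDimensional ℝ F]

/-! A co-isometry, i.e. a continuous linear map `A` with `A ∘ A* = id`, maps standard Gaussians to
standard Gaussians. Normalized weighted sums of the blocks of a vector, and the blocks themselves,
are of this form. -/

theorem charFun_map_continuousLinearMap (μ : Measure E) (A : E →L[ℝ] F) (t : F) :
    charFun (μ.map A) t = charFun μ (A.adjoint t) := by
  rw [charFun_apply, charFun_apply, integral_map A.continuous.measurable.aemeasurable
    (Continuous.aestronglyMeasurable (by fun_prop))]
  simp_rw [ContinuousLinearMap.adjoint_inner_right]

theorem norm_adjoint_of_coisometry {A : E →L[ℝ] F} (hA : A ∘L A.adjoint = .id ℝ F) (t : F) :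
    ‖A.adjoint t‖ ^ 2 = ‖t‖ ^ 2 := by
  have h : A (A.adjoint t) = t := DFunLike.congr_fun hA t
  rw [← real_inner_self_eq_norm_sq, ContinuousLinearMap.adjoint_inner_left, h,
    real_inner_self_eq_norm_sq]

theorem map_stdGaussian_of_coisometry {A : E →L[ℝ] F} (hA : A ∘L A.adjoint = .id ℝ F) :
    (stdGaussian E).map A = stdGaussian F := by
  have : IsProbabilityMeasure ((stdGaussian E).map A) :=
    Measure.isProbabilityMeasure_map A.continuous.measurable.aemeasurable
  apply Measure.ext_of_charFun
  ext t
  rw [charFun_map_continuousLinearMap, charFun_stdGaussian, charFun_stdGaussian,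
    ← Complex.ofReal_pow, ← Complex.ofReal_pow, norm_adjoint_of_coisometry hA]

theorem map_heatMeasure_of_coisometry {A : E →L[ℝ] F} (hA : A ∘L A.adjoint = .id ℝ F)
    (hs : 0 < s) : (heatMeasure E s).map A = heatMeasure F s := by
  rw [← map_smul_stdGaussian hs, ← map_smul_stdGaussian hs, ← map_stdGaussian_of_coisometry hA,
    Measure.map_map A.continuous.measurable (measurable_const_smul _),
    Measure.map_map (measurable_const_smul _) A.continuous.measurable]
  congr 1
  ext z
  simp

theorem map_flowLaw_of_coisometry {A : E →L[ℝ] F} (hA : A ∘L A.adjoint = .id ℝ F)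
    (hs : 0 < s) : (flowLaw ν s).map A = flowLaw (ν.map A) s := by
  have hAm := A.continuous.measurable
  have := Measure.isProbabilityMeasure_map (μ := ν) hAm.aemeasurable
  have := isProbabilityMeasure_heatMeasure (E := E) hs
  rw [← map_add_prod_heatMeasure hs, ← map_add_prod_heatMeasure hs,
    ← map_heatMeasure_of_coisometry hA hs, Measure.map_prod_map _ _ hAm hAm,
    Measure.map_map (by fun_prop) (by fun_prop), Measure.map_map (by fun_prop) (by fun_prop)]
  congr 1
  ext p
  simp

theorem integrable_sq_norm_map (hν : Integrable (fun x => ‖x‖ ^ 2) ν) (A : E →L[ℝ] F) :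
    Integrable (fun x => ‖x‖ ^ 2) (ν.map A) := by
  rw [integrable_map_measure (Continuous.aestronglyMeasurable (by fun_prop))
    A.continuous.measurable.aemeasurable]
  refine (hν.const_mul (‖A‖ ^ 2)).mono' (Continuous.aestronglyMeasurable (by fun_prop))
    (Eventually.of_forall fun x => ?_)
  simp only [Function.comp_apply]
  rw [norm_pow, norm_norm, ← mul_pow]
  gcongr
  exact A.le_opNorm x

/-- **Fisher information inequality**: under a co-isometry `A`, the score of the image is the
conditional expectation of the image of the score, which decreases the second moment. -/
theorem heatFisher_map_le {A : E →L[ℝ] F} (hA : A ∘L A.adjoint = .id ℝ F)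
    (hν : Integrable (fun x => ‖x‖ ^ 2) ν) (hs : 0 < s) :
    heatFisher (ν.map A) s ≤ ∫ y, ‖A (heatScore ν s y)‖ ^ 2 ∂(flowLaw ν s) := by
  have hAm := A.continuous.measurable
  have := Measure.isProbabilityMeasure_map (μ := ν) hAm.aemeasurable
  have := isProbabilityMeasure_heatMeasure (E := E) hs
  have := isProbabilityMeasure_heatMeasure (E := F) hs
  have hνA := integrable_sq_norm_map hν A
  set ρ := heatScore (ν.map A) s with hρ
  have hρc : Continuous ρ := continuous_heatScore hs
  have hρm := hρc.measurable
  have hLp : MemLp ρ 2 (flowLaw (ν.map A) s) := memLp_heatScore hνA hs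
  have hLp1 : MemLp (fun p : F × F => ρ (p.1 + p.2)) 2 ((ν.map A).prod (heatMeasure F s)) := by
    rw [← map_add_prod_heatMeasure hs] at hLp
    exact hLp.comp_of_map (by fun_prop)
  have hLp2 : MemLp (fun y => ρ (A y)) 2 (flowLaw ν s) := by
    rw [← map_flowLaw_of_coisometry hA hs] at hLp
    exact hLp.comp_of_map hAm.aemeasurable
  have hLp3 : MemLp (fun p : E × E => A.adjoint (ρ (A (p.1 + p.2)))) 2
      (ν.prod (heatMeasure E s)) := by
    rw [← map_add_prod_heatMeasure hs] at hLp2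
    exact (A.adjoint).comp_memLp' (hLp2.comp_of_map (by fun_prop))
  have hLp4 : MemLp (fun y => A (heatScore ν s y)) 2 (flowLaw ν s) :=
    A.comp_memLp' (memLp_heatScore hν hs)
  -- Tweedie's formula, downstairs and upstairs, identifies `ρ` as a conditional expectation
  have h1 : heatFisher (ν.map A) s =
      ∫ y, (inner ℝ (A (heatScore ν s y)) (ρ (A y)) : ℝ) ∂(flowLaw ν s) := by
    calc heatFisher (ν.map A) s = ∫ y, (inner ℝ (ρ y) (ρ y) : ℝ) ∂(flowLaw (ν.map A) s) := by
          rw [heatFisher_eq_integral_flowLaw hs]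
          simp_rw [real_inner_self_eq_norm_sq]
          rfl
      _ = s⁻¹ * ∫ p, (inner ℝ p.2 (ρ (p.1 + p.2)) : ℝ) ∂((ν.map A).prod (heatMeasure F s)) :=
          integral_inner_heatScore hs
            (integrable_inner_of_memLp (memLp_snd_prod_heatMeasure hs) hLp1)
      _ = s⁻¹ * ∫ p, (inner ℝ p.2 (A.adjoint (ρ (A (p.1 + p.2)))) : ℝ)
            ∂(ν.prod (heatMeasure E s)) := by
          rw [← map_heatMeasure_of_coisometry hA hs, Measure.map_prod_map _ _ hAm hAm,
            integral_map (by fun_prop) (Continuous.aestronglyMeasurable (by fun_prop))]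
          simp [ContinuousLinearMap.adjoint_inner_right]
      _ = ∫ y, (inner ℝ (heatScore ν s y) (A.adjoint (ρ (A y))) : ℝ) ∂(flowLaw ν s) :=
          (integral_inner_heatScore hs (φ := fun y => A.adjoint (ρ (A y)))
            (integrable_inner_of_memLp (memLp_snd_prod_heatMeasure hs) hLp3)).symm
      _ = _ := by simp_rw [ContinuousLinearMap.adjoint_inner_right]
  have h2 : ∫ y, ‖ρ (A y)‖ ^ 2 ∂(flowLaw ν s) = heatFisher (ν.map A) s := by
    rw [heatFisher_eq_integral_flowLaw hs, ← map_flowLaw_of_coisometry hA hs,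
      integral_map hAm.aemeasurable
        (Continuous.aestronglyMeasurable (by rw [← hρ]; fun_prop))]
  have i1 := hLp4.integrable_norm_pow (p := 2) (by norm_num)
  have i2 := hLp2.integrable_norm_pow (p := 2) (by norm_num)
  have h3 := integral_mono (integrable_inner_of_memLp hLp4 hLp2)
    ((i1.const_mul (1 / 2)).add (i2.const_mul (1 / 2))) (fun y => by
      have := real_inner_le_norm (A (heatScore ν s y)) (ρ (A y))
      simp only [Pi.add_apply]
      nlinarith [sq_nonneg (‖A (heatScore ν s y)‖ - ‖ρ (A y)‖)])
  simp only [Pi.add_apply] at h3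
  rw [← h1, integral_add (i1.const_mul _) (i2.const_mul _), integral_const_mul,
    integral_const_mul, h2] at h3
  linarith

/-! ### Parabolic scaling -/

theorem heatFlow_map_smul {c : ℝ} (hc : 0 < c) (hs : 0 < s) (y : E) :
    heatFlow (ν.map (fun x => c • x)) (c ^ 2 * s) (c • y) =
      c⁻¹ ^ Module.finrank ℝ E * heatFlow ν s y := by
  have hK : Continuous fun x : E => heatKernel (c ^ 2 * s) (c • y - x) :=
    (continuous_heatKernel _).comp (by fun_prop)
  rw [heatFlow, heatFlow, integral_map (by fun_prop) hK.aestronglyMeasurable,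
    ← integral_const_mul]
  congr 1 with x
  rw [← smul_sub, heatKernel_smul hc hs]

theorem heatGrad_map_smul {c : ℝ} (hc : 0 < c) (hs : 0 < s) (y : E) :
    heatGrad (ν.map (fun x => c • x)) (c ^ 2 * s) (c • y) =
      (c⁻¹ ^ Module.finrank ℝ E * c⁻¹) • heatGrad ν s y := by
  have h : heatAvg (ν.map (fun x => c • x)) (c ^ 2 * s) id (c • y) =
      (c⁻¹ ^ Module.finrank ℝ E * c) • heatAvg ν s id y := by
    rw [heatAvg, heatAvg, integral_map (by fun_prop)
      (aestronglyMeasurable_heatKernel_smul continuous_id _), ← integral_smul]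
    congr 1 with x
    simp only [id]
    rw [← smul_sub, heatKernel_smul hc hs, smul_smul, smul_smul]
    congr 1
    ring
  rw [heatGrad, heatGrad, h, smul_neg, smul_smul, smul_smul]
  congr 2
  field_simp

theorem heatScore_map_smul {c : ℝ} (hc : 0 < c) (hs : 0 < s) (y : E) :
    heatScore (ν.map (fun x => c • x)) (c ^ 2 * s) (c • y) = c⁻¹ • heatScore ν s y := by
  rw [heatScore, heatScore, heatFlow_map_smul hc hs, heatGrad_map_smul hc hs, smul_neg, smul_smul,
    smul_smul]
  congr 2
  field_simp

theorem heatFisher_map_smul {c : ℝ} (hc : 0 < c) (hs : 0 < s) :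
    heatFisher (ν.map (fun x => c • x)) (c ^ 2 * s) = c⁻¹ ^ 2 * heatFisher ν s := by
  have h := Measure.integral_comp_smul (volume : Measure E)
    (fun y => heatFlow (ν.map (fun x => c • x)) (c ^ 2 * s) y *
      ‖heatScore (ν.map (fun x => c • x)) (c ^ 2 * s) y‖ ^ 2) c
  simp_rw [heatScore_map_smul hc hs, heatFlow_map_smul hc hs] at h
  rw [abs_of_pos (by positivity), smul_eq_mul] at h
  change _ = _ * heatFisher _ _ at h
  have h2 : ∫ y, c⁻¹ ^ Module.finrank ℝ E * heatFlow ν s y * ‖c⁻¹ • heatScore ν s y‖ ^ 2 =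
      (c ^ Module.finrank ℝ E)⁻¹ * (c⁻¹ ^ 2 * heatFisher ν s) := by
    rw [heatFisher, ← integral_const_mul, ← integral_const_mul]
    congr 1 with y
    rw [norm_smul, mul_pow, Real.norm_of_nonneg (inv_pos.2 hc).le, inv_pow c]
    ring
  rw [h2] at h
  exact (mul_left_cancel₀ (by positivity) h).symm

theorem integral_negMulLog_heatFlow_map_smul (hν : Integrable (fun x => ‖x‖ ^ 2) ν) {c : ℝ}
    (hc : 0 < c) (hs : 0 < s) :
    ∫ y, Real.negMulLog (heatFlow (ν.map (fun x => c • x)) (c ^ 2 * s) y) =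
      (∫ y, Real.negMulLog (heatFlow ν s y)) + Module.finrank ℝ E * Real.log c := by
  have h := Measure.integral_comp_smul (volume : Measure E)
    (fun y => Real.negMulLog (heatFlow (ν.map (fun x => c • x)) (c ^ 2 * s) y)) c
  simp_rw [heatFlow_map_smul hc hs, Real.negMulLog_mul] at h
  rw [integral_add ((integrable_heatFlow hν hs).mul_const _)
    ((integrable_negMulLog_heatFlow hν hs).const_mul _), integral_mul_const, integral_const_mul,
    integral_heatFlow hs, abs_of_pos (by positivity), smul_eq_mul, one_mul, Real.negMulLog,
    ← inv_pow c, Real.log_pow, Real.log_inv] at h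
  have hc' : 0 < c⁻¹ ^ Module.finrank ℝ E := by positivity
  have h2 : c⁻¹ ^ Module.finrank ℝ E * ((∫ y, Real.negMulLog (heatFlow ν s y)) +
      Module.finrank ℝ E * Real.log c) = c⁻¹ ^ Module.finrank ℝ E *
      ∫ y, Real.negMulLog (heatFlow (ν.map (fun x => c • x)) (c ^ 2 * s) y) := by
    rw [← h]
    ring
  exact (mul_left_cancel₀ hc'.ne' h2).symm

end

section

variable {E : Type*} [NormedAddCommGroup E] [InnerProductSpace ℝ E] [MeasurableSpace E]
  [BorelSpace E] [FiniteDimensional ℝ E]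
variable {ν : Measure E} [IsProbabilityMeasure ν] {s : ℝ}

/-! ### Relative entropy with respect to the standard Gaussian -/

/-- The nonnegative integrand `u log (u / γ) - u + γ` of the relative entropy of a density `u`
with respect to the standard Gaussian density `γ`, where `u` is the value at `y`. The terms
`-u + γ` integrate to zero and make the integrand nonnegative pointwise. -/
def relEntropyIntegrand (y : E) (u : ℝ) : ℝ :=
  -Real.negMulLog u + (Module.finrank ℝ E / 2 * Real.log (2 * Real.pi) + ‖y‖ ^ 2 / 2) * u +
    heatKernel 1 y - u

theorem relEntropyIntegrand_eq (y : E) (u : ℝ) : relEntropyIntegrand y u =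
    u * Real.log u - u * Real.log (heatKernel 1 y) + heatKernel 1 y - u := by
  rw [relEntropyIntegrand, log_heatKernel one_pos, Real.negMulLog]
  ring_nf

theorem relEntropyIntegrand_nonneg (y : E) {u : ℝ} (hu : 0 ≤ u) :
    0 ≤ relEntropyIntegrand y u := by
  rw [relEntropyIntegrand_eq]
  have hk := heatKernel_pos one_pos y
  rcases hu.eq_or_lt with rfl | hu
  · simpa using hk.le
  · have h1 := Real.log_le_sub_one_of_pos (div_pos hk hu)
    rw [Real.log_div hk.ne' hu.ne'] at h1
    have h2 := mul_le_mul_of_nonneg_left h1 hu.le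
    have h3 : u * (heatKernel 1 y / u - 1) = heatKernel 1 y - u := by
      field_simp
    linarith

theorem continuous_relEntropyIntegrand (y : E) : Continuous (relEntropyIntegrand y) := by
  unfold relEntropyIntegrand
  have := Real.continuous_negMulLog
  fun_prop

section Density

variable {f : E → ℝ} (hf : Integrable f) (hf2 : Integrable fun y => ‖y‖ ^ 2 * f y)
  (hlog : Integrable fun y => Real.negMulLog (f y))
include hf hf2 hlog

theorem integrable_relEntropyIntegrand : Integrable fun y => relEntropyIntegrand y (f y) := by
  have h2 : Integrable fun y => (Module.finrank ℝ E / 2 * Real.log (2 * Real.pi) + ‖y‖ ^ 2 / 2) *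
      f y := by
    refine ((hf.const_mul (Module.finrank ℝ E / 2 * Real.log (2 * Real.pi))).add
      (hf2.const_mul (1 / 2))).congr (Eventually.of_forall fun y => ?_)
    simp only [Pi.add_apply]
    ring
  exact ((hlog.neg.add h2).add (integrable_heatKernel one_pos)).sub hf

theorem integral_relEntropyIntegrand (hf1 : ∫ y, f y = 1) :
    ∫ y, relEntropyIntegrand y (f y) = Module.finrank ℝ E / 2 * Real.log (2 * Real.pi) +
      (∫ y, ‖y‖ ^ 2 * f y) / 2 - ∫ y, Real.negMulLog (f y) := by
  have e : ∀ y, relEntropyIntegrand y (f y) = (-Real.negMulLog (f y) +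
      (Module.finrank ℝ E / 2 * Real.log (2 * Real.pi) * f y + 1 / 2 * (‖y‖ ^ 2 * f y))) +
      heatKernel 1 y - f y := fun y => by
    rw [relEntropyIntegrand]
    ring
  simp_rw [e]
  have i1 := hf.const_mul (Module.finrank ℝ E / 2 * Real.log (2 * Real.pi))
  have i2 := hf2.const_mul (1 / 2)
  have i3 : Integrable fun y => Module.finrank ℝ E / 2 * Real.log (2 * Real.pi) * f y +
      1 / 2 * (‖y‖ ^ 2 * f y) := i1.add i2
  have i4 : Integrable fun y => -Real.negMulLog (f y) +
      (Module.finrank ℝ E / 2 * Real.log (2 * Real.pi) * f y + 1 / 2 * (‖y‖ ^ 2 * f y)) :=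
    hlog.neg.add i3
  have i5 : Integrable fun y => -Real.negMulLog (f y) +
      (Module.finrank ℝ E / 2 * Real.log (2 * Real.pi) * f y + 1 / 2 * (‖y‖ ^ 2 * f y)) +
      heatKernel 1 y := i4.add (integrable_heatKernel one_pos)
  rw [integral_sub i5 hf, integral_add i4 (integrable_heatKernel one_pos),
    integral_add (f := fun y => -Real.negMulLog (f y)) hlog.neg i3, integral_add i1 i2,
    integral_neg, integral_const_mul, integral_const_mul, integral_heatKernel one_pos, hf1]
  ring

/-- The entropy is bounded in terms of the second moment, because the relative entropy with respect
to the standard Gaussian is nonnegative. -/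
theorem integral_negMulLog_le (hf0 : ∀ y, 0 ≤ f y) (hf1 : ∫ y, f y = 1) :
    ∫ y, Real.negMulLog (f y) ≤
      Module.finrank ℝ E / 2 * Real.log (2 * Real.pi) + (∫ y, ‖y‖ ^ 2 * f y) / 2 := by
  have h := integral_relEntropyIntegrand hf hf2 hlog hf1
  have : 0 ≤ ∫ y, relEntropyIntegrand y (f y) :=
    integral_nonneg fun y => relEntropyIntegrand_nonneg y (hf0 y)
  linarith

end Density

theorem integrable_sq_norm_mul_heatFlow (hν : Integrable (fun x => ‖x‖ ^ 2) ν) (hs : 0 < s) :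
    Integrable (fun y => ‖y‖ ^ 2 * heatFlow ν s y) := by
  refine integrable_mul_heatFlow hν hs (C := 1) (by fun_prop) fun y => ?_
  rw [abs_of_nonneg (by positivity)]
  linarith

theorem integral_sq_norm_mul_heatFlow (hν : Integrable (fun x => ‖x‖ ^ 2) ν) (hs : 0 < s) :
    ∫ y, ‖y‖ ^ 2 * heatFlow ν s y = ∫ x, ‖x‖ ^ 2 ∂ν + s * gaussianMoment E := by
  rw [← integral_sq_norm_flowLaw hν hs, integral_flowLaw hs]
  simp_rw [smul_eq_mul, mul_comm]

theorem integral_negMulLog_heatFlow_le (hν : Integrable (fun x => ‖x‖ ^ 2) ν) (hs : 0 < s) :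
    ∫ y, Real.negMulLog (heatFlow ν s y) ≤ Module.finrank ℝ E / 2 * Real.log (2 * Real.pi) +
      (∫ x, ‖x‖ ^ 2 ∂ν + s * gaussianMoment E) / 2 := by
  rw [← integral_sq_norm_mul_heatFlow hν hs]
  exact integral_negMulLog_le (integrable_heatFlow hν hs) (integrable_sq_norm_mul_heatFlow hν hs)
    (integrable_negMulLog_heatFlow hν hs) (fun y => (heatFlow_pos hs y).le) (integral_heatFlow hs)

/-- Conditioning on the starting point decreases the entropy: the entropy of the heat flow is at
least that of the heat kernel. -/
theorem le_integral_negMulLog_heatFlow (hν : Integrable (fun x => ‖x‖ ^ 2) ν) (hs : 0 < s) :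
    Module.finrank ℝ E / 2 * Real.log (2 * Real.pi * s) + gaussianMoment E / 2 ≤
      ∫ y, Real.negMulLog (heatFlow ν s y) := by
  have e : ∀ r : E, Real.negMulLog (heatKernel s r) =
      Module.finrank ℝ E / 2 * Real.log (2 * Real.pi * s) * heatKernel s r +
        1 / (2 * s) * (heatKernel s r • ‖r‖ ^ 2) := fun r => by
    rw [Real.negMulLog, log_heatKernel hs, smul_eq_mul]
    field_simp
    ring
  have hKm : Measurable (heatKernel s : E → ℝ) := (continuous_heatKernel s).measurable
  have hK0 : ∀ r : E, 0 ≤ heatKernel s r := fun r => (heatKernel_pos hs r).le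
  have i1 := (integrable_heatKernel (E := E) hs).const_mul
    (Module.finrank ℝ E / 2 * Real.log (2 * Real.pi * s))
  have i2 : Integrable fun r : E => 1 / (2 * s) * (heatKernel s r • ‖r‖ ^ 2) :=
    ((integrable_withDensity_ofReal_iff hKm hK0).1 (integrable_sq_norm_heatMeasure hs)).const_mul _
  have i3 : Integrable fun r : E => Real.negMulLog (heatKernel s r) := by
    simp_rw [e]
    exact i1.add i2
  have hval : ∫ r : E, Real.negMulLog (heatKernel s r) =
      Module.finrank ℝ E / 2 * Real.log (2 * Real.pi * s) + gaussianMoment E / 2 := by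
    simp_rw [e]
    have := integral_withDensity_ofReal (m := (volume : Measure E)) hKm hK0 (fun r => ‖r‖ ^ 2)
    rw [integral_add i1 i2, integral_const_mul, integral_const_mul, integral_heatKernel hs,
      ← this]
    change _ + 1 / (2 * s) * ∫ r, ‖r‖ ^ 2 ∂(heatMeasure E s) = _
    rw [integral_sq_norm_heatMeasure hs]
    field_simp
  have i4 : Integrable (fun p : E × E => Real.negMulLog (heatKernel s (p.2 - p.1)))
      (ν.prod volume) := integrable_shear (f := fun p => Real.negMulLog (heatKernel s p.2))
        (i3.comp_snd ν)
  have h1 : ∫ y, ∫ x, Real.negMulLog (heatKernel s (y - x)) ∂ν =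
      ∫ r : E, Real.negMulLog (heatKernel s r) := by
    rw [integral_integral_swap (f := fun y x => Real.negMulLog (heatKernel s (y - x))) i4.swap]
    simp_rw [integral_sub_right_eq_self (fun r => Real.negMulLog (heatKernel s r))]
    simp
  rw [← hval, ← h1]
  refine integral_mono_ae i4.integral_prod_right (integrable_negMulLog_heatFlow hν hs) ?_
  filter_upwards [i4.swap.prod_right_ae] with y hy
  -- the heat flow is an average of translates of the heat kernel, and `-u log u` is concave
  refine Real.concaveOn_negMulLog.le_map_integral Real.continuous_negMulLog.continuousOn
    isClosed_Ici (Eventually.of_forall fun x => hK0 _) (integrable_heatKernel_sub hs y) hy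

end

section

variable {E : Type*} [NormedAddCommGroup E] [InnerProductSpace ℝ E] [MeasurableSpace E]
  [BorelSpace E] [FiniteDimensional ℝ E]
variable {ν : Measure E} [IsProbabilityMeasure ν] {s : ℝ}

/-! ### Continuity of the entropy at the initial time -/

theorem continuous_vadd_Lp_one (f : Lp ℝ 1 (volume : Measure E)) :
    Continuous fun r : E => DomAddAct.mk r +ᵥ f := by
  have : Fact ((1 : ENNReal) ≠ ⊤) := ⟨ENNReal.one_ne_top⟩
  have : ContinuousVAdd Eᵈᵃᵃ (Lp ℝ 1 (volume : Measure E)) := Lp.instContinuousVAddDomAddAct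
  have h : Continuous fun q : Eᵈᵃᵃ × Lp ℝ 1 (volume : Measure E) => q.1 +ᵥ q.2 := continuous_vadd
  have h2 : Continuous (fun r : E => (DomAddAct.mk r : Eᵈᵃᵃ)) := DomAddAct.continuous_mk
  exact h.comp (h2.prodMk continuous_const)

/-- Translation is continuous in `L¹`. -/
theorem continuous_integral_abs_translate_sub {p : E → ℝ} (hp : Integrable p) :
    Continuous (fun r => ∫ y, |p (r + y) - p y|) := by
  obtain ⟨f, h2⟩ : ∃ f : Lp ℝ 1 (volume : Measure E), f =ᵐ[volume] p :=
    ⟨hp.toL1 p, hp.coeFn_toL1⟩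
  have h1 : Continuous fun r : E => dist (DomAddAct.mk r +ᵥ f) f :=
    (continuous_vadd_Lp_one f).dist continuous_const
  convert h1 using 2 with r
  rw [dist_eq_norm, L1.norm_eq_integral_norm]
  refine integral_congr_ae ?_
  have h3 : (fun y => f (r + y)) =ᵐ[volume] fun y => p (r + y) :=
    (measurePreserving_add_left volume r).quasiMeasurePreserving.ae_eq h2
  filter_upwards [Lp.coeFn_sub (DomAddAct.mk r +ᵥ f) f, DomAddAct.vadd_Lp_ae_eq (DomAddAct.mk r) f,
    h2, h3] with y e1 e2 e3 e4
  rw [e1, Pi.sub_apply, e2, e3, Real.norm_eq_abs]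
  exact congrArg (fun z => |z - p y|) e4.symm

section Density

variable {p : E → ℝ} (hp : Measurable p) (hp0 : ∀ x, 0 ≤ p x)
  (hνp : ν = volume.withDensity fun x => ENNReal.ofReal (p x))
include hp hp0 hνp

theorem integrable_of_eq_withDensity : Integrable p := by
  have h : Integrable (fun _ : E => (1 : ℝ)) ν := integrable_const 1
  rw [hνp, integrable_withDensity_ofReal_iff hp hp0] at h
  simpa using h

theorem integral_of_eq_withDensity : ∫ x, p x = 1 := by
  have h : ∫ _ : E, (1 : ℝ) ∂ν = 1 := by simp
  rw [hνp, integral_withDensity_ofReal hp hp0] at h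
  simpa using h

theorem entropy_eq_of_eq_withDensity : entropy ν = ∫ x, Real.negMulLog (p x) := by
  refine integral_congr_ae ?_
  have h := Measure.rnDeriv_withDensity (volume : Measure E) hp.ennreal_ofReal
  rw [← hνp] at h
  filter_upwards [h] with x hx
  rw [hx, ENNReal.toReal_ofReal (hp0 x)]

omit hp hp0 hνp in
theorem integrable_translate_heatMeasure {f : E → ℝ} (hf : Integrable f) (hs : 0 < s) (y : E) :
    Integrable (fun r => f (y + r)) (heatMeasure E s) := by
  rw [heatMeasure, integrable_withDensity_ofReal_iff (continuous_heatKernel s).measurable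
    fun r => (heatKernel_pos hs r).le]
  refine (hf.comp_add_left y).bdd_smul ((2 * Real.pi * s) ^ (-(Module.finrank ℝ E / 2 : ℝ)))
    (continuous_heatKernel s).aestronglyMeasurable (Eventually.of_forall fun r => ?_)
  rw [Real.norm_of_nonneg (heatKernel_pos hs r).le]
  exact heatKernel_le hs r

theorem heatFlow_eq_integral_translate (hs : 0 < s) (y : E) :
    heatFlow ν s y = ∫ r, p (y + r) ∂(heatMeasure E s) := by
  rw [heatFlow, hνp, integral_withDensity_ofReal hp hp0, heatMeasure, integral_withDensity_ofReal
    (continuous_heatKernel s).measurable fun r => (heatKernel_pos hs r).le,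
    ← integral_add_left_eq_self _ y]
  congr 1 with r
  simp [heatKernel, mul_comm]

omit hp hp0 hνp in
theorem integrable_translate_prod {f : E → ℝ} (hf : Integrable f) (hs : 0 < s) :
    Integrable (fun q : E × E => f (q.1 + q.2)) ((heatMeasure E s).prod volume) := by
  have := isProbabilityMeasure_heatMeasure (E := E) hs
  exact (measurePreserving_prod_add (heatMeasure E s)
    (volume : Measure E)).integrable_comp_of_integrable (hf.comp_snd (heatMeasure E s))

/-- Adding an independent Gaussian increases the entropy: the heat flow averages translates of the
density, and `-u log u` is concave. -/
theorem integral_negMulLog_le_heatFlow (hν : Integrable (fun x => ‖x‖ ^ 2) ν)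
    (hlog : Integrable fun x => Real.negMulLog (p x)) (hs : 0 < s) :
    ∫ x, Real.negMulLog (p x) ≤ ∫ y, Real.negMulLog (heatFlow ν s y) := by
  have := isProbabilityMeasure_heatMeasure (E := E) hs
  have hpi := integrable_of_eq_withDensity hp hp0 hνp
  have h1 := integrable_translate_prod hlog hs
  have h2 : ∫ y, ∫ r, Real.negMulLog (p (y + r)) ∂(heatMeasure E s) =
      ∫ x, Real.negMulLog (p x) := by
    rw [integral_integral_swap (f := fun y r => Real.negMulLog (p (y + r)))
      (h1.swap.congr (Eventually.of_forall fun q => by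
        simp [Function.uncurry, add_comm]))]
    simp_rw [integral_add_right_eq_self (fun y => Real.negMulLog (p y))]
    simp
  rw [← h2]
  refine integral_mono_ae (h1.integral_prod_right.congr (Eventually.of_forall fun y => by
    simp [add_comm])) (integrable_negMulLog_heatFlow hν hs) (Eventually.of_forall fun y => ?_)
  simp only
  rw [heatFlow_eq_integral_translate hp hp0 hνp hs]
  exact Real.concaveOn_negMulLog.le_map_integral Real.continuous_negMulLog.continuousOn
    isClosed_Ici (Eventually.of_forall fun r => hp0 _) (integrable_translate_heatMeasure hpi hs y)
    (integrable_translate_heatMeasure hlog hs y)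

theorem integral_abs_heatFlow_sub_le (hs : 0 < s) :
    ∫ y, |heatFlow ν s y - p y| ≤ ∫ z, (∫ y, |p (Real.sqrt s • z + y) - p y|) ∂(stdGaussian E) := by
  have := isProbabilityMeasure_heatMeasure (E := E) hs
  have hpi := integrable_of_eq_withDensity hp hp0 hνp
  have h1 : Integrable (fun q : E × E => |p (q.1 + q.2) - p q.2|)
      ((heatMeasure E s).prod volume) :=
    ((integrable_translate_prod hpi hs).sub (hpi.comp_snd (heatMeasure E s))).abs
  have h2 : ∫ z, (∫ y, |p (Real.sqrt s • z + y) - p y|) ∂(stdGaussian E) =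
      ∫ y, ∫ r, |p (r + y) - p y| ∂(heatMeasure E s) := by
    rw [← integral_integral_swap (f := fun r y => |p (r + y) - p y|) h1, ← map_smul_stdGaussian hs,
      integral_map (by fun_prop)
      (continuous_integral_abs_translate_sub hpi).aestronglyMeasurable]
  rw [h2]
  refine integral_mono_of_nonneg (Eventually.of_forall fun y => abs_nonneg _)
    h1.integral_prod_right (Eventually.of_forall fun y => ?_)
  simp only
  rw [heatFlow_eq_integral_translate hp hp0 hνp hs]
  have h3 : ∫ r, p (y + r) ∂(heatMeasure E s) - p y =
      ∫ r, (p (r + y) - p y) ∂(heatMeasure E s) := by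
    have h4 := integrable_translate_heatMeasure hpi hs y
    simp_rw [add_comm _ y]
    rw [integral_sub h4 (integrable_const _)]
    simp
  rw [h3]
  exact abs_integral_le_integral_abs

/-- The heat flow converges to its initial density in `L¹`. -/
theorem tendsto_integral_abs_heatFlow_sub :
    Tendsto (fun s => ∫ y, |heatFlow ν s y - p y|) (𝓝[>] 0) (𝓝 0) := by
  have hpi := integrable_of_eq_withDensity hp hp0 hνp
  have hc := continuous_integral_abs_translate_sub hpi
  have h1 : Tendsto (fun s => ∫ z, (∫ y, |p (Real.sqrt s • z + y) - p y|) ∂(stdGaussian E))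
      (𝓝[>] 0) (𝓝 (∫ _, (0 : ℝ) ∂(stdGaussian E))) := by
    refine tendsto_integral_filter_of_dominated_convergence (fun _ => 2 * ∫ y, |p y|)
      (Eventually.of_forall fun s => (hc.comp (by fun_prop)).aestronglyMeasurable)
      (Eventually.of_forall fun s => Eventually.of_forall fun z => ?_) (integrable_const _)
      (Eventually.of_forall fun z => ?_)
    · rw [Real.norm_of_nonneg (integral_nonneg fun _ => abs_nonneg _)]
      have h2 := hpi.comp_add_left (Real.sqrt s • z)
      have h3 := integral_mono (h2.sub hpi).abs (h2.abs.add hpi.abs) (fun y => abs_sub _ _)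
      simp only [Pi.add_apply, Pi.sub_apply] at h3
      rw [integral_add h2.abs hpi.abs,
        integral_add_left_eq_self (fun y => |p y|) (Real.sqrt s • z)] at h3
      linarith
    · have h2 : Tendsto (fun s : ℝ => Real.sqrt s • z) (𝓝[>] 0) (𝓝 0) := by
        have : Continuous fun s : ℝ => Real.sqrt s • z := by fun_prop
        have h := this.tendsto 0
        simp only [Real.sqrt_zero, zero_smul] at h
        exact h.mono_left nhdsWithin_le_nhds
      have h3 := (hc.tendsto 0).comp h2
      simpa [Function.comp_def] using h3
  simp only [integral_zero] at h1
  exact tendsto_of_tendsto_of_tendsto_of_le_of_le' tendsto_const_nhds h1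
    (Eventually.of_forall fun s => integral_nonneg fun _ => abs_nonneg _)
    (eventually_mem_nhdsWithin.mono fun s hs => integral_abs_heatFlow_sub_le hp hp0 hνp hs)

theorem exists_subseq_tendsto_heatFlow (hν : Integrable (fun x => ‖x‖ ^ 2) ν) {t : ℕ → ℝ}
    (ht0 : ∀ n, 0 < t n) (ht : Tendsto t atTop (𝓝[>] 0)) :
    ∃ k : ℕ → ℕ, StrictMono k ∧
      ∀ᵐ y, Tendsto (fun n => heatFlow ν (t (k n)) y) atTop (𝓝 (p y)) := by
  have hpi := integrable_of_eq_withDensity hp hp0 hνp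
  have h1 := (tendsto_integral_abs_heatFlow_sub hp hp0 hνp).comp ht
  have h2 : Tendsto (fun n => eLpNorm (heatFlow ν (t n) - p) 1 volume) atTop (𝓝 0) := by
    have h3 := (ENNReal.continuous_ofReal.tendsto 0).comp h1
    rw [ENNReal.ofReal_zero] at h3
    refine h3.congr fun n => ?_
    rw [eLpNorm_one_eq_lintegral_enorm,
      ← ofReal_integral_norm_eq_lintegral_enorm ((integrable_heatFlow hν (ht0 n)).sub hpi)]
    rfl
  exact (tendstoInMeasure_of_tendsto_eLpNorm one_ne_zero
    (fun n => (continuous_heatFlow (ht0 n)).aestronglyMeasurable) hp.aestronglyMeasurable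
    h2).exists_seq_tendsto_ae

omit hp hp0 hνp in
/-- A form of Fatou's lemma: nonnegative functions that converge almost everywhere, with integrals
asymptotically at most that of the limit, have convergent integrals. -/
theorem tendsto_integral_of_ae_tendsto_of_le {α : Type*} [MeasurableSpace α] {m : Measure α}
    {f : ℕ → α → ℝ} {g : α → ℝ} (hf : ∀ n, Integrable (f n) m) (hf0 : ∀ n x, 0 ≤ f n x)
    (hg : Integrable g m) (hfg : ∀ᵐ x ∂m, Tendsto (fun n => f n x) atTop (𝓝 (g x)))
    {c : ℕ → ℝ} (hc : Tendsto c atTop (𝓝 (∫ x, g x ∂m))) (hle : ∀ n, ∫ x, f n x ∂m ≤ c n) :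
    Tendsto (fun n => ∫ x, f n x ∂m) atTop (𝓝 (∫ x, g x ∂m)) := by
  have hg0 : 0 ≤ᵐ[m] g := by
    filter_upwards [hfg] with x hx
    exact ge_of_tendsto' hx fun n => hf0 n x
  refine tendsto_order.2 ⟨fun b hb => ?_, fun b hb => ?_⟩
  · rcases lt_or_ge b 0 with hb0 | hb0
    · exact Eventually.of_forall fun n => hb0.trans_le (integral_nonneg (hf0 n))
    have h1 : ENNReal.ofReal (∫ x, g x ∂m) ≤
        liminf (fun n => ENNReal.ofReal (∫ x, f n x ∂m)) atTop := by
      simp_rw [ofReal_integral_eq_lintegral_ofReal (hf _) (Eventually.of_forall (hf0 _)),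
        ofReal_integral_eq_lintegral_ofReal hg hg0]
      refine le_trans (le_of_eq (lintegral_congr_ae ?_))
        (lintegral_liminf_le' fun n => (hf n).aestronglyMeasurable.aemeasurable.ennreal_ofReal)
      filter_upwards [hfg] with x hx
      exact ((ENNReal.continuous_ofReal.tendsto _).comp hx).liminf_eq.symm
    have h2 : ENNReal.ofReal b < liminf (fun n => ENNReal.ofReal (∫ x, f n x ∂m)) atTop :=
      lt_of_lt_of_le ((ENNReal.ofReal_lt_ofReal_iff_of_nonneg hb0).2 hb) h1
    filter_upwards [eventually_lt_of_lt_liminf h2] with n hn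
    exact (ENNReal.ofReal_lt_ofReal_iff_of_nonneg hb0).1 hn
  · filter_upwards [hc.eventually_lt_const hb] with n hn
    exact (hle n).trans_lt hn

/-- The entropy is continuous along the heat flow at the initial time. The relative entropy with
respect to the standard Gaussian is lower semicontinuous by Fatou's lemma, which bounds the entropy
from above in the limit, and adding a Gaussian does not decrease the entropy. -/
theorem tendsto_integral_negMulLog_heatFlow (hν : Integrable (fun x => ‖x‖ ^ 2) ν)
    (hlog : Integrable fun x => Real.negMulLog (p x)) :
    Tendsto (fun s => ∫ y, Real.negMulLog (heatFlow ν s y)) (𝓝[>] 0)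
      (𝓝 (∫ x, Real.negMulLog (p x))) := by
  have hpi := integrable_of_eq_withDensity hp hp0 hνp
  have hp2 : Integrable fun x => ‖x‖ ^ 2 * p x := by
    have h := hν
    rw [hνp, integrable_withDensity_ofReal_iff hp hp0] at h
    simpa [mul_comm] using h
  have hp2' : ∫ x, ‖x‖ ^ 2 * p x = ∫ x, ‖x‖ ^ 2 ∂ν := by
    rw [hνp, integral_withDensity_ofReal hp hp0]
    simp [mul_comm]
  refine tendsto_of_subseq_tendsto fun t ht => ?_
  obtain ⟨N, hN⟩ := eventually_atTop.1 (ht.eventually (self_mem_nhdsWithin (s := Ioi (0 : ℝ))))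
  have ht0 : ∀ n, 0 < t (n + N) := fun n => hN _ (Nat.le_add_left _ _)
  have ht' : Tendsto (fun n => t (n + N)) atTop (𝓝[>] 0) := (tendsto_add_atTop_iff_nat N).2 ht
  obtain ⟨k, hk, hae⟩ := exists_subseq_tendsto_heatFlow hp hp0 hνp hν ht0 ht'
  refine ⟨fun n => k n + N, ?_⟩
  have htk : Tendsto (fun n => t (k n + N)) atTop (𝓝 0) :=
    (ht'.comp hk.tendsto_atTop).mono_right nhdsWithin_le_nhds
  set A := Module.finrank ℝ E / 2 * Real.log (2 * Real.pi) with hA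
  set I := ∫ x, ‖x‖ ^ 2 ∂ν with hI
  have hval : ∀ n, ∫ y, relEntropyIntegrand y (heatFlow ν (t (k n + N)) y) =
      A + (I + t (k n + N) * gaussianMoment E) / 2 -
        ∫ y, Real.negMulLog (heatFlow ν (t (k n + N)) y) := fun n => by
    rw [integral_relEntropyIntegrand (integrable_heatFlow hν (ht0 _))
      (integrable_sq_norm_mul_heatFlow hν (ht0 _)) (integrable_negMulLog_heatFlow hν (ht0 _))
      (integral_heatFlow (ht0 _)), integral_sq_norm_mul_heatFlow hν (ht0 _)]
  have hval' : ∫ y, relEntropyIntegrand y (p y) =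
      A + I / 2 - ∫ y, Real.negMulLog (p y) := by
    rw [integral_relEntropyIntegrand hpi hp2 hlog (integral_of_eq_withDensity hp hp0 hνp), hp2']
  have hc : Tendsto (fun n => A + (I + t (k n + N) * gaussianMoment E) / 2) atTop
      (𝓝 (A + I / 2)) := by
    have := (((htk.mul_const (gaussianMoment E)).const_add I).div_const 2).const_add A
    simpa using this
  have key := tendsto_integral_of_ae_tendsto_of_le
    (f := fun n y => relEntropyIntegrand y (heatFlow ν (t (k n + N)) y))
    (g := fun y => relEntropyIntegrand y (p y)) (m := volume)
    (c := fun n => A + (I + t (k n + N) * gaussianMoment E) / 2 - ∫ y, Real.negMulLog (p y))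
    (fun n => integrable_relEntropyIntegrand (integrable_heatFlow hν (ht0 _))
      (integrable_sq_norm_mul_heatFlow hν (ht0 _)) (integrable_negMulLog_heatFlow hν (ht0 _)))
    (fun n y => relEntropyIntegrand_nonneg y (heatFlow_pos (ht0 _) y).le)
    (integrable_relEntropyIntegrand hpi hp2 hlog)
    (hae.mono fun y hy => ((continuous_relEntropyIntegrand y).tendsto _).comp hy)
    (by rw [hval']; exact hc.sub_const _)
    (fun n => by
      rw [hval]
      exact sub_le_sub_left (integral_negMulLog_le_heatFlow hp hp0 hνp hν hlog (ht0 _)) _)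
  rw [hval'] at key
  simp_rw [hval] at key
  have := hc.sub key
  simpa using this

end Density

end

section

variable {E : Type*} [NormedAddCommGroup E] [InnerProductSpace ℝ E] [MeasurableSpace E]
  [BorelSpace E] [FiniteDimensional ℝ E]
variable {F : Type*} [NormedAddCommGroup F] [InnerProductSpace ℝ F] [MeasurableSpace F]
  [BorelSpace F] [FiniteDimensional ℝ F]
variable {ν : Measure E} [IsProbabilityMeasure ν] {s t : ℝ}

/-! ### Finiteness of the entropy -/

theorem stdGaussian_eq_heatMeasure : stdGaussian E = heatMeasure E 1 := by
  rw [← map_smul_stdGaussian one_pos]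
  simp

theorem volume_absolutelyContinuous_stdGaussian : (volume : Measure E) ≪ stdGaussian E := by
  rw [stdGaussian_eq_heatMeasure]
  refine withDensity_absolutelyContinuous'
    (continuous_heatKernel 1).measurable.ennreal_ofReal.aemeasurable
    (Eventually.of_forall fun y => ?_)
  simpa using heatKernel_pos one_pos y

theorem stdGaussian_absolutelyContinuous_volume : stdGaussian E ≪ volume := by
  rw [stdGaussian_eq_heatMeasure]
  exact withDensity_absolutelyContinuous _ _

theorem integrable_log_heatKernel (hν : Integrable (fun x => ‖x‖ ^ 2) ν) :
    Integrable (fun x => Real.log (heatKernel 1 x)) ν := by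
  simp_rw [log_heatKernel one_pos]
  exact (integrable_const _).sub (hν.div_const _)

/-- Given a finite second moment, finite entropy amounts to finite relative entropy with respect
to the standard Gaussian. -/
theorem finiteEntropy_iff_integrable_llr (hν : Integrable (fun x => ‖x‖ ^ 2) ν) :
    FiniteEntropy ν ↔ ν ≪ stdGaussian E ∧ Integrable (llr ν (stdGaussian E)) ν := by
  have hac : ν ≪ volume ↔ ν ≪ stdGaussian E :=
    ⟨fun h => h.trans volume_absolutelyContinuous_stdGaussian,
      fun h => h.trans stdGaussian_absolutelyContinuous_volume⟩
  have hint : ν ≪ volume → ((Integrable fun x => Real.negMulLog (ν.rnDeriv volume x).toReal) ↔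
      Integrable (llr ν (stdGaussian E)) ν) := fun h => by
    have h1 : llr ν (stdGaussian E) =ᵐ[ν]
        fun x => Real.log (ν.rnDeriv volume x).toReal - Real.log (heatKernel 1 x) := by
      have h2 := Measure.rnDeriv_withDensity_right ν (volume : Measure E)
        (f := fun y => ENNReal.ofReal (heatKernel 1 y))
        (continuous_heatKernel 1).measurable.ennreal_ofReal.aemeasurable
        (Eventually.of_forall fun y => by simpa using heatKernel_pos one_pos y)
        (Eventually.of_forall fun y => ENNReal.ofReal_ne_top)
      filter_upwards [h.ae_le h2, Measure.rnDeriv_pos h, h.ae_le (Measure.rnDeriv_lt_top ν volume)]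
        with x hx hpos' hlt
      have hpos := ENNReal.toReal_pos hpos'.ne' hlt.ne
      rw [llr, stdGaussian_eq_heatMeasure, heatMeasure, hx, ENNReal.toReal_mul, ENNReal.toReal_inv,
        ENNReal.toReal_ofReal (heatKernel_pos one_pos x).le,
        Real.log_mul (inv_ne_zero (heatKernel_pos one_pos x).ne') hpos.ne', Real.log_inv]
      ring
    have h3 : (Integrable fun x => Real.negMulLog (ν.rnDeriv volume x).toReal) ↔
        Integrable (fun x => Real.log (ν.rnDeriv volume x).toReal) ν := by
      rw [← integrable_rnDeriv_smul_iff h, ← integrable_neg_iff]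
      refine integrable_congr (Eventually.of_forall fun x => ?_)
      simp [Real.negMulLog]
    rw [h3, integrable_congr h1]
    exact ⟨fun h => h.sub (integrable_log_heatKernel hν), fun h =>
      (h.add (integrable_log_heatKernel hν)).congr (Eventually.of_forall fun x => by simp)⟩
  exact ⟨fun h => ⟨hac.1 h.1, (hint h.1).1 h.2⟩,
    fun h => ⟨hac.2 h.1, (hint (hac.2 h.1)).2 h.2⟩⟩

/-- Co-isometries preserve finiteness of the entropy, by the data processing inequality for the
relative entropy with respect to the standard Gaussian. -/
theorem finiteEntropy_map_of_coisometry {A : E →L[ℝ] F} (hA : A ∘L A.adjoint = .id ℝ F)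
    (hν : Integrable (fun x => ‖x‖ ^ 2) ν) (h : FiniteEntropy ν) : FiniteEntropy (ν.map A) := by
  have hAm := A.continuous.measurable
  have := Measure.isProbabilityMeasure_map (μ := ν) hAm.aemeasurable
  rw [finiteEntropy_iff_integrable_llr (integrable_sq_norm_map hν A),
    ← map_stdGaussian_of_coisometry hA]
  -- the standard Gaussian is mapped to the standard Gaussian
  have h1 := (finiteEntropy_iff_integrable_llr hν).1 h
  exact ⟨h1.1.map hAm, InformationTheory.integrable_llr_map h1.1 hAm h1.2⟩

theorem finiteEntropy_of_eq_withDensity {p : E → ℝ} (hp : Measurable p) (hp0 : ∀ x, 0 ≤ p x)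
    (hνp : ν = volume.withDensity fun x => ENNReal.ofReal (p x))
    (hlog : Integrable fun x => Real.negMulLog (p x)) : FiniteEntropy ν := by
  refine ⟨hνp ▸ withDensity_absolutelyContinuous _ _, hlog.congr ?_⟩
  have h := Measure.rnDeriv_withDensity (volume : Measure E) hp.ennreal_ofReal
  rw [← hνp] at h
  filter_upwards [h] with x hx
  rw [hx, ENNReal.toReal_ofReal (hp0 x)]

theorem finiteEntropy_flowLaw (hν : Integrable (fun x => ‖x‖ ^ 2) ν) (hs : 0 < s) :
    FiniteEntropy (flowLaw ν s) := by
  have := isProbabilityMeasure_flowLaw (ν := ν) hs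
  exact finiteEntropy_of_eq_withDensity (continuous_heatFlow hs).measurable
    (fun y => (heatFlow_pos hs y).le) rfl (integrable_negMulLog_heatFlow hν hs)

theorem entropy_flowLaw (hs : 0 < s) :
    entropy (flowLaw ν s) = ∫ y, Real.negMulLog (heatFlow ν s y) := by
  have := isProbabilityMeasure_flowLaw (ν := ν) hs
  exact entropy_eq_of_eq_withDensity (continuous_heatFlow hs).measurable
    (fun y => (heatFlow_pos hs y).le) rfl

/-! ### The Ornstein-Uhlenbeck flow of a law -/

/-- The law of `e^{-t} X` for `X` of law `ν`. -/
def dilate (ν : Measure E) (t : ℝ) : Measure E :=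
  ν.map fun x => Real.exp (-t) • x

/-- The law at time `t` of the Ornstein-Uhlenbeck flow started from `ν`. -/
def ouLaw (ν : Measure E) (t : ℝ) : Measure E :=
  (ν.prod (stdGaussian E)).map fun p =>
    Real.exp (-t) • p.1 + Real.sqrt (1 - Real.exp (-2 * t)) • p.2

/-- The score of `ouLaw ν t`, for `t > 0`, using that the flow is a heat flow run for time
`1 - exp (-2 t)` and started from a dilated law. -/
def ouScore (ν : Measure E) (t : ℝ) : E → E :=
  heatScore (dilate ν t) (1 - Real.exp (-2 * t))

/-- The trace of the Fisher information matrix of `ouLaw ν t`, for `t > 0`. -/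
def ouFisher (ν : Measure E) (t : ℝ) : ℝ :=
  heatFisher (dilate ν t) (1 - Real.exp (-2 * t))

instance isProbabilityMeasure_dilate : IsProbabilityMeasure (dilate ν t) :=
  Measure.isProbabilityMeasure_map (by fun_prop)

theorem one_sub_exp_pos (ht : 0 < t) : 0 < 1 - Real.exp (-2 * t) := by
  have : Real.exp (-2 * t) < 1 := by
    rw [Real.exp_lt_one_iff]
    linarith
  linarith

theorem integrable_sq_norm_dilate (hν : Integrable (fun x => ‖x‖ ^ 2) ν) :
    Integrable (fun x => ‖x‖ ^ 2) (dilate ν t) :=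
  integrable_sq_norm_map hν (Real.exp (-t) • ContinuousLinearMap.id ℝ E)

theorem integral_sq_norm_dilate :
    ∫ x, ‖x‖ ^ 2 ∂(dilate ν t) = Real.exp (-t) ^ 2 * ∫ x, ‖x‖ ^ 2 ∂ν := by
  rw [dilate, integral_map (by fun_prop) (Continuous.aestronglyMeasurable (by fun_prop)),
    ← integral_const_mul]
  congr 1 with x
  rw [norm_smul, mul_pow, Real.norm_of_nonneg (Real.exp_pos _).le]

theorem dilate_map (A : E →L[ℝ] F) : dilate (ν.map A) t = (dilate ν t).map A := by
  rw [dilate, dilate, Measure.map_map (by fun_prop) (by fun_prop),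
    Measure.map_map (by fun_prop) (by fun_prop)]
  congr 1
  ext x
  simp

/-- `ouLaw` depends on the law of the starting point only. -/
theorem map_ou_eq_ouLaw {Ω : Type*} [MeasurableSpace Ω] {P : Measure Ω} [IsProbabilityMeasure P]
    {X Z : Ω → E} (hX : Measurable X) (hZ : Measurable Z) (hZlaw : P.map Z = stdGaussian E)
    (hXZ : IndepFun X Z P) (t : ℝ) :
    P.map (fun ω => Real.exp (-t) • X ω + Real.sqrt (1 - Real.exp (-2 * t)) • Z ω) =
      ouLaw (P.map X) t := by
  rw [ouLaw, ← hZlaw, ← (indepFun_iff_map_prod_eq_prod_map_map hX.aemeasurable hZ.aemeasurable).1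
    hXZ, Measure.map_map (by fun_prop) (hX.prodMk hZ)]
  rfl

theorem ouLaw_zero : ouLaw ν 0 = ν := by
  simp [ouLaw, Measure.map_fst_prod]

theorem ouLaw_eq_flowLaw (ht : 0 < t) :
    ouLaw ν t = flowLaw (dilate ν t) (1 - Real.exp (-2 * t)) := by
  have hs := one_sub_exp_pos ht
  have := isProbabilityMeasure_heatMeasure (E := E) hs
  rw [← map_add_prod_heatMeasure hs, ← map_smul_stdGaussian hs, dilate,
    Measure.map_prod_map _ _ (by fun_prop) (by fun_prop), Measure.map_map (by fun_prop)
    (by fun_prop)]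
  rfl

/-- The variance of the Ornstein-Uhlenbeck flow, in terms of that of the heat flow. -/
theorem one_sub_exp_eq (t : ℝ) :
    1 - Real.exp (-2 * t) = Real.exp (-t) ^ 2 * (Real.exp (2 * t) - 1) := by
  rw [← Real.exp_nat_mul, mul_sub, ← Real.exp_add]
  have h1 : ((2 : ℕ) : ℝ) * -t + 2 * t = 0 := by push_cast; ring
  have h2 : ((2 : ℕ) : ℝ) * -t = -2 * t := by push_cast; ring
  rw [h1, h2, Real.exp_zero, mul_one]

theorem exp_sub_one_pos (ht : 0 < t) : 0 < Real.exp (2 * t) - 1 := by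
  have : 1 < Real.exp (2 * t) := by
    rw [Real.one_lt_exp_iff]
    linarith
  linarith

/-- The Ornstein-Uhlenbeck flow at time `t` is the heat flow at time `exp (2 t) - 1`, dilated by
`exp (-t)`. -/
theorem entropy_ouLaw (hν : Integrable (fun x => ‖x‖ ^ 2) ν) (ht : 0 < t) :
    entropy (ouLaw ν t) = (∫ y, Real.negMulLog (heatFlow ν (Real.exp (2 * t) - 1) y)) -
      Module.finrank ℝ E * t := by
  rw [ouLaw_eq_flowLaw ht, entropy_flowLaw (one_sub_exp_pos ht), one_sub_exp_eq, dilate,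
    integral_negMulLog_heatFlow_map_smul hν (Real.exp_pos _) (exp_sub_one_pos ht), Real.log_exp]
  ring

theorem ouFisher_eq (ht : 0 < t) :
    ouFisher ν t = Real.exp (2 * t) * heatFisher ν (Real.exp (2 * t) - 1) := by
  rw [ouFisher, one_sub_exp_eq, dilate, heatFisher_map_smul (Real.exp_pos _) (exp_sub_one_pos ht),
    ← Real.exp_neg, neg_neg, ← Real.exp_nat_mul]
  norm_cast

theorem ouFisher_nonneg (ht : 0 < t) : 0 ≤ ouFisher ν t :=
  integral_nonneg fun y => mul_nonneg (heatFlow_pos (one_sub_exp_pos ht) y).le (sq_nonneg _)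

/-- **De Bruijn's identity** along the Ornstein-Uhlenbeck flow. -/
theorem hasDerivAt_entropy_ouLaw (hν : Integrable (fun x => ‖x‖ ^ 2) ν) (ht : 0 < t) :
    HasDerivAt (fun t => entropy (ouLaw ν t)) (ouFisher ν t - Module.finrank ℝ E) t := by
  have h1 : HasDerivAt (fun t : ℝ => Real.exp (2 * t) - 1) (Real.exp (2 * t) * 2) t := by
    simpa using (((hasDerivAt_id t).const_mul 2).exp).sub_const 1
  have h2 := (hasDerivAt_integral_negMulLog_heatFlow hν (exp_sub_one_pos ht)).comp t h1
  have h3 := h2.sub ((hasDerivAt_id t).const_mul (Module.finrank ℝ E : ℝ))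
  refine (h3.congr_of_eventuallyEq ?_).congr_deriv ?_
  · filter_upwards [lt_mem_nhds ht] with u hu
    rw [entropy_ouLaw hν hu]
    rfl
  · rw [ouFisher_eq ht]
    ring

theorem finiteEntropy_ouLaw (hν : Integrable (fun x => ‖x‖ ^ 2) ν) (h : FiniteEntropy ν)
    (ht : 0 ≤ t) : FiniteEntropy (ouLaw ν t) := by
  rcases ht.eq_or_lt with rfl | ht
  · rwa [ouLaw_zero]
  · rw [ouLaw_eq_flowLaw ht]
    exact finiteEntropy_flowLaw (integrable_sq_norm_dilate hν) (one_sub_exp_pos ht)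

theorem continuousOn_entropy_ouLaw (hν : Integrable (fun x => ‖x‖ ^ 2) ν) (h : FiniteEntropy ν) :
    ContinuousOn (fun t => entropy (ouLaw ν t)) (Ici 0) := by
  intro t ht
  rcases (show (0 : ℝ) ≤ t from ht).eq_or_lt with rfl | ht
  · rw [← continuousWithinAt_Ioi_iff_Ici, ContinuousWithinAt, ouLaw_zero]
    have hνp : ν = volume.withDensity fun x =>
        ENNReal.ofReal (ν.rnDeriv volume x).toReal := by
      conv_lhs => rw [← Measure.withDensity_rnDeriv_eq ν volume h.1]
      refine withDensity_congr_ae ?_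
      filter_upwards [Measure.rnDeriv_lt_top ν volume] with x hx
      rw [ENNReal.ofReal_toReal hx.ne]
    have h1 := tendsto_integral_negMulLog_heatFlow
      (Measure.measurable_rnDeriv ν volume).ennreal_toReal (fun _ => ENNReal.toReal_nonneg) hνp hν
      h.2
    have h2 : Tendsto (fun t : ℝ => Real.exp (2 * t) - 1) (𝓝[>] 0) (𝓝[>] 0) := by
      refine tendsto_nhdsWithin_iff.2 ⟨?_, eventually_mem_nhdsWithin.mono fun t ht =>
        exp_sub_one_pos ht⟩
      have : Continuous fun t : ℝ => Real.exp (2 * t) - 1 := by fun_prop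
      have h3 := (this.tendsto 0).mono_left (nhdsWithin_le_nhds (s := Ioi 0))
      simpa using h3
    have h4 : Tendsto (fun t : ℝ => (Module.finrank ℝ E : ℝ) * t) (𝓝[>] 0) (𝓝 0) := by
      have : Continuous fun t : ℝ => (Module.finrank ℝ E : ℝ) * t := by fun_prop
      have h3 := (this.tendsto 0).mono_left (nhdsWithin_le_nhds (s := Ioi 0))
      simpa using h3
    have h5 := (h1.comp h2).sub h4
    rw [sub_zero] at h5
    refine h5.congr' (eventually_mem_nhdsWithin.mono fun t ht => ?_)
    exact (entropy_ouLaw hν ht).symm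
  · exact (hasDerivAt_entropy_ouLaw hν ht).continuousAt.continuousWithinAt

/-- The Fisher information is integrable up to time zero, where it may be infinite: it is, up to a
constant, the nonnegative derivative of a function that is continuous at zero. -/
theorem intervalIntegrable_ouFisher (hν : Integrable (fun x => ‖x‖ ^ 2) ν) (h : FiniteEntropy ν)
    (ht : 0 ≤ t) : IntervalIntegrable (ouFisher ν) volume 0 t := by
  rw [intervalIntegrable_iff_integrableOn_Ioc_of_le ht]
  refine intervalIntegral.integrableOn_deriv_of_nonneg
    (g := fun t => entropy (ouLaw ν t) + Module.finrank ℝ E * t)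
    (((continuousOn_entropy_ouLaw hν h).mono Icc_subset_Ici_self).add (by fun_prop))
    (fun x hx => ?_) fun x hx => ouFisher_nonneg hx.1
  have h1 := (hasDerivAt_entropy_ouLaw hν hx.1).add
    ((hasDerivAt_id x).const_mul (Module.finrank ℝ E : ℝ))
  exact h1.congr_deriv (by ring)

/-- The integrated form of de Bruijn's identity. -/
theorem entropy_ouLaw_sub_entropy (hν : Integrable (fun x => ‖x‖ ^ 2) ν) (h : FiniteEntropy ν)
    (ht : 0 ≤ t) : entropy (ouLaw ν t) - entropy ν =
      (∫ u in (0 : ℝ)..t, ouFisher ν u) - Module.finrank ℝ E * t := by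
  have hint := intervalIntegrable_ouFisher hν h ht
  have h1 := intervalIntegral.integral_eq_sub_of_hasDerivAt_of_le ht
    ((continuousOn_entropy_ouLaw hν h).mono Icc_subset_Ici_self)
    (fun x hx => hasDerivAt_entropy_ouLaw hν hx.1) (hint.sub intervalIntegrable_const)
  rw [intervalIntegral.integral_sub hint intervalIntegrable_const, ouLaw_zero] at h1
  rw [← h1]
  simp [mul_comm]

/-- A lower bound that is sharp as `t → ∞`, from the entropy of the Gaussian component. -/
theorem le_entropy_ouLaw (hν : Integrable (fun x => ‖x‖ ^ 2) ν) (ht : 0 < t) :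
    Module.finrank ℝ E / 2 * Real.log (2 * Real.pi * (1 - Real.exp (-2 * t))) +
      gaussianMoment E / 2 ≤ entropy (ouLaw ν t) := by
  rw [ouLaw_eq_flowLaw ht, entropy_flowLaw (one_sub_exp_pos ht)]
  exact le_integral_negMulLog_heatFlow (integrable_sq_norm_dilate hν) (one_sub_exp_pos ht)

/-- An upper bound that is sharp as `t → ∞`, from the second moment. -/
theorem entropy_ouLaw_le (hν : Integrable (fun x => ‖x‖ ^ 2) ν) (ht : 0 < t) :
    entropy (ouLaw ν t) ≤ Module.finrank ℝ E / 2 * Real.log (2 * Real.pi) +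
      (Real.exp (-t) ^ 2 * ∫ x, ‖x‖ ^ 2 ∂ν + (1 - Real.exp (-2 * t)) * gaussianMoment E) / 2 := by
  rw [ouLaw_eq_flowLaw ht, entropy_flowLaw (one_sub_exp_pos ht), ← integral_sq_norm_dilate]
  exact integral_negMulLog_heatFlow_le (integrable_sq_norm_dilate hν) (one_sub_exp_pos ht)

theorem ouFisher_eq_integral (ht : 0 < t) :
    ouFisher ν t = ∫ y, ‖ouScore ν t y‖ ^ 2 ∂(ouLaw ν t) := by
  rw [ouLaw_eq_flowLaw ht]
  exact heatFisher_eq_integral_flowLaw (one_sub_exp_pos ht)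

theorem memLp_ouScore (hν : Integrable (fun x => ‖x‖ ^ 2) ν) (ht : 0 < t) :
    MemLp (ouScore ν t) 2 (ouLaw ν t) := by
  rw [ouLaw_eq_flowLaw ht]
  exact memLp_heatScore (integrable_sq_norm_dilate hν) (one_sub_exp_pos ht)

/-- The Fisher information inequality along the Ornstein-Uhlenbeck flow, see `heatFisher_map_le`. -/
theorem ouFisher_map_le {A : E →L[ℝ] F} (hA : A ∘L A.adjoint = .id ℝ F)
    (hν : Integrable (fun x => ‖x‖ ^ 2) ν) (ht : 0 < t) :
    ouFisher (ν.map A) t ≤ ∫ y, ‖A (ouScore ν t y)‖ ^ 2 ∂(ouLaw ν t) := by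
  rw [ouLaw_eq_flowLaw ht, ouFisher, dilate_map]
  exact heatFisher_map_le hA (integrable_sq_norm_dilate hν) (one_sub_exp_pos ht)

end

section

variable {E : Type*} [NormedAddCommGroup E] [InnerProductSpace ℝ E] [MeasurableSpace E]
  [BorelSpace E] [FiniteDimensional ℝ E]
variable {ι : Type*} [Fintype ι] {s t : ℝ}

/-! ### Euclidean products -/

/-! Random vectors with `n` blocks in `E` are regarded as elements of the Hilbert sum `PiLp 2`, so
that the heat flow of the whole vector is covered by the results for a general Euclidean space. -/

theorem heatKernel_piLp (hs : 0 < s) (x : PiLp 2 fun _ : ι => E) :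
    heatKernel s x = ∏ i, heatKernel s (x i) := by
  have hpos : 0 < 2 * Real.pi * s := by positivity
  have hdim : Module.finrank ℝ (PiLp 2 fun _ : ι => E) = Fintype.card ι * Module.finrank ℝ E := by
    rw [(WithLp.linearEquiv 2 ℝ (ι → E)).finrank_eq, Module.finrank_pi_fintype]
    simp
  simp only [heatKernel]
  rw [Finset.prod_mul_distrib, Finset.prod_const, ← Real.exp_sum, PiLp.norm_sq_eq_of_L2, hdim,
    Finset.card_univ, ← Finset.sum_div, Finset.sum_neg_distrib, ← Real.rpow_natCast,
    ← Real.rpow_mul hpos.le]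
  congr 2
  push_cast
  ring

/-- The Euclidean and the product structures define the same volume. Both are Haar measures, and
both give mass one to the Gaussian density. -/
theorem map_toLp_volume :
    (volume : Measure (ι → E)).map (WithLp.toLp 2) = (volume : Measure (PiLp 2 fun _ : ι => E)) := by
  have h0 : (volume : Measure (ι → E)).map (WithLp.toLp 2) =
      (volume : Measure (ι → E)).map (PiLp.continuousLinearEquiv 2 ℝ fun _ : ι => E).symm := rfl
  have hH : ((volume : Measure (ι → E)).map
      (WithLp.toLp 2 : (ι → E) → PiLp 2 fun _ : ι => E)).IsAddHaarMeasure := by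
    rw [h0]
    exact (PiLp.continuousLinearEquiv 2 ℝ fun _ : ι => E).symm.isAddHaarMeasure_map _
  have h1 := Measure.isAddLeftInvariant_eq_smul ((volume : Measure (ι → E)).map
    (WithLp.toLp 2 : (ι → E) → PiLp 2 fun _ : ι => E)) volume
  have h2 : ∫ x, heatKernel 1 x ∂((volume : Measure (ι → E)).map
      (WithLp.toLp 2 : (ι → E) → PiLp 2 fun _ : ι => E)) = 1 := by
    rw [integral_map (by fun_prop) (continuous_heatKernel 1).aestronglyMeasurable]
    simp_rw [heatKernel_piLp one_pos]
    rw [integral_fintype_prod_volume_eq_prod]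
    simp [integral_heatKernel one_pos]
  rw [h1] at h2 ⊢
  rw [integral_smul_nnreal_measure, integral_heatKernel one_pos] at h2
  have h3 : (Measure.addHaarScalarFactor ((volume : Measure (ι → E)).map
    (WithLp.toLp 2 : (ι → E) → PiLp 2 fun _ : ι => E)) volume) = 1 := by
    ext
    simpa [NNReal.smul_def] using h2
  rw [h3, one_smul]

theorem map_ofLp_volume :
    (volume : Measure (PiLp 2 fun _ : ι => E)).map WithLp.ofLp = (volume : Measure (ι → E)) := by
  rw [← map_toLp_volume, Measure.map_map (by fun_prop) (by fun_prop)]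
  exact Measure.map_id

/-- The map `x ↦ ∑ i, l i • x i`, a co-isometry if the squared weights sum to one. The projection
onto the `i`-th block is the case `l = Pi.single i 1`. -/
def weightedSumL (l : ι → ℝ) : (PiLp 2 fun _ : ι => E) →L[ℝ] E :=
  ∑ i, l i • PiLp.proj 2 (fun _ : ι => E) i

theorem weightedSumL_apply (l : ι → ℝ) (x : PiLp 2 fun _ : ι => E) :
    weightedSumL l x = ∑ i, l i • x i := by
  simp [weightedSumL]

theorem weightedSumL_coisometry {l : ι → ℝ} (hl : ∑ i, l i ^ 2 = 1) :
    (weightedSumL l : (PiLp 2 fun _ : ι => E) →L[ℝ] E) ∘L (weightedSumL l).adjoint = .id ℝ E := by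
  have h : (weightedSumL l : (PiLp 2 fun _ : ι => E) →L[ℝ] E).adjoint =
      ((PiLp.continuousLinearEquiv 2 ℝ fun _ : ι => E).symm : (ι → E) →L[ℝ] _) ∘L
        ContinuousLinearMap.pi fun i => l i • ContinuousLinearMap.id ℝ E := by
    symm
    rw [ContinuousLinearMap.eq_adjoint_iff]
    intro x y
    simp [weightedSumL_apply, PiLp.inner_apply, inner_sum, inner_smul_left, inner_smul_right]
  rw [h]
  ext v
  simp [weightedSumL_apply, smul_smul, ← Finset.sum_smul, ← pow_two, hl]

theorem weightedSumL_single [DecidableEq ι] (i : ι) (x : PiLp 2 fun _ : ι => E) :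
    weightedSumL (Pi.single i 1) x = x i := by
  rw [weightedSumL_apply, Finset.sum_eq_single i]
  · simp
  · intro j _ hj
    simp [hj]
  · simp

theorem sum_single_sq [DecidableEq ι] (i : ι) : ∑ j, (Pi.single i 1 : ι → ℝ) j ^ 2 = 1 := by
  rw [Finset.sum_eq_single i]
  · simp
  · intro j _ hj
    simp [hj]
  · simp

/-! ### The Fisher information matrix along the flow -/

variable {ν : Measure (PiLp 2 fun _ : ι => E)} [IsProbabilityMeasure ν]

/-- The Fisher information matrix of `ouLaw ν t`, for `t > 0`. -/
def ouFisherMatrix (ν : Measure (PiLp 2 fun _ : ι => E)) (t : ℝ) : Matrix ι ι ℝ :=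
  Matrix.of fun i j => ∫ y, (inner ℝ (ouScore ν t y i) (ouScore ν t y j) : ℝ) ∂(ouLaw ν t)

theorem memLp_ouScore_apply (hν : Integrable (fun x => ‖x‖ ^ 2) ν) (ht : 0 < t) (i : ι) :
    MemLp (fun y => ouScore ν t y i) 2 (ouLaw ν t) :=
  (PiLp.proj 2 (fun _ : ι => E) i : (PiLp 2 fun _ : ι => E) →L[ℝ] E).comp_memLp'
    (memLp_ouScore hν ht)

theorem integrable_inner_ouScore (hν : Integrable (fun x => ‖x‖ ^ 2) ν) (ht : 0 < t) (i j : ι) :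
    Integrable (fun y => (inner ℝ (ouScore ν t y i) (ouScore ν t y j) : ℝ)) (ouLaw ν t) :=
  integrable_inner_of_memLp (memLp_ouScore_apply hν ht i) (memLp_ouScore_apply hν ht j)

theorem integral_norm_sq_weightedSumL (hν : Integrable (fun x => ‖x‖ ^ 2) ν) (ht : 0 < t)
    (l : ι → ℝ) : ∫ y, ‖weightedSumL l (ouScore ν t y)‖ ^ 2 ∂(ouLaw ν t) =
      l ⬝ᵥ (ouFisherMatrix ν t).mulVec l := by
  have h1 : ∀ y, ‖weightedSumL l (ouScore ν t y)‖ ^ 2 =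
      ∑ i, ∑ j, l i * l j * inner ℝ (ouScore ν t y i) (ouScore ν t y j) := fun y => by
    rw [← real_inner_self_eq_norm_sq, weightedSumL_apply, sum_inner]
    refine Finset.sum_congr rfl fun i _ => ?_
    rw [inner_sum]
    refine Finset.sum_congr rfl fun j _ => ?_
    rw [real_inner_smul_left, real_inner_smul_right, mul_assoc]
  simp_rw [h1]
  have hint := fun i j => (integrable_inner_ouScore hν ht i j).const_mul (l i * l j)
  rw [integral_finsetSum _ fun i _ => integrable_finsetSum _ fun j _ => hint i j]
  simp only [dotProduct, Matrix.mulVec, ouFisherMatrix, Matrix.of_apply, Finset.mul_sum]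
  refine Finset.sum_congr rfl fun i _ => ?_
  rw [integral_finsetSum _ fun j _ => hint i j]
  refine Finset.sum_congr rfl fun j _ => ?_
  rw [integral_const_mul]
  ring

/-- The Fisher information of a normalized weighted sum is at most the corresponding value of the
quadratic form of the Fisher information matrix. -/
theorem ouFisher_map_weightedSumL_le (hν : Integrable (fun x => ‖x‖ ^ 2) ν) (ht : 0 < t)
    {l : ι → ℝ} (hl : ∑ i, l i ^ 2 = 1) :
    ouFisher (ν.map (weightedSumL l)) t ≤ l ⬝ᵥ (ouFisherMatrix ν t).mulVec l := by
  rw [← integral_norm_sq_weightedSumL hν ht]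
  exact ouFisher_map_le (weightedSumL_coisometry hl) hν ht

theorem abs_ouFisherMatrix_le (hν : Integrable (fun x => ‖x‖ ^ 2) ν) (ht : 0 < t) (i j : ι) :
    |ouFisherMatrix ν t i j| ≤ ouFisher ν t := by
  rw [ouFisher_eq_integral ht]
  refine (abs_integral_le_integral_abs).trans (integral_mono
    (integrable_inner_ouScore hν ht i j).abs
    ((memLp_ouScore hν ht).integrable_norm_pow (by norm_num)) fun y => ?_)
  have h : ∀ k, ‖ouScore ν t y k‖ ≤ ‖ouScore ν t y‖ := fun k => PiLp.norm_apply_le _ k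
  calc |(inner ℝ (ouScore ν t y i) (ouScore ν t y j) : ℝ)|
      ≤ ‖ouScore ν t y i‖ * ‖ouScore ν t y j‖ := abs_real_inner_le_norm _ _
    _ ≤ ‖ouScore ν t y‖ * ‖ouScore ν t y‖ := by gcongr <;> apply h
    _ = ‖ouScore ν t y‖ ^ 2 := by ring

section Measurability

/-! Joint measurability in time and space makes the Fisher information matrix a measurable function
of time. -/

variable {μ : Measure E} [IsProbabilityMeasure μ]

theorem heatFlow_dilate (s t : ℝ) (y : E) :
    heatFlow (dilate μ t) s y = ∫ x, heatKernel s (y - Real.exp (-t) • x) ∂μ := by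
  rw [heatFlow, dilate, integral_map (by fun_prop)]
  exact ((continuous_heatKernel s).comp (by fun_prop)).aestronglyMeasurable

theorem heatGrad_dilate (s t : ℝ) (y : E) :
    heatGrad (dilate μ t) s y = -(s⁻¹ • ∫ x, heatKernel s (y - Real.exp (-t) • x) •
      (y - Real.exp (-t) • x) ∂μ) := by
  rw [heatGrad, heatAvg, dilate, integral_map (by fun_prop)]
  · rfl
  · exact (((continuous_heatKernel s).comp (by fun_prop)).smul
      (by fun_prop)).aestronglyMeasurable

theorem measurable_heatKernel_dilate : Measurable fun p : (ℝ × E) × E =>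
    heatKernel (1 - Real.exp (-2 * p.1.1)) (p.1.2 - Real.exp (-p.1.1) • p.2) :=
  measurable_uncurry_heatKernel.comp
    (g := fun p : ℝ × E => heatKernel p.1 p.2)
    (f := fun p : (ℝ × E) × E => (1 - Real.exp (-2 * p.1.1), p.1.2 - Real.exp (-p.1.1) • p.2))
    (by fun_prop)

theorem measurable_heatFlow_dilate :
    Measurable fun p : ℝ × E => heatFlow (dilate μ p.1) (1 - Real.exp (-2 * p.1)) p.2 := by
  simp_rw [heatFlow_dilate]
  exact (measurable_heatKernel_dilate.stronglyMeasurable.integral_prod_right').measurable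

theorem measurable_ouScore : Measurable fun p : ℝ × E => ouScore μ p.1 p.2 := by
  have h : Measurable fun p : ℝ × E =>
      heatGrad (dilate μ p.1) (1 - Real.exp (-2 * p.1)) p.2 := by
    simp_rw [heatGrad_dilate]
    have h1 : Measurable fun p : (ℝ × E) × E =>
        heatKernel (1 - Real.exp (-2 * p.1.1)) (p.1.2 - Real.exp (-p.1.1) • p.2) •
          (p.1.2 - Real.exp (-p.1.1) • p.2) :=
      measurable_heatKernel_dilate.smul (by fun_prop)
    have h2 := (h1.stronglyMeasurable.integral_prod_right' (ν := μ)).measurable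
    exact ((show Measurable fun p : ℝ × E => (1 - Real.exp (-2 * p.1))⁻¹ by fun_prop).smul h2).neg
  exact (measurable_heatFlow_dilate.inv.smul h).neg

end Measurability

theorem intervalIntegrable_ouFisherMatrix (hν : Integrable (fun x => ‖x‖ ^ 2) ν) (i j : ι)
    (h : IntervalIntegrable (ouFisher ν) volume 0 t) (ht : 0 ≤ t) :
    IntervalIntegrable (fun u => ouFisherMatrix ν u i j) volume 0 t := by
  rw [intervalIntegrable_iff_integrableOn_Ioc_of_le ht] at h ⊢
  -- for `u > 0` this parametric integral is the matrix entry
  have hm : StronglyMeasurable fun u : ℝ => ∫ y, heatFlow (dilate ν u) (1 - Real.exp (-2 * u)) y *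
      inner ℝ (ouScore ν u y i) (ouScore ν u y j) := by
    have h1 : ∀ k, Measurable fun p : ℝ × (PiLp 2 fun _ : ι => E) => ouScore ν p.1 p.2 k :=
      fun k => (PiLp.proj 2 (𝕜 := ℝ) (fun _ : ι => E) k).continuous.measurable.comp
        measurable_ouScore
    exact (measurable_heatFlow_dilate.mul
      ((h1 i).inner (h1 j))).stronglyMeasurable.integral_prod_right'
  refine h.mono' (hm.aestronglyMeasurable.congr ?_)
    ((ae_restrict_mem measurableSet_Ioc).mono fun u hu => abs_ouFisherMatrix_le hν hu.1 i j)
  refine (ae_restrict_mem measurableSet_Ioc).mono fun u hu => ?_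
  simp only [ouFisherMatrix, Matrix.of_apply]
  rw [ouLaw_eq_flowLaw hu.1, integral_flowLaw
    (one_sub_exp_pos hu.1)]
  rfl

end

section

variable {E : Type*} [NormedAddCommGroup E] [InnerProductSpace ℝ E] [MeasurableSpace E]
  [BorelSpace E] [FiniteDimensional ℝ E]
variable {ι : Type*} [Fintype ι] {s t : ℝ}

/-! ### Block gradients and product laws -/

/-- The blocks of the full gradient are the gradients in the single blocks. -/
theorem hasGradientAt_comp_update [DecidableEq ι] {f : (PiLp 2 fun _ : ι => E) → ℝ}
    {x : ι → E} {G : PiLp 2 fun _ : ι => E} (hf : HasFDerivAt f (innerSL ℝ G) (WithLp.toLp 2 x))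
    (i : ι) : HasGradientAt (fun z => f (WithLp.toLp 2 (Function.update x i z))) (G i) (x i) := by
  have h1 : HasFDerivAt (fun z : E => (WithLp.toLp 2 (Function.update x i z) :
      PiLp 2 fun _ : ι => E)) (((PiLp.continuousLinearEquiv 2 ℝ fun _ : ι => E).symm :
        (ι → E) →L[ℝ] _) ∘L ContinuousLinearMap.pi
          (Pi.single i (ContinuousLinearMap.id ℝ E))) (x i) :=
    (((PiLp.continuousLinearEquiv 2 ℝ fun _ : ι => E).symm :
      (ι → E) →L[ℝ] (PiLp 2 fun _ : ι => E)).hasFDerivAt (x := Function.update x i (x i))).comp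
      (x i) (hasFDerivAt_update x (x i))
  rw [← Function.update_eq_self i x] at hf
  have h2 := hf.comp (x i) h1
  rw [hasGradientAt_iff_hasFDerivAt]
  refine h2.congr_fderiv ?_
  ext v
  simp only [ContinuousLinearMap.comp_apply, innerSL_apply_apply, PiLp.inner_apply,
    InnerProductSpace.toDual_apply_apply]
  rw [Finset.sum_eq_single i]
  · simp
  · intro j _ hj
    simp [hj]
  · simp

theorem hasGradientAt_prod_update [DecidableEq ι] {f : ι → E → ℝ} {x : ι → E} {i : ι} {g : E}
    (hf : HasGradientAt (f i) g (x i)) :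
    HasGradientAt (fun z => ∏ j, f j (Function.update x i z j))
      ((∏ j ∈ Finset.univ.erase i, f j (x j)) • g) (x i) := by
  have h : (fun z => ∏ j, f j (Function.update x i z j)) =
      fun z => (∏ j ∈ Finset.univ.erase i, f j (x j)) * f i z := by
    ext z
    rw [← Finset.prod_erase_mul _ _ (Finset.mem_univ i)]
    congr 1
    · exact Finset.prod_congr rfl fun j hj => by
        rw [Function.update_of_ne (Finset.ne_of_mem_erase hj)]
    · simp
  rw [h]
  rw [hasGradientAt_iff_hasFDerivAt] at hf ⊢
  refine (hf.const_mul _).congr_fderiv ?_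
  simp

variable {μ : ι → Measure E} [∀ i, IsProbabilityMeasure (μ i)]

theorem heatFlow_map_toLp_pi (hs : 0 < s) (y : PiLp 2 fun _ : ι => E) :
    heatFlow ((Measure.pi μ).map (WithLp.toLp 2)) s y = ∏ i, heatFlow (μ i) s (y i) := by
  rw [heatFlow, integral_map (by fun_prop)
    (show Continuous fun x => heatKernel s (y - x) from
      (continuous_heatKernel s).comp (by fun_prop)).aestronglyMeasurable]
  simp_rw [heatKernel_piLp hs]
  exact integral_fintype_prod_eq_prod fun i x => heatKernel s (y i - x)

instance isProbabilityMeasure_map_toLp_pi : IsProbabilityMeasure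
    ((Measure.pi μ).map (WithLp.toLp 2 : (ι → E) → PiLp 2 fun _ : ι => E)) :=
  Measure.isProbabilityMeasure_map (by fun_prop)

theorem hasGradientAt_heatFlow {ν : Measure E} [IsProbabilityMeasure ν] (hs : 0 < s) (y : E) :
    HasGradientAt (heatFlow ν s) (heatGrad ν s y) y := by
  rw [hasGradientAt_iff_hasFDerivAt]
  exact hasFDerivAt_heatFlow hs y

/-- The score of a product law acts coordinatewise, since the heat flow factorizes. -/
theorem heatScore_map_toLp_pi (hs : 0 < s) (y : PiLp 2 fun _ : ι => E) (i : ι) :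
    heatScore ((Measure.pi μ).map (WithLp.toLp 2)) s y i = heatScore (μ i) s (y i) := by
  classical
  have h1 := hasGradientAt_comp_update (x := WithLp.ofLp y) (hasFDerivAt_heatFlow
    (ν := (Measure.pi μ).map (WithLp.toLp 2)) hs (WithLp.toLp 2 (WithLp.ofLp y))) i
  simp_rw [heatFlow_map_toLp_pi hs] at h1
  have h2 := hasGradientAt_prod_update (f := fun j => heatFlow (μ j) s) (x := WithLp.ofLp y)
    (hasGradientAt_heatFlow hs (y i))
  have h3 := h1.unique h2
  have hne : (∏ j ∈ Finset.univ.erase i, heatFlow (μ j) s (y j)) ≠ 0 :=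
    Finset.prod_ne_zero_iff.2 fun j _ => (heatFlow_pos hs _).ne'
  simp only [heatScore, PiLp.neg_apply, PiLp.smul_apply]
  rw [show heatGrad ((Measure.pi μ).map (WithLp.toLp 2)) s y i = _ from h3,
    heatFlow_map_toLp_pi hs, ← Finset.prod_erase_mul _ _ (Finset.mem_univ i), smul_smul, mul_inv,
    mul_right_comm, inv_mul_cancel₀ hne, one_mul]

theorem dilate_map_toLp_pi (t : ℝ) :
    dilate ((Measure.pi μ).map (WithLp.toLp 2 : (ι → E) → PiLp 2 fun _ : ι => E)) t =
      (Measure.pi fun i => dilate (μ i) t).map (WithLp.toLp 2) := by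
  rw [dilate, Measure.map_map (by fun_prop) (by fun_prop)]
  simp only [dilate]
  rw [← Measure.pi_map_pi fun i => by fun_prop, Measure.map_map (by fun_prop) (by fun_prop)]
  rfl

theorem ouScore_map_toLp_pi (ht : 0 < t) (y : PiLp 2 fun _ : ι => E) (i : ι) :
    ouScore ((Measure.pi μ).map (WithLp.toLp 2)) t y i = ouScore (μ i) t (y i) := by
  rw [ouScore, dilate_map_toLp_pi, heatScore_map_toLp_pi (one_sub_exp_pos ht)]
  rfl

theorem charFun_ouLaw {ν : Measure E} [IsProbabilityMeasure ν] (v : E) :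
    charFun (ouLaw ν t) v = charFun ν (Real.exp (-t) • v) *
      charFun (stdGaussian E) (Real.sqrt (1 - Real.exp (-2 * t)) • v) := by
  rw [charFun_apply, ouLaw, integral_map (by fun_prop)
    (Continuous.aestronglyMeasurable (by fun_prop)), charFun_apply, charFun_apply,
    ← integral_prod_mul]
  congr 1 with p
  rw [← Complex.exp_add, inner_add_left, real_inner_smul_left, real_inner_smul_left,
    real_inner_smul_right, real_inner_smul_right]
  push_cast
  ring_nf

instance isProbabilityMeasure_ouLaw {ν : Measure E} [IsProbabilityMeasure ν] :
    IsProbabilityMeasure (ouLaw ν t) :=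
  Measure.isProbabilityMeasure_map (by fun_prop)

theorem map_toLp_pi_stdGaussian :
    (Measure.pi fun _ : ι => stdGaussian E).map (WithLp.toLp 2) =
      stdGaussian (PiLp 2 fun _ : ι => E) := by
  apply Measure.ext_of_charFun
  ext v
  simp_rw [charFun_stdGaussian, charFun_pi, charFun_stdGaussian, ← Complex.exp_sum,
    ← Complex.ofReal_pow, PiLp.norm_sq_eq_of_L2]
  simp [Finset.sum_div, neg_div]

/-- The Ornstein-Uhlenbeck flow preserves independence of the coordinates. -/
theorem ouLaw_map_toLp_pi :
    ouLaw ((Measure.pi μ).map (WithLp.toLp 2 : (ι → E) → PiLp 2 fun _ : ι => E)) t =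
      (Measure.pi fun i => ouLaw (μ i) t).map (WithLp.toLp 2) := by
  apply Measure.ext_of_charFun
  ext v
  rw [charFun_ouLaw, charFun_pi, charFun_pi, ← map_toLp_pi_stdGaussian, charFun_pi,
    ← Finset.prod_mul_distrib]
  simp_rw [charFun_ouLaw]
  rfl

/-- The score is centred. This is Tweedie's formula with a constant test function. -/
theorem integral_ouScore {ν : Measure E} [IsProbabilityMeasure ν]
    (hν : Integrable (fun x => ‖x‖ ^ 2) ν) (ht : 0 < t) :
    ∫ y, ouScore ν t y ∂(ouLaw ν t) = 0 := by
  have hs := one_sub_exp_pos ht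
  have := isProbabilityMeasure_heatMeasure (E := E) hs
  have hid : Integrable (fun r : E => r) (heatMeasure E (1 - Real.exp (-2 * t))) := by
    rw [← map_smul_stdGaussian hs, integrable_map_measure (by fun_prop) (by fun_prop)]
    exact IsGaussian.integrable_id.smul _
  have h0 : ∫ r : E, r ∂(heatMeasure E (1 - Real.exp (-2 * t))) = 0 := by
    rw [← map_smul_stdGaussian hs, integral_map (by fun_prop) (by fun_prop), integral_smul,
      integral_id_stdGaussian, smul_zero]
  have hint := (memLp_ouScore hν ht).integrable (by norm_num)
  refine ext_inner_right ℝ fun v => ?_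
  have h1 := integral_inner_heatScore (ν := dilate ν t) hs (φ := fun _ => v)
    (Integrable.comp_snd (f := fun r : E => (inner ℝ r v : ℝ)) (hid.inner_const v) (dilate ν t))
  rw [integral_fun_snd (f := fun r : E => (inner ℝ r v : ℝ))] at h1
  have h2 : ∫ r : E, (inner ℝ r v : ℝ) ∂(heatMeasure E (1 - Real.exp (-2 * t))) = 0 := by
    simp_rw [fun r : E => real_inner_comm v r]
    rw [integral_inner hid, h0, inner_zero_right]
  rw [h2, smul_zero, mul_zero] at h1
  rw [inner_zero_left, real_inner_comm, ← integral_inner hint, ouLaw_eq_flowLaw ht, ← h1]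
  exact integral_congr_ae (Eventually.of_forall fun y => real_inner_comm _ _)

/-- The Fisher information matrix of a product law is diagonal, because the scores of the blocks
are independent and centred. -/
theorem ouFisherMatrix_map_toLp_pi [DecidableEq ι]
    (hμ : ∀ i, Integrable (fun x => ‖x‖ ^ 2) (μ i)) (ht : 0 < t) :
    ouFisherMatrix ((Measure.pi μ).map (WithLp.toLp 2)) t =
      Matrix.diagonal fun i => ouFisher (μ i) t := by
  ext i j
  simp only [ouFisherMatrix, Matrix.of_apply, ouScore_map_toLp_pi ht]
  rw [ouLaw_map_toLp_pi, ← MeasurableEquiv.coe_toLp, integral_map_equiv]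
  simp only [MeasurableEquiv.coe_toLp]
  have hmp := fun i => measurePreserving_eval (fun i => ouLaw (μ i) t) i
  have hL := fun i => (memLp_ouScore (hμ i) ht).comp_measurePreserving (hmp i)
  rcases eq_or_ne i j with rfl | hij
  · rw [Matrix.diagonal_apply_eq, ouFisher_eq_integral ht]
    simp_rw [real_inner_self_eq_norm_sq]
    rw [← (hmp i).map_eq, integral_map (hmp i).measurable.aemeasurable]
    rw [(hmp i).map_eq]
    exact (memLp_ouScore (hμ i) ht).1.norm.pow 2
  · rw [Matrix.diagonal_apply_ne _ hij]
    have hind := (iIndepFun_pi (μ := fun i => ouLaw (μ i) t) (X := fun i => ouScore (μ i) t)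
      fun i => (memLp_ouScore (hμ i) ht).1.aemeasurable).indepFun hij
    have h := hind.integral_bilin ((hL i).integrable (by norm_num))
      ((hL j).integrable (by norm_num)) (innerSL ℝ)
    have h0 : ∫ x, ouScore (μ i) t (x i) ∂(Measure.pi fun i => ouLaw (μ i) t) = 0 := by
      rw [← integral_ouScore (hμ i) ht, ← (hmp i).map_eq, integral_map (hmp i).measurable.aemeasurable]
      rw [(hmp i).map_eq]
      exact (memLp_ouScore (hμ i) ht).1
    rw [h0] at h
    rw [map_zero, zero_apply] at h
    exact h

end

section

variable {E : Type*} [NormedAddCommGroup E] [InnerProductSpace ℝ E] [MeasurableSpace E]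
  [BorelSpace E] [FiniteDimensional ℝ E]
variable {F : Type*} [NormedAddCommGroup F] [InnerProductSpace ℝ F] [MeasurableSpace F]
  [BorelSpace F] [FiniteDimensional ℝ F]
variable {ι : Type*} [Fintype ι] {s t : ℝ}

/-! ### The deficit along the flow -/

theorem map_ouLaw_of_coisometry {ν : Measure E} [IsProbabilityMeasure ν] {A : E →L[ℝ] F}
    (hA : A ∘L A.adjoint = .id ℝ F) : (ouLaw ν t).map A = ouLaw (ν.map A) t := by
  have := Measure.isProbabilityMeasure_map (μ := ν) (f := A) (by fun_prop)
  have := Measure.isProbabilityMeasure_map (μ := ouLaw ν t) (f := A) (by fun_prop)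
  apply Measure.ext_of_charFun
  ext v
  rw [charFun_map_continuousLinearMap, charFun_ouLaw, charFun_ouLaw,
    charFun_map_continuousLinearMap, ← map_stdGaussian_of_coisometry hA,
    charFun_map_continuousLinearMap, map_smul, map_smul]

/-- The deficit in the linearized entropy power inequality for the blocks of a vector of
law `ν`. -/
def entropyDeficit [DecidableEq ι] (l : ι → ℝ) (ν : Measure (PiLp 2 fun _ : ι => E)) : ℝ :=
  entropy (ν.map (weightedSumL l)) - ∑ i, l i ^ 2 * entropy (ν.map (weightedSumL (Pi.single i 1)))

variable [DecidableEq ι] {ν : Measure (PiLp 2 fun _ : ι => E)} [IsProbabilityMeasure ν] {l : ι → ℝ}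

instance isProbabilityMeasure_map_weightedSumL :
    IsProbabilityMeasure (ν.map (weightedSumL l)) :=
  Measure.isProbabilityMeasure_map (by fun_prop)

theorem entropyDeficit_ouLaw (hl : ∑ i, l i ^ 2 = 1) :
    entropyDeficit l (ouLaw ν t) = entropy (ouLaw (ν.map (weightedSumL l)) t) -
      ∑ i, l i ^ 2 * entropy (ouLaw (ν.map (weightedSumL (Pi.single i 1))) t) := by
  simp only [entropyDeficit]
  rw [map_ouLaw_of_coisometry (weightedSumL_coisometry hl)]
  simp_rw [fun i : ι => map_ouLaw_of_coisometry (ν := ν) (t := t)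
    (weightedSumL_coisometry (E := E) (sum_single_sq i))]

/-- The deficit grows along the flow at most like the integrated gap between the Fisher
information matrix and the Fisher informations of the blocks. The contributions `-d t` in
de Bruijn's identity cancel because the squared weights sum to one. -/
theorem entropyDeficit_ouLaw_le (hν : Integrable (fun x => ‖x‖ ^ 2) ν) (h : FiniteEntropy ν)
    (hl : ∑ i, l i ^ 2 = 1) (ht : 0 ≤ t) :
    entropyDeficit l (ouLaw ν t) ≤ entropyDeficit l ν +
      ∑ i, ∑ j, l i * l j * ∫ u in (0 : ℝ)..t, (ouFisherMatrix ν u i j - Matrix.diagonal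
        (fun i => ouFisher (ν.map (weightedSumL (Pi.single i 1))) u) i j) := by
  have hA := weightedSumL_coisometry (E := E) hl
  have hAi := fun i : ι => weightedSumL_coisometry (E := E) (sum_single_sq i)
  have hJ := intervalIntegrable_ouFisher (integrable_sq_norm_map hν _)
    (finiteEntropy_map_of_coisometry hA hν h) ht
  have hJi := fun i => intervalIntegrable_ouFisher (integrable_sq_norm_map hν _)
    (finiteEntropy_map_of_coisometry (hAi i) hν h) ht
  have h1 := entropy_ouLaw_sub_entropy (integrable_sq_norm_map hν _)
    (finiteEntropy_map_of_coisometry hA hν h) ht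
  have h2 := fun i => entropy_ouLaw_sub_entropy (integrable_sq_norm_map hν _)
    (finiteEntropy_map_of_coisometry (hAi i) hν h) ht
  have hM := fun i j => intervalIntegrable_ouFisherMatrix hν i j
    (intervalIntegrable_ouFisher hν h ht) ht
  have hD : ∀ i j, IntervalIntegrable (fun u => Matrix.diagonal
      (fun i => ouFisher (ν.map (weightedSumL (Pi.single i 1))) u) i j) volume 0 t := fun i j => by
    rcases eq_or_ne i j with rfl | hij
    · simpa using hJi i
    · simp [hij]
  have h3 : entropyDeficit l (ouLaw ν t) - entropyDeficit l ν =
      (∫ u in (0 : ℝ)..t, ouFisher (ν.map (weightedSumL l)) u) - ∑ i, l i ^ 2 *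
        ∫ u in (0 : ℝ)..t, ouFisher (ν.map (weightedSumL (Pi.single i 1))) u := by
    have h4 : ∀ i, l i ^ 2 * entropy (ouLaw (ν.map (weightedSumL (Pi.single i 1))) t) =
        l i ^ 2 * entropy (ν.map (weightedSumL (Pi.single i 1))) + l i ^ 2 *
          (∫ u in (0 : ℝ)..t, ouFisher (ν.map (weightedSumL (Pi.single i 1))) u) -
          l i ^ 2 * (Module.finrank ℝ E * t) := fun i => by
      linear_combination l i ^ 2 * h2 i
    rw [entropyDeficit_ouLaw hl, entropyDeficit]
    simp_rw [h4]
    rw [Finset.sum_sub_distrib, Finset.sum_add_distrib, ← Finset.sum_mul, hl]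
    linarith
  have h5 : (∫ u in (0 : ℝ)..t, ouFisher (ν.map (weightedSumL l)) u) ≤
      ∑ i, ∑ j, l i * l j * ∫ u in (0 : ℝ)..t, ouFisherMatrix ν u i j := by
    have hint := fun i j => (hM i j).const_mul (l i * l j)
    have hint' : ∀ i, IntervalIntegrable
        (fun u => ∑ j, l i * l j * ouFisherMatrix ν u i j) volume 0 t := fun i => by
      simpa only [Finset.sum_fn] using IntervalIntegrable.sum Finset.univ fun j _ => hint i j
    have hint'' : IntervalIntegrable
        (fun u => ∑ i, ∑ j, l i * l j * ouFisherMatrix ν u i j) volume 0 t := by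
      simpa only [Finset.sum_fn] using IntervalIntegrable.sum Finset.univ fun i _ => hint' i
    have h6 : (∑ i, ∑ j, l i * l j * ∫ u in (0 : ℝ)..t, ouFisherMatrix ν u i j) =
        ∫ u in (0 : ℝ)..t, ∑ i, ∑ j, l i * l j * ouFisherMatrix ν u i j := by
      rw [intervalIntegral.integral_finsetSum fun i _ => hint' i]
      refine Finset.sum_congr rfl fun i _ => ?_
      rw [intervalIntegral.integral_finsetSum fun j _ => hint i j]
      refine Finset.sum_congr rfl fun j _ => ?_
      rw [intervalIntegral.integral_const_mul]
    rw [h6]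
    refine intervalIntegral.integral_mono_on_of_le_Ioo ht hJ hint'' fun u hu => ?_
    refine (ouFisher_map_weightedSumL_le hν hu.1 hl).trans_eq ?_
    simp only [dotProduct, Matrix.mulVec, Finset.mul_sum]
    exact Finset.sum_congr rfl fun i _ => Finset.sum_congr rfl fun j _ => by ring
  have h7 : (∑ i, ∑ j, l i * l j * ∫ u in (0 : ℝ)..t, (Matrix.diagonal
      (fun i => ouFisher (ν.map (weightedSumL (Pi.single i 1))) u) i j)) = ∑ i, l i ^ 2 *
        ∫ u in (0 : ℝ)..t, ouFisher (ν.map (weightedSumL (Pi.single i 1))) u := by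
    refine Finset.sum_congr rfl fun i _ => ?_
    rw [Finset.sum_eq_single i]
    · simp [pow_two]
    · intro j _ hj
      simp [hj.symm]
    · simp
  simp_rw [intervalIntegral.integral_sub (hM _ _) (hD _ _), mul_sub, Finset.sum_sub_distrib]
  rw [h7]
  linarith

/-- The deficit along the flow has a nonnegative lower limit, since all the laws involved become
standard Gaussian. -/
theorem exists_tendsto_le_entropyDeficit (hν : Integrable (fun x => ‖x‖ ^ 2) ν)
    (hl : ∑ i, l i ^ 2 = 1) : ∃ g : ℝ → ℝ, Tendsto g atTop (𝓝 0) ∧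
      ∀ t, 0 < t → g t ≤ entropyDeficit l (ouLaw ν t) := by
  set d : ℝ := (Module.finrank ℝ E : ℝ)
  set κ := gaussianMoment E
  set m : ι → ℝ := fun i => ∫ x, ‖x‖ ^ 2 ∂(ν.map (weightedSumL (Pi.single i 1)))
  refine ⟨fun t => d / 2 * Real.log (2 * Real.pi * (1 - Real.exp (-2 * t))) + κ / 2 -
    ∑ i, l i ^ 2 * (d / 2 * Real.log (2 * Real.pi) +
      (Real.exp (-t) ^ 2 * m i + (1 - Real.exp (-2 * t)) * κ) / 2), ?_, fun t ht => ?_⟩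
  · have e1 : Tendsto (fun t : ℝ => Real.exp (-2 * t)) atTop (𝓝 0) :=
      Real.tendsto_exp_atBot.comp (tendsto_id.const_mul_atTop_of_neg (by norm_num))
    have e2 : Tendsto (fun t : ℝ => Real.exp (-t)) atTop (𝓝 0) :=
      Real.tendsto_exp_atBot.comp tendsto_neg_atTop_atBot
    have e3 : Tendsto (fun t : ℝ => 1 - Real.exp (-2 * t)) atTop (𝓝 1) := by
      simpa using e1.const_sub 1
    have e4 : Tendsto (fun t : ℝ => Real.log (2 * Real.pi * (1 - Real.exp (-2 * t)))) atTop
        (𝓝 (Real.log (2 * Real.pi * 1))) := (e3.const_mul _).log (by positivity)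
    have e5 := ((e4.const_mul (d / 2)).add_const (κ / 2)).sub (tendsto_finsetSum Finset.univ
      fun i _ => (((((e2.pow 2).mul_const (m i)).add (e3.mul_const κ)).div_const 2).const_add
        (d / 2 * Real.log (2 * Real.pi))).const_mul (l i ^ 2))
    convert e5 using 2
    simp only [ne_eq, OfNat.ofNat_ne_zero, not_false_eq_true, zero_pow, zero_mul, zero_add,
      mul_one, one_mul]
    rw [← Finset.sum_mul, hl]
    ring
  · rw [entropyDeficit_ouLaw hl]
    refine sub_le_sub (le_entropy_ouLaw (integrable_sq_norm_map hν _) ht)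
      (Finset.sum_le_sum fun i _ => mul_le_mul_of_nonneg_left
        (entropy_ouLaw_le (integrable_sq_norm_map hν _) ht) (sq_nonneg _))

end

section

/-! ### Random vectors -/

section Transfer

variable {α β : Type*} [MeasureSpace α] [MeasureSpace β] [SigmaFinite (volume : Measure α)]

/-- A volume preserving measurable equivalence preserves finiteness of the entropy. -/
theorem FiniteEntropy.map_equiv {μ : Measure α} [SigmaFinite μ] (h : FiniteEntropy μ)
    (e : α ≃ᵐ β) (he : (volume : Measure α).map e = volume) : FiniteEntropy (μ.map e) := by
  refine ⟨he ▸ h.1.map e.measurable, ?_⟩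
  have h1 := e.measurableEmbedding.rnDeriv_map μ volume
  rw [he] at h1
  rw [← he, integrable_map_equiv]
  refine h.2.congr ?_
  filter_upwards [h1] with x hx
  simp only [Function.comp_apply]
  rw [he, ← hx]

end Transfer

section Euclidean

variable {n d : ℕ} {t : ℝ}
  {ν : Measure (PiLp 2 fun _ : Fin n => EuclideanSpace ℝ (Fin d))} [IsProbabilityMeasure ν]

theorem isSmoothDensity_ouLaw (ht : 0 < t) : IsSmoothDensity ((ouLaw ν t).map WithLp.ofLp)
    fun x => heatFlow (dilate ν t) (1 - Real.exp (-2 * t)) (WithLp.toLp 2 x) := by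
  have hs := one_sub_exp_pos ht
  refine ⟨?_, fun x => (heatFlow_pos hs _).le, ?_⟩
  · have h : ContDiff ℝ 1 (heatFlow (dilate ν t) (1 - Real.exp (-2 * t))) := by
      rw [contDiff_one_iff_hasFDerivAt]
      exact ⟨fun y => innerSL ℝ (heatGrad (dilate ν t) (1 - Real.exp (-2 * t)) y),
        (innerSL ℝ).continuous.comp (continuous_heatGrad hs), hasFDerivAt_heatFlow hs⟩
    exact h.comp (PiLp.continuousLinearEquiv 2 ℝ
      fun _ : Fin n => EuclideanSpace ℝ (Fin d)).symm.contDiff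
  · rw [ouLaw_eq_flowLaw ht, flowLaw]
    ext A hA
    rw [Measure.map_apply (by fun_prop) hA, withDensity_apply _ (by measurability),
      withDensity_apply _ hA, ← map_ofLp_volume, setLIntegral_map hA _ (by fun_prop)]
    exact ((continuous_heatFlow hs).measurable.comp (by fun_prop)).ennreal_ofReal

theorem score_map_ouLaw (ht : 0 < t) (i : Fin n) (x : Fin n → EuclideanSpace ℝ (Fin d)) :
    score ((ouLaw ν t).map WithLp.ofLp) i x = ouScore ν t (WithLp.toLp 2 x) i := by
  have h : blockGradient (fun x => heatFlow (dilate ν t) (1 - Real.exp (-2 * t)) (WithLp.toLp 2 x))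
      i x = heatGrad (dilate ν t) (1 - Real.exp (-2 * t)) (WithLp.toLp 2 x) i := by
    have h0 := hasFDerivAt_heatFlow (ν := dilate ν t) (one_sub_exp_pos ht) (WithLp.toLp 2 x)
    exact (hasGradientAt_comp_update h0 i).gradient
  rw [score, (isSmoothDensity_ouLaw ht).smoothDensity_eq, h, ouScore, heatScore, PiLp.neg_apply,
    PiLp.smul_apply]

theorem fisherMatrix_map_ouLaw (ht : 0 < t) :
    fisherMatrix ((ouLaw ν t).map WithLp.ofLp) = ouFisherMatrix ν t := by
  ext i j
  simp only [fisherMatrix, ouFisherMatrix, Matrix.of_apply, score_map_ouLaw ht]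
  exact integral_map_equiv (MeasurableEquiv.toLp 2 (Fin n → EuclideanSpace ℝ (Fin d))).symm _

theorem finiteFisher_map_ouLaw (hν : Integrable (fun x => ‖x‖ ^ 2) ν) (ht : 0 < t) :
    FiniteFisher ((ouLaw ν t).map WithLp.ofLp) := by
  refine ⟨⟨_, isSmoothDensity_ouLaw ht⟩, fun i => ?_⟩
  rw [funext (score_map_ouLaw (ν := ν) ht i)]
  exact ((MeasurableEquiv.toLp 2 (Fin n → EuclideanSpace ℝ (Fin d))).symm.memLp_map_measure_iff).2
    (memLp_ouScore_apply hν ht i)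

variable {Ω : Type*} [MeasurableSpace Ω] {P : Measure Ω} [IsProbabilityMeasure P]
  {X Z : Fin n → Ω → EuclideanSpace ℝ (Fin d)}

/-- The joint law of `(X_1, …, X_n)` on the Euclidean direct sum of `n` copies of `ℝ^d`, whose norm
is the one adapted to Gaussian vectors. -/
def euclideanLaw (P : Measure Ω) (X : Fin n → Ω → EuclideanSpace ℝ (Fin d)) :
    Measure (PiLp 2 fun _ : Fin n => EuclideanSpace ℝ (Fin d)) :=
  P.map fun ω => WithLp.toLp 2 fun i => X i ω

theorem measurable_toLp_vec (hX : ∀ i, Measurable (X i)) : Measurable fun ω =>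
    (WithLp.toLp 2 fun i => X i ω : PiLp 2 fun _ : Fin n => EuclideanSpace ℝ (Fin d)) :=
  (WithLp.measurable_toLp 2 _).comp (measurable_pi_lambda _ hX)

theorem isProbabilityMeasure_euclideanLaw (hX : ∀ i, Measurable (X i)) :
    IsProbabilityMeasure (euclideanLaw P X) :=
  Measure.isProbabilityMeasure_map (measurable_toLp_vec hX).aemeasurable

theorem map_ofLp_euclideanLaw (hX : ∀ i, Measurable (X i)) :
    (euclideanLaw P X).map WithLp.ofLp = jointLaw P X := by
  rw [euclideanLaw, Measure.map_map (by fun_prop) (measurable_toLp_vec hX)]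
  rfl

theorem map_toLp_jointLaw (hX : ∀ i, Measurable (X i)) :
    (jointLaw P X).map (WithLp.toLp 2) = euclideanLaw P X := by
  rw [jointLaw, Measure.map_map (by fun_prop) (measurable_pi_lambda _ hX)]
  rfl

theorem finiteEntropy_euclideanLaw (hX : ∀ i, Measurable (X i)) (h : FiniteEntropy (jointLaw P X)) :
    FiniteEntropy (euclideanLaw P X) := by
  have : IsProbabilityMeasure (jointLaw P X) :=
    Measure.isProbabilityMeasure_map (measurable_pi_lambda _ hX).aemeasurable
  rw [← map_toLp_jointLaw hX]
  exact h.map_equiv (MeasurableEquiv.toLp 2 _) map_toLp_volume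

theorem integrable_sq_norm_euclideanLaw (hX : ∀ i, Measurable (X i)) (hX2 : ∀ i, MemLp (X i) 2 P) :
    Integrable (fun x => ‖x‖ ^ 2) (euclideanLaw P X) := by
  rw [euclideanLaw, integrable_map_measure (Continuous.aestronglyMeasurable (by fun_prop))
    (measurable_toLp_vec hX).aemeasurable]
  refine (integrable_finsetSum Finset.univ fun i _ =>
    (hX2 i).integrable_norm_pow (by norm_num)).congr (Eventually.of_forall fun ω => ?_)
  simp [PiLp.norm_sq_eq_of_L2]

theorem map_weightedSum (hX : ∀ i, Measurable (X i)) (l : Fin n → ℝ) :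
    P.map (weightedSum l X) = (euclideanLaw P X).map (weightedSumL l) := by
  rw [euclideanLaw, Measure.map_map (by fun_prop) (measurable_toLp_vec hX)]
  congr 1
  ext1 ω
  simp [weightedSum, weightedSumL_apply]

theorem map_eq_map_weightedSumL_single (hX : ∀ i, Measurable (X i)) (i : Fin n) :
    P.map (X i) = (euclideanLaw P X).map (weightedSumL (Pi.single i 1)) := by
  rw [euclideanLaw, Measure.map_map (by fun_prop) (measurable_toLp_vec hX)]
  congr 1
  ext1 ω
  simp [weightedSumL_single]

theorem euclideanLaw_eq_map_pi (hX : ∀ i, Measurable (X i)) (h : iIndepFun X P) :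
    euclideanLaw P X = (Measure.pi fun i => P.map (X i)).map (WithLp.toLp 2) := by
  rw [← map_toLp_jointLaw hX, jointLaw, h.map_fun_eq_pi_map fun i => (hX i).aemeasurable]

theorem measurable_ouFlow (hX : ∀ i, Measurable (X i)) (hZ : ∀ i, Measurable (Z i)) (i : Fin n) :
    Measurable (ouFlow X Z t i) := by
  have h1 := hX i
  have h2 := hZ i
  exact show Measurable fun ω => Real.exp (-t) • X i ω + Real.sqrt (1 - Real.exp (-2 * t)) • Z i ω
    by fun_prop

theorem euclideanLaw_ouFlow (hX : ∀ i, Measurable (X i)) (hZ : ∀ i, Measurable (Z i))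
    (hZlaw : ∀ i, P.map (Z i) = stdGaussian (EuclideanSpace ℝ (Fin d))) (hZind : iIndepFun Z P)
    (hZX : IndepFun (fun ω i => Z i ω) (fun ω i => X i ω) P) :
    euclideanLaw P (ouFlow X Z t) = ouLaw (euclideanLaw P X) t := by
  have hZlaw' : euclideanLaw P Z = stdGaussian _ := by
    rw [euclideanLaw_eq_map_pi hZ hZind]
    simp_rw [hZlaw]
    exact map_toLp_pi_stdGaussian
  exact map_ou_eq_ouLaw (measurable_toLp_vec hX) (measurable_toLp_vec hZ) hZlaw'
    (hZX.symm.comp (φ := WithLp.toLp 2) (ψ := WithLp.toLp 2) (by fun_prop) (by fun_prop)) t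

theorem jointLaw_ouFlow (hX : ∀ i, Measurable (X i)) (hZ : ∀ i, Measurable (Z i))
    (hZlaw : ∀ i, P.map (Z i) = stdGaussian (EuclideanSpace ℝ (Fin d))) (hZind : iIndepFun Z P)
    (hZX : IndepFun (fun ω i => Z i ω) (fun ω i => X i ω) P) :
    jointLaw P (ouFlow X Z t) = (ouLaw (euclideanLaw P X) t).map WithLp.ofLp := by
  rw [← map_ofLp_euclideanLaw (measurable_ouFlow hX hZ),
    euclideanLaw_ouFlow hX hZ hZlaw hZind hZX]

end Euclidean

end

end

end DependentEPI

theorem mainTheorem4 {n d : ℕ} {Ω : Type*} [MeasurableSpace Ω] (P : Measure Ω)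
    [IsProbabilityMeasure P]
    (X X' Z : Fin n → Ω → EuclideanSpace ℝ (Fin d))
    (hX : ∀ i, Measurable (X i)) (hX' : ∀ i, Measurable (X' i)) (hZ : ∀ i, Measurable (Z i))
    -- standing assumptions: second moments, and a joint density `p` with `p log p` integrable
    (hX2 : ∀ i, MemLp (X i) 2 P)
    (hent : FiniteEntropy (jointLaw P X))
    -- `X'` is an independent copy of the marginals
    (hX'ind : iIndepFun X' P)
    (hXX' : ∀ i, IdentDistrib (X i) (X' i) P P)
    -- `Z_1, …, Z_n` are i.i.d. standard Gaussian, independent of `X` and of `X'`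
    (hZlaw : ∀ i, P.map (Z i) = stdGaussian (EuclideanSpace ℝ (Fin d)))
    (hZind : iIndepFun Z P)
    (hZX : IndepFun (fun ω i => Z i ω) (fun ω i => X i ω) P)
    (hZX' : IndepFun (fun ω i => Z i ω) (fun ω i => X' i ω) P)
    (l : Fin n → ℝ) (hl : ∀ i, l i ∈ Set.Ioo (0 : ℝ) 1) (hl2 : ∑ i, l i ^ 2 = 1) :
    -- all the quantities involved are well defined and finite
    ((∀ i, FiniteEntropy (P.map (X i))) ∧ FiniteEntropy (P.map (weightedSum l X)) ∧
      (∀ t, 0 ≤ t → (∀ i, FiniteEntropy (P.map (ouFlow X Z t i))) ∧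
        FiniteEntropy (P.map (weightedSum l (ouFlow X Z t)))) ∧
      (∀ s, 0 < s → FiniteFisher (jointLaw P (ouFlow X Z s)) ∧
        FiniteFisher (jointLaw P (ouFlow X' Z s))) ∧
      (∀ t, 0 ≤ t → ∀ i j, IntervalIntegrable
        (fun s => fisherMatrix (jointLaw P (ouFlow X Z s)) i j -
          fisherMatrix (jointLaw P (ouFlow X' Z s)) i j) volume 0 t)) ∧
    -- the deficit along the flow
    (∀ t, 0 ≤ t →
      entropy (P.map (weightedSum l (ouFlow X Z t)))
          - ∑ i, l i ^ 2 * entropy (P.map (ouFlow X Z t i)) ≤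
        entropy (P.map (weightedSum l X)) - ∑ i, l i ^ 2 * entropy (P.map (X i))
          + l ⬝ᵥ (fisherGap P X X' Z t).mulVec l) ∧
    -- the linearized entropy power inequality, with the upper limit taken in `[-∞, ∞]`
    ((∑ i, l i ^ 2 * entropy (P.map (X i)) : ℝ) : EReal)
        - limsup (fun t : ℝ => ((l ⬝ᵥ (fisherGap P X X' Z t).mulVec l : ℝ) : EReal)) atTop
      ≤ ((entropy (P.map (weightedSum l X)) : ℝ) : EReal) := by
  have hν := integrable_sq_norm_euclideanLaw hX hX2
  have hX2' : ∀ i, MemLp (X' i) 2 P := fun i => (hXX' i).memLp_iff.1 (hX2 i)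
  have hν' := integrable_sq_norm_euclideanLaw hX' hX2'
  have hνent := finiteEntropy_euclideanLaw hX hent
  have := isProbabilityMeasure_euclideanLaw (P := P) hX
  have := isProbabilityMeasure_euclideanLaw (P := P) hX'
  have hY := fun t => euclideanLaw_ouFlow (t := t) hX hZ hZlaw hZind hZX
  have hJ := fun t => jointLaw_ouFlow (t := t) hX hZ hZlaw hZind hZX
  have hJ' := fun t => jointLaw_ouFlow (t := t) hX' hZ hZlaw hZind hZX'
  have hYm := fun t => measurable_ouFlow (t := t) hX hZ
  have hA := weightedSumL_coisometry (E := EuclideanSpace ℝ (Fin d)) hl2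
  have hAi := fun i : Fin n =>
    weightedSumL_coisometry (E := EuclideanSpace ℝ (Fin d)) (sum_single_sq i)
  -- the Fisher information matrices of the two flows
  have hI : ∀ s, 0 < s → fisherMatrix (jointLaw P (ouFlow X Z s)) =
      ouFisherMatrix (euclideanLaw P X) s := fun s hs => by
    rw [hJ, fisherMatrix_map_ouLaw hs]
  have hI' : ∀ s, 0 < s → fisherMatrix (jointLaw P (ouFlow X' Z s)) = Matrix.diagonal fun i =>
      ouFisher ((euclideanLaw P X).map (weightedSumL (Pi.single i 1))) s := fun s hs => by
    have hlaw := euclideanLaw_eq_map_pi hX' hX'ind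
    have hp := fun i => Measure.isProbabilityMeasure_map (μ := P) (hX' i).aemeasurable
    rw [hJ', fisherMatrix_map_ouLaw hs, hlaw, ouFisherMatrix_map_toLp_pi (fun i => ?_) hs]
    · congr 1
      ext i
      rw [← (hXX' i).map_eq, map_eq_map_weightedSumL_single hX]
    · rw [integrable_map_measure (Continuous.aestronglyMeasurable (by fun_prop))
        (hX' i).aemeasurable]
      exact (hX2' i).integrable_norm_pow (by norm_num)
  have hdef : ∀ t, entropy (P.map (weightedSum l (ouFlow X Z t)))
      - ∑ i, l i ^ 2 * entropy (P.map (ouFlow X Z t i)) =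
        entropyDeficit l (ouLaw (euclideanLaw P X) t) := fun t => by
    rw [entropyDeficit, ← hY, map_weightedSum (hYm t)]
    simp_rw [map_eq_map_weightedSumL_single (hYm t)]
  have hdef0 : entropy (P.map (weightedSum l X)) - ∑ i, l i ^ 2 * entropy (P.map (X i)) =
      entropyDeficit l (euclideanLaw P X) := by
    rw [entropyDeficit, map_weightedSum hX]
    simp_rw [map_eq_map_weightedSumL_single hX]
  -- only times in the open interval matter, which avoids the junk value of the matrices at time zero
  have hgap : ∀ t, 0 ≤ t → l ⬝ᵥ (fisherGap P X X' Z t).mulVec l =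
      ∑ i, ∑ j, l i * l j * ∫ u in (0 : ℝ)..t, (ouFisherMatrix (euclideanLaw P X) u i j -
        Matrix.diagonal (fun i => ouFisher
          ((euclideanLaw P X).map (weightedSumL (Pi.single i 1))) u) i j) := fun t ht => by
    simp only [dotProduct, Matrix.mulVec, Finset.mul_sum, fisherGap, Matrix.of_apply]
    refine Finset.sum_congr rfl fun i _ => Finset.sum_congr rfl fun j _ => ?_
    rw [mul_comm _ (l j), ← mul_assoc]
    congr 1
    refine intervalIntegral.integral_congr_Ioo_of_le ht fun u hu => ?_
    rw [hI u hu.1, hI' u hu.1]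
  have hmain : ∀ t, 0 ≤ t → entropyDeficit l (ouLaw (euclideanLaw P X) t) ≤
      entropyDeficit l (euclideanLaw P X) + l ⬝ᵥ (fisherGap P X X' Z t).mulVec l := fun t ht => by
    rw [hgap t ht]
    exact entropyDeficit_ouLaw_le hν hνent hl2 ht
  refine ⟨⟨fun i => ?_, ?_, fun t ht => ⟨fun i => ?_, ?_⟩, fun s hs => ⟨?_, ?_⟩,
    fun t ht i j => ?_⟩, fun t ht => ?_, ?_⟩
  · rw [map_eq_map_weightedSumL_single hX]
    exact finiteEntropy_map_of_coisometry (hAi i) hν hνent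
  · rw [map_weightedSum hX]
    exact finiteEntropy_map_of_coisometry hA hν hνent
  · rw [map_eq_map_weightedSumL_single (hYm t), hY, map_ouLaw_of_coisometry (hAi i)]
    exact finiteEntropy_ouLaw (integrable_sq_norm_map hν _)
      (finiteEntropy_map_of_coisometry (hAi i) hν hνent) ht
  · rw [map_weightedSum (hYm t), hY, map_ouLaw_of_coisometry hA]
    exact finiteEntropy_ouLaw (integrable_sq_norm_map hν _)
      (finiteEntropy_map_of_coisometry hA hν hνent) ht
  · rw [hJ]
    exact finiteFisher_map_ouLaw hν hs
  · rw [hJ']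
    exact finiteFisher_map_ouLaw hν' hs
  · refine ((intervalIntegrable_ouFisherMatrix hν i j
      (intervalIntegrable_ouFisher hν hνent ht) ht).sub (g := fun u => Matrix.diagonal (fun i =>
        ouFisher ((euclideanLaw P X).map (weightedSumL (Pi.single i 1))) u) i j) ?_).congr ?_
    · rcases eq_or_ne i j with rfl | hij
      · simpa using intervalIntegrable_ouFisher (integrable_sq_norm_map hν _)
          (finiteEntropy_map_of_coisometry (hAi i) hν hνent) ht
      · simp [hij]
    · intro u hu
      rw [uIoc_of_le ht] at hu
      simp only [hI u hu.1, hI' u hu.1]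
  · rw [hdef, hdef0]
    exact hmain t ht
  -- `λᵀ R_t λ ≥ D(t) - D(0) ≥ g(t) - D(0)` with `g(t) → 0`
  · obtain ⟨g, hg, hgle⟩ := exists_tendsto_le_entropyDeficit hν hl2
    have h1 : Tendsto (fun t => ((g t - entropyDeficit l (euclideanLaw P X) : ℝ) : EReal)) atTop
        (𝓝 ((0 - entropyDeficit l (euclideanLaw P X) : ℝ) : EReal)) :=
      (continuous_coe_real_ereal.tendsto _).comp (hg.sub_const _)
    have h2 : ((0 - entropyDeficit l (euclideanLaw P X) : ℝ) : EReal) ≤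
        limsup (fun t : ℝ => ((l ⬝ᵥ (fisherGap P X X' Z t).mulVec l : ℝ) : EReal)) atTop := by
      rw [← h1.limsup_eq]
      refine limsup_le_limsup ((eventually_gt_atTop 0).mono fun t ht => ?_)
      rw [EReal.coe_le_coe_iff]
      linarith [hmain t ht.le, hgle t ht]
    refine (EReal.sub_le_sub le_rfl h2).trans_eq ?_
    rw [← EReal.coe_sub, ← hdef0]
    congr 1
    ring
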